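/- **Setting.** Let $k$ be a field. A (right) Leibniz algebra is a $k$-space $\mathcal L$ with a bilinear product $\{\,,\}$ such that $\{\{a,b\},c\}=\{\{a,c\},b\}+\{a,\{b,c\}\}$. A dialgebra is a $k$-space $D$ with two bilinear associative products $\dashv,\vdash$ such that $a\dashv(b\vdash c)=(a\dashv b)\dashv c$, $(a\dashv b)\vdash c=(a\vdash b)\vdash c$ and $a\vdash(b\dashv c)=(a\vdash b)\dashv c$. A Leibniz homomorphism $\delta:\mathcal L\to D$ is a linear map with $\delta\{a,b\}=\delta a\dashv\delta b-\delta b\vdash\delta a$. The free dialgebra $D(X)$ has as linear basis the normal diwords $[u]=x_{-m}\cdots x_{-1}\dot x_0x_1\cdots x_n=x_{-m}\vdash\cdots\vdash x_{-1}\vdash x_0\dashv x_1\dashv\cdots\dashv x_n$ ($m,n\ge 0$, $x_i\in X$) with center $x_0$; $[u]\dashv[v]$ (resp. $[u]\vdash[v]$) is the concatenation $uv$ with the center of $[u]$ (resp. of $[v]$). Write $|[u]|=m+n+1$, let $Id(S)$ be the two-sided ideal generated by $S\subset D(X)$, and $D(X|S)=D(X)/Id(S)$. If $X$ is well ordered,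 normal diwords are ordered by comparing $wt([u])=(n+m+1,m,x_{-m},\dots,x_n)$ lexicographically; $[\bar f]$ is the leading diword of $f\ne0$, $\deg f=|[\bar f]|$, and $f$ is monic if $[\bar f]$ has coefficient $1$. A polynomial $f$ is left (right) normed if in each of its diwords the center is the last (first) letter. For $s\in D(X)$, an $s$-diword $[asb]$ is a normal diword with one letter replaced by $s$ (with $a$, $b$ the words to the left and to the right of $s$). It is normal if $s$ is at the center, or $s$ stands before the center and is left normed, or $s$ stands after the center and is right normed. A normal $s$-diword is a left (right) normed $s$-diword if both $s$ and $[asb]$ are left (right) normed. A set $S$ of monic polynomials is a Gröbner–Shirshov basis in $D(X)$ if for all $f,g\in S$ and $x\in X$: 1. if $f$ is not right normed, then $x\dashv f$ is a linear combination of right normed $s$-diwords $[asb]$, $s\in S$, with $|[a[\bar s]b]|\le\deg(x\dashv f)$; if $f$ is not left normed, then $f\vdash x$ is a linear combination of left normed $s$-diwords $[asb]$, $s\in S$, with $|[a[\bar s]b]|\le\deg(f\vdash x)$ (in both cases the value $0$ is allowed, as the empty combination); 2. (inclusion) if $[w]=[\bar f]=[a[\bar g]b]$ with $[agb]$ a normal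 $g$-diword, then $f-[agb]$ is a linear combination of normal $s$-diwords $[csd]$, $s\in S$, with $[c[\bar s]d]<[w]$, all of them right (left) normed $s$-diwords whenever $f$ and $[agb]$ are both right (left) normed; 3. (intersection) if $[w]=[[\bar f]b]=[a[\bar g]]$ with $|[\bar f]|+|[\bar g]|>|[w]|$ and $[fb]$, $[ag]$ a normal $f$-diword and a normal $g$-diword, then $[fb]-[ag]$ is a linear combination of normal $s$-diwords $[csd]$, $s\in S$, with $[c[\bar s]d]<[w]$, all of them right (left) normed $s$-diwords whenever $[fb]$ and $[ag]$ are both right (left) normed $f$- and $g$-diwords. **Theorem.** Let $\mathcal L$ be a Leibniz algebra over $k$ and $\mathcal L_0$ the subspace spanned by all $\{a,a\}$ and all $\{a,b\}+\{b,a\}$, $a,b\in\mathcal L$. Let $X=\{x_i\mid i\in I\}$ be a well-ordered basis of $\mathcal L$ (ordered by the well order of $I$) and $I_0\subseteq I$ such that $\{x_i\mid i\in I_0\}$ is a basis of $\mathcal L_0$. Let $$U(\mathcal L)=D\bigl(X\mid x_i\dashv x_j-x_j\vdash x_i-\{x_i,x_j\}\ (i,j\in I)\bigr),$$ where elements of $\mathcal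 L$ are read as linear combinations of $X$, and let $\varepsilon:\mathcal L\to U(\mathcal L)$ be the linear map sending $x_i$ to its class. Then $(U(\mathcal L),\varepsilon)$ is the universal enveloping dialgebra of $\mathcal L$: $\varepsilon$ is a Leibniz homomorphism, and every Leibniz homomorphism from $\mathcal L$ to a dialgebra $D$ factors as $F\circ\varepsilon$ for a unique dialgebra homomorphism $F:U(\mathcal L)\to D$. Moreover: (i) $Id\bigl(x_i\dashv x_j-x_j\vdash x_i-\{x_i,x_j\}\ (i,j\in I)\bigr)=Id(S)$, that is, $U(\mathcal L)=D(X|S)$, where $S$ consists of - (a) $x_j\vdash x_i-x_i\dashv x_j+\{x_i,x_j\}$ for $i,j\in I$; - (b) $x_j\vdash x_i\vdash x_t-x_i\vdash x_j\vdash x_t+\{x_i,x_j\}\vdash x_t$ for $i,j,t\in I$, $j>i$; - (c) $x_{i_0}\vdash x_t$ for $i_0\in I_0$, $t\in I$; - (d) $x_t\dashv x_j\dashv x_i-x_t\dashv x_i\dashv x_j+x_t\dashv\{x_i,x_j\}$ for $i,j,t\in I$, $j>i$; - (e) $x_t\dashv x_{i_0}$ for $i_0\in I_0$, $t\in I$.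 (ii) $S$ is a Gröbner–Shirshov basis in $D(X)$. (iii) The elements $x_j\dashv x_{i_1}\dashv\cdots\dashv x_{i_n}$ with $n\ge0$, $j\in I$, $i_p\in I\setminus I_0$ $(1\le p\le n)$ and $i_1\le\cdots\le i_n$ form a linear basis of $U(\mathcal L)$. In particular $\varepsilon$ is an injective Leibniz homomorphism, so $\mathcal L$ is a Leibniz subalgebra of $U(\mathcal L)$ with the bracket $[a,b]=a\dashv b-b\vdash a$. -/

import Mathlib

universe w

/-! ### Leibniz algebras and dialgebras -/

/-- A (right) Leibniz algebra over `k`: a vector space with a bilinear bracket satisfying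
`{{a,b},c} = {{a,c},b} + {a,{b,c}}`. -/
class LeibnizAlgebra (k L : Type*) [Field k] [AddCommGroup L] [Module k L] [Bracket L L] :
    Prop where
  add_bracket : ∀ a b c : L, ⁅a + b, c⁆ = ⁅a, c⁆ + ⁅b, c⁆
  bracket_add : ∀ a b c : L, ⁅a, b + c⁆ = ⁅a, b⁆ + ⁅a, c⁆
  smul_bracket : ∀ (r : k) (a b : L), ⁅r • a, b⁆ = r • ⁅a, b⁆
  bracket_smul : ∀ (r : k) (a b : L), ⁅a, r • b⁆ = r • ⁅a, b⁆
  leibniz : ∀ a b c : L, ⁅⁅a, b⁆, c⁆ = ⁅⁅a, c⁆, b⁆ + ⁅a, ⁅b, c⁆⁆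

/-- The subspace `L₀` spanned by all `{a,a}` and all `{a,b} + {b,a}`. -/
def leibnizKernel (k L : Type*) [Field k] [AddCommGroup L] [Module k L] [Bracket L L] :
    Submodule k L :=
  Submodule.span k ({z | ∃ a : L, z = ⁅a, a⁆} ∪ {z | ∃ a b : L, z = ⁅a, b⁆ + ⁅b, a⁆})

/-- The two products `⊣` and `⊢` of a dialgebra. -/
class DialgebraMul (D : Type*) where
  dashv : D → D → D
  vdash : D → D → D

infixl:70 " ⊣ᵈ " => DialgebraMul.dashv
infixl:70 " ⊢ᵈ " => DialgebraMul.vdash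

/-- A dialgebra over `k`. -/
class Dialgebra (k D : Type*) [Field k] [AddCommGroup D] [Module k D] [DialgebraMul D] :
    Prop where
  add_dashv : ∀ a b c : D, (a + b) ⊣ᵈ c = a ⊣ᵈ c + b ⊣ᵈ c
  dashv_add : ∀ a b c : D, a ⊣ᵈ (b + c) = a ⊣ᵈ b + a ⊣ᵈ c
  smul_dashv : ∀ (r : k) (a b : D), (r • a) ⊣ᵈ b = r • (a ⊣ᵈ b)
  dashv_smul : ∀ (r : k) (a b : D), a ⊣ᵈ (r • b) = r • (a ⊣ᵈ b)
  add_vdash : ∀ a b c : D, (a + b) ⊢ᵈ c = a ⊢ᵈ c + b ⊢ᵈ c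
  vdash_add : ∀ a b c : D, a ⊢ᵈ (b + c) = a ⊢ᵈ b + a ⊢ᵈ c
  smul_vdash : ∀ (r : k) (a b : D), (r • a) ⊢ᵈ b = r • (a ⊢ᵈ b)
  vdash_smul : ∀ (r : k) (a b : D), a ⊢ᵈ (r • b) = r • (a ⊢ᵈ b)
  dashv_assoc : ∀ a b c : D, (a ⊣ᵈ b) ⊣ᵈ c = a ⊣ᵈ (b ⊣ᵈ c)
  vdash_assoc : ∀ a b c : D, (a ⊢ᵈ b) ⊢ᵈ c = a ⊢ᵈ (b ⊢ᵈ c)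
  dashv_vdash : ∀ a b c : D, a ⊣ᵈ (b ⊢ᵈ c) = (a ⊣ᵈ b) ⊣ᵈ c
  vdash_of_dashv : ∀ a b c : D, (a ⊣ᵈ b) ⊢ᵈ c = (a ⊢ᵈ b) ⊢ᵈ c
  vdash_dashv : ∀ a b c : D, a ⊢ᵈ (b ⊣ᵈ c) = (a ⊢ᵈ b) ⊣ᵈ c

/-- Homomorphisms of dialgebras. -/
def IsDialgebraHom {k D E : Type*} [Field k] [AddCommGroup D] [Module k D] [DialgebraMul D]
    [AddCommGroup E] [Module k E] [DialgebraMul E] (F : D →ₗ[k] E) : Prop :=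
  ∀ a b : D, F (a ⊣ᵈ b) = F a ⊣ᵈ F b ∧ F (a ⊢ᵈ b) = F a ⊢ᵈ F b

/-- Leibniz homomorphisms from `L` to the Leibniz algebra `D⁽⁻⁾`, whose bracket is
`[a,b] = a ⊣ b - b ⊢ a`. -/
def IsLeibnizHom {k L D : Type*} [Field k] [AddCommGroup L] [Module k L] [Bracket L L]
    [AddCommGroup D] [Module k D] [DialgebraMul D] (δ : L →ₗ[k] D) : Prop :=
  ∀ a b : L, δ ⁅a, b⁆ = δ a ⊣ᵈ δ b - δ b ⊢ᵈ δ a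

/-- `ε : L → U` is a universal enveloping dialgebra of `L`: `U` is a dialgebra, `ε` is a Leibniz
homomorphism, and every Leibniz homomorphism from `L` to a dialgebra `D` factors through `ε` by a
unique dialgebra homomorphism. -/
def IsUniversalEnvelopingDialgebra {k L U : Type*} [Field k] [AddCommGroup L] [Module k L]
    [Bracket L L] [AddCommGroup U] [Module k U] [DialgebraMul U] (ε : L →ₗ[k] U) : Prop :=
  Dialgebra k U ∧ IsLeibnizHom ε ∧
    ∀ (D : Type w) [AddCommGroup D] [Module k D] [DialgebraMul D] [Dialgebra k D]
      (δ : L →ₗ[k] D), IsLeibnizHom δ → ∃! F : U →ₗ[k] D, IsDialgebraHom F ∧ F ∘ₗ ε = δ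

/-! ### Ideals and quotients -/

/-- Two-sided ideals (with respect to both products). -/
def IsDialgebraIdeal {k D : Type*} [Field k] [AddCommGroup D] [Module k D] [DialgebraMul D]
    (J : Submodule k D) : Prop :=
  ∀ a ∈ J, ∀ d : D, a ⊣ᵈ d ∈ J ∧ d ⊣ᵈ a ∈ J ∧ a ⊢ᵈ d ∈ J ∧ d ⊢ᵈ a ∈ J

/-- `Id(S)`, the smallest ideal containing `S`. -/
def dialgebraIdeal (k : Type*) {D : Type*} [Field k] [AddCommGroup D] [Module k D]
    [DialgebraMul D] (S : Set D) : Submodule k D :=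
  sInf {J | IsDialgebraIdeal J ∧ S ⊆ (J : Set D)}

theorem isDialgebraIdeal_dialgebraIdeal (k : Type*) {D : Type*} [Field k] [AddCommGroup D]
    [Module k D] [DialgebraMul D] (S : Set D) : IsDialgebraIdeal (dialgebraIdeal k S) := by
  intro a ha d
  simp only [dialgebraIdeal, Submodule.mem_sInf] at ha ⊢
  exact ⟨fun J hJ => (hJ.1 a (ha J hJ) d).1, fun J hJ => (hJ.1 a (ha J hJ) d).2.1,
    fun J hJ => (hJ.1 a (ha J hJ) d).2.2.1, fun J hJ => (hJ.1 a (ha J hJ) d).2.2.2⟩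

section Quotient

variable {k D : Type*} [Field k] [AddCommGroup D] [Module k D] [DialgebraMul D] [Dialgebra k D]

theorem Dialgebra.dashv_sub_dashv_mem {J : Submodule k D} (hJ : IsDialgebraIdeal J)
    {a a' b b' : D} (ha : a - a' ∈ J) (hb : b - b' ∈ J) : a ⊣ᵈ b - a' ⊣ᵈ b' ∈ J := by
  have h1 : a ⊣ᵈ b = (a - a') ⊣ᵈ b + a' ⊣ᵈ b := by
    rw [← Dialgebra.add_dashv k, sub_add_cancel]
  have h2 : a' ⊣ᵈ b = a' ⊣ᵈ (b - b') + a' ⊣ᵈ b' := by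
    rw [← Dialgebra.dashv_add k, sub_add_cancel]
  have h3 : a ⊣ᵈ b - a' ⊣ᵈ b' = (a - a') ⊣ᵈ b + a' ⊣ᵈ (b - b') := by
    rw [h1, h2]; abel
  rw [h3]
  exact J.add_mem (hJ _ ha _).1 (hJ _ hb _).2.1

theorem Dialgebra.vdash_sub_vdash_mem {J : Submodule k D} (hJ : IsDialgebraIdeal J)
    {a a' b b' : D} (ha : a - a' ∈ J) (hb : b - b' ∈ J) : a ⊢ᵈ b - a' ⊢ᵈ b' ∈ J := by
  have h1 : a ⊢ᵈ b = (a - a') ⊢ᵈ b + a' ⊢ᵈ b := by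
    rw [← Dialgebra.add_vdash k, sub_add_cancel]
  have h2 : a' ⊢ᵈ b = a' ⊢ᵈ (b - b') + a' ⊢ᵈ b' := by
    rw [← Dialgebra.vdash_add k, sub_add_cancel]
  have h3 : a ⊢ᵈ b - a' ⊢ᵈ b' = (a - a') ⊢ᵈ b + a' ⊢ᵈ (b - b') := by
    rw [h1, h2]; abel
  rw [h3]
  exact J.add_mem (hJ _ ha _).2.2.1 (hJ _ hb _).2.2.2

/-- The products of `D / Id(S)`. -/
instance dialgebraQuotientMul (S : Set D) : DialgebraMul (D ⧸ dialgebraIdeal k S) where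
  dashv x y := Quotient.liftOn₂' x y (fun a b => Submodule.Quotient.mk (a ⊣ᵈ b)) (by
    intro a b a' b' ha hb
    refine (Submodule.Quotient.eq _).2 (Dialgebra.dashv_sub_dashv_mem
      (isDialgebraIdeal_dialgebraIdeal k S) ?_ ?_)
    · exact (Submodule.quotientRel_def _).1 ha
    · exact (Submodule.quotientRel_def _).1 hb)
  vdash x y := Quotient.liftOn₂' x y (fun a b => Submodule.Quotient.mk (a ⊢ᵈ b)) (by
    intro a b a' b' ha hb
    refine (Submodule.Quotient.eq _).2 (Dialgebra.vdash_sub_vdash_mem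
      (isDialgebraIdeal_dialgebraIdeal k S) ?_ ?_)
    · exact (Submodule.quotientRel_def _).1 ha
    · exact (Submodule.quotientRel_def _).1 hb)

end Quotient

/-! ### Normal diwords and the free dialgebra -/

/-- The normal diword `x₋ₘ ⋯ x₋₁ ẋ₀ x₁ ⋯ xₙ`, with `left = [x₋ₘ, …, x₋₁]`, `center = x₀` and
`right = [x₁, …, xₙ]`. -/
@[ext] structure Diword (X : Type*) where
  left : List X
  center : X
  right : List X

namespace Diword

variable {X : Type*}

/-- The underlying associative word. -/
def word (u : Diword X) : List X := u.left ++ u.center :: u.right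

/-- The length `|[u]|`. -/
def length (u : Diword X) : ℕ := u.word.length

/-- `[u] ⊣ [v]` is `[uv]` with the center of `[u]`. -/
def dashv (u v : Diword X) : Diword X := ⟨u.left, u.center, u.right ++ v.word⟩

/-- `[u] ⊢ [v]` is `[uv]` with the center of `[v]`. -/
def vdash (u v : Diword X) : Diword X := ⟨u.word ++ v.left, v.center, v.right⟩

/-- The weight `(n + m + 1, m, x₋ₘ, …, x₀, …, xₙ)`, in the lexicographically ordered product. -/
def wt (u : Diword X) : ℕ ×ₗ (ℕ ×ₗ List X) := toLex (u.length, toLex (u.left.length, u.word))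

theorem wt_injective : Function.Injective (wt : Diword X → ℕ ×ₗ (ℕ ×ₗ List X)) := by
  rintro ⟨l, c, r⟩ ⟨l', c', r'⟩ h
  have h2 := congrArg (fun p => ofLex (ofLex p).2) h
  simp only [wt, word, ofLex_toLex, Prod.mk.injEq] at h2
  obtain ⟨hl, hw⟩ := h2
  obtain ⟨h3, h4⟩ := List.append_inj hw hl
  simp only [List.cons.injEq] at h4
  rw [h3, h4.1, h4.2]

/-- The deg-lex ordering of normal diwords: compare the weights lexicographically. -/
noncomputable instance [LinearOrder X] : LinearOrder (Diword X) :=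
  LinearOrder.lift' wt wt_injective

end Diword

/-- The free dialgebra `D(X)`: the vector space with basis the normal diwords in `X`. -/
abbrev FreeDialgebra (k X : Type*) [Field k] : Type _ := Diword X →₀ k

noncomputable section

namespace FreeDialgebra

variable {k X : Type*} [Field k]

/-- The bilinear extension of a product of normal diwords. -/
def bilin (m : Diword X → Diword X → Diword X) :
    FreeDialgebra k X →ₗ[k] FreeDialgebra k X →ₗ[k] FreeDialgebra k X :=
  Finsupp.lift _ k _ fun u => Finsupp.lift _ k _ fun v => Finsupp.single (m u v) 1

theorem bilin_single (m : Diword X → Diword X → Diword X) (u v : Diword X) (a b : k) :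
    bilin m (Finsupp.single u a) (Finsupp.single v b) = Finsupp.single (m u v) (a * b) := by
  simp [bilin]

instance : DialgebraMul (FreeDialgebra k X) where
  dashv f g := bilin Diword.dashv f g
  vdash f g := bilin Diword.vdash f g

theorem bilin_assoc {m₁ m₂ m₃ m₄ : Diword X → Diword X → Diword X}
    (h : ∀ u v t, m₁ (m₂ u v) t = m₃ u (m₄ v t)) (f g e : FreeDialgebra k X) :
    bilin m₁ (bilin m₂ f g) e = bilin m₃ f (bilin m₄ g e) := by
  induction f using Finsupp.induction_linear with
  | zero => simp
  | add f₁ f₂ h₁ h₂ => simp only [map_add, LinearMap.add_apply, h₁, h₂]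
  | single u a =>
    induction g using Finsupp.induction_linear with
    | zero => simp
    | add f₁ f₂ h₁ h₂ => simp only [map_add, LinearMap.add_apply, h₁, h₂]
    | single v b =>
      induction e using Finsupp.induction_linear with
      | zero => simp
      | add f₁ f₂ h₁ h₂ => simp only [map_add, h₁, h₂]
      | single t c => simp only [bilin_single, h, mul_assoc]

instance : Dialgebra k (FreeDialgebra k X) where
  add_dashv a b c := LinearMap.map_add₂ _ a b c
  dashv_add a b c := map_add _ b c
  smul_dashv r a b := LinearMap.map_smul₂ _ r a b
  dashv_smul r a b := map_smul _ r b
  add_vdash a b c := LinearMap.map_add₂ _ a b c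
  vdash_add a b c := map_add _ b c
  smul_vdash r a b := LinearMap.map_smul₂ _ r a b
  vdash_smul r a b := map_smul _ r b
  dashv_assoc := bilin_assoc fun u v t => by simp [Diword.dashv, Diword.word]
  vdash_assoc := bilin_assoc fun u v t => by simp [Diword.vdash, Diword.word]
  dashv_vdash a b c := (bilin_assoc (fun u v t => by
    simp [Diword.dashv, Diword.vdash, Diword.word]) a b c).symm
  vdash_of_dashv a b c := (bilin_assoc (m₄ := Diword.vdash) (m₃ := Diword.vdash) (fun u v t => by
    simp [Diword.dashv, Diword.vdash, Diword.word]) a b c).trans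
      (bilin_assoc (fun u v t => by simp [Diword.vdash, Diword.word]) a b c).symm
  vdash_dashv a b c := (bilin_assoc (fun u v t => by
    simp [Diword.dashv, Diword.vdash]) a b c).symm

/-- The generator `x`. -/
def of (k : Type*) {X : Type*} [Field k] (x : X) : FreeDialgebra k X :=
  Finsupp.single ⟨[], x, []⟩ 1

section Order

variable [LinearOrder X]

/-- `u` is the leading term `[f̄]` of `f`. -/
def IsLead (f : FreeDialgebra k X) (u : Diword X) : Prop :=
  u ∈ f.support ∧ ∀ v ∈ f.support, v ≤ u

/-- `f` is monic: its leading coefficient is `1`. -/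
def Monic (f : FreeDialgebra k X) : Prop := ∃ u, IsLead f u ∧ f u = 1

end Order

/-- `f` is a combination of diwords with center the last letter. -/
def LeftNormed (f : FreeDialgebra k X) : Prop := ∀ u ∈ f.support, u.right = []

/-- `f` is a combination of diwords with center the first letter. -/
def RightNormed (f : FreeDialgebra k X) : Prop := ∀ u ∈ f.support, u.left = []

end FreeDialgebra

/-! ### `S`-diwords -/

/-- A normal diword with one letter replaced by a hole. In `center a b` the hole is the center
(`a ⊢ □ ⊣ b`); in `before a b₁ x₀ b₂` it stands before the center `x₀`
(`a ⊢ □ ⊢ b₁ ⊢ x₀ ⊣ b₂`); in `after a₁ x₀ a₂ b` it stands after the center `x₀`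
(`a₁ ⊢ x₀ ⊣ a₂ ⊣ □ ⊣ b`). -/
inductive DiContext (X : Type*) where
  | center (a b : List X)
  | before (a b₁ : List X) (x₀ : X) (b₂ : List X)
  | after (a₁ : List X) (x₀ : X) (a₂ b : List X)

namespace DiContext

variable {k X : Type*} [Field k]

/-- The word to the left of the hole. -/
def leftWord : DiContext X → List X
  | center a _ => a
  | before a _ _ _ => a
  | after a₁ x₀ a₂ _ => a₁ ++ x₀ :: a₂

/-- The word to the right of the hole. -/
def rightWord : DiContext X → List X
  | center _ b => b
  | before _ b₁ x₀ b₂ => b₁ ++ x₀ :: b₂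
  | after _ _ _ b => b

/-- `[a[u]b]`, the hole filled with a normal diword. -/
def fill : DiContext X → Diword X → Diword X
  | center a b, u => ⟨a ++ u.left, u.center, u.right ++ b⟩
  | before a b₁ x₀ b₂, u => ⟨a ++ u.word ++ b₁, x₀, b₂⟩
  | after a₁ x₀ a₂ b, u => ⟨a₁, x₀, a₂ ++ u.word ++ b⟩

/-- The diword `[asb]` for `s ∈ D(X)`: the linear extension of `fill`. -/
def plug (c : DiContext X) (s : FreeDialgebra k X) : FreeDialgebra k X :=
  Finsupp.mapDomain c.fill s

/-- `[asb]` is a normal `s`-diword. -/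
def IsNormal (c : DiContext X) (s : FreeDialgebra k X) : Prop :=
  match c with
  | center _ _ => True
  | before _ _ _ _ => s.LeftNormed
  | after _ _ _ _ => s.RightNormed

/-- `[asb]` is a left normed `s`-diword. -/
def IsLeftNormed (c : DiContext X) (s : FreeDialgebra k X) : Prop :=
  c.IsNormal s ∧ s.LeftNormed ∧ (c.plug s).LeftNormed

/-- `[asb]` is a right normed `s`-diword. -/
def IsRightNormed (c : DiContext X) (s : FreeDialgebra k X) : Prop :=
  c.IsNormal s ∧ s.RightNormed ∧ (c.plug s).RightNormed

end DiContext

/-! ### Gröbner–Shirshov bases -/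

namespace FreeDialgebra

variable {k X : Type*} [Field k] [LinearOrder X]

/-- Triviality modulo `S` of a composition `h` of left multiplication: `h` is a combination of
right normed `s`-diwords `[asb]`, `s ∈ S`, with `|[a[s̄]b]| ≤ deg h`. (For `h = 0` this holds by
the empty combination.) -/
def LeftMulTrivial (S : Set (FreeDialgebra k X)) (h : FreeDialgebra k X) : Prop :=
  h ∈ Submodule.span k {p | ∃ s ∈ S, ∃ (c : DiContext X) (u v : Diword X),
    c.IsRightNormed s ∧ IsLead s u ∧ IsLead h v ∧ (c.fill u).length ≤ v.length ∧ p = c.plug s}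

/-- Triviality modulo `S` of a composition `h` of right multiplication. -/
def RightMulTrivial (S : Set (FreeDialgebra k X)) (h : FreeDialgebra k X) : Prop :=
  h ∈ Submodule.span k {p | ∃ s ∈ S, ∃ (c : DiContext X) (u v : Diword X),
    c.IsLeftNormed s ∧ IsLead s u ∧ IsLead h v ∧ (c.fill u).length ≤ v.length ∧ p = c.plug s}

/-- Triviality modulo `(S, [w])` of a composition `h` of inclusion or intersection: `h` is a
combination of normal `s`-diwords `[asb]`, `s ∈ S`, with `[a[s̄]b] < [w]`, which are moreover
right normed if `PR` holds and left normed if `PL` holds. -/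
def TrivialMod (S : Set (FreeDialgebra k X)) (w : Diword X) (PR PL : Prop)
    (h : FreeDialgebra k X) : Prop :=
  h ∈ Submodule.span k {p | ∃ s ∈ S, ∃ (c : DiContext X) (u : Diword X),
    c.IsNormal s ∧ IsLead s u ∧ c.fill u < w ∧ (PR → c.IsRightNormed s) ∧
      (PL → c.IsLeftNormed s) ∧ p = c.plug s}

/-- `S` is a Gröbner–Shirshov basis in `D(X)`: `S` is monic, and all compositions of elements of
`S` are trivial. -/
structure IsGroebnerShirshovBasis (S : Set (FreeDialgebra k X)) : Prop where
  monic : ∀ f ∈ S, Monic f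
  left_mul : ∀ f ∈ S, ¬ RightNormed f → ∀ x : X, LeftMulTrivial S (of k x ⊣ᵈ f)
  right_mul : ∀ f ∈ S, ¬ LeftNormed f → ∀ x : X, RightMulTrivial S (f ⊢ᵈ of k x)
  /-- `[w] = [f̄] = [a[ḡ]b]` with `[agb]` normal. -/
  inclusion : ∀ f ∈ S, ∀ g ∈ S, ∀ (c : DiContext X) (u w : Diword X),
    IsLead f w → IsLead g u → c.IsNormal g → w = c.fill u →
      TrivialMod S w (RightNormed f ∧ c.IsRightNormed g) (LeftNormed f ∧ c.IsLeftNormed g)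
        (f - c.plug g)
  /-- `[w] = [[f̄]b] = [a[ḡ]]` with `[fb]`, `[ag]` normal and `|f̄| + |ḡ| > |w|`. -/
  intersection : ∀ f ∈ S, ∀ g ∈ S, ∀ (c d : DiContext X) (t u w : Diword X),
    c.leftWord = [] → d.rightWord = [] → IsLead f t → IsLead g u →
    c.IsNormal f → d.IsNormal g → w = c.fill t → w = d.fill u →
    w.length < t.length + u.length →
      TrivialMod S w (c.IsRightNormed f ∧ d.IsRightNormed g)
        (c.IsLeftNormed f ∧ d.IsLeftNormed g) (c.plug f - d.plug g)

end FreeDialgebra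

/-! ### The universal enveloping dialgebra of a Leibniz algebra -/

section Enveloping

open FreeDialgebra

variable {k L I : Type*} [Field k] [AddCommGroup L] [Module k L] [Bracket L L]

/-- An element of `L` as a linear combination of the generators `x_i` (the basis vectors). -/
def letters (b : Module.Basis I k L) : L →ₗ[k] FreeDialgebra k I :=
  b.constr k fun i => of k i

/-- The relations `x_i ⊣ x_j - x_j ⊢ x_i - {x_i, x_j}`. -/
def envelopingRelations (b : Module.Basis I k L) : Set (FreeDialgebra k I) :=
  {f | ∃ i j, f = of k i ⊣ᵈ of k j - of k j ⊢ᵈ of k i - letters b ⁅b i, b j⁆}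

/-- `U(L) = D(X | x_i ⊣ x_j - x_j ⊢ x_i - {x_i, x_j})`. -/
abbrev EnvelopingDialgebra (b : Module.Basis I k L) : Type _ :=
  FreeDialgebra k I ⧸ dialgebraIdeal k (envelopingRelations b)

/-- The canonical map `L → U(L)`, sending the basis vector `x_i` to the class of `x_i`. -/
def envelopingMap (b : Module.Basis I k L) : L →ₗ[k] EnvelopingDialgebra b :=
  (dialgebraIdeal k (envelopingRelations b)).mkQ ∘ₗ letters b

/-- The polynomials (a)–(e). -/
inductive GSRelation [LinearOrder I] (b : Module.Basis I k L) (I₀ : Set I) :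
    FreeDialgebra k I → Prop
  | a (i j : I) : GSRelation b I₀
      (of k j ⊢ᵈ of k i - of k i ⊣ᵈ of k j + letters b ⁅b i, b j⁆)
  | b (i j t : I) (hij : i < j) : GSRelation b I₀
      (of k j ⊢ᵈ of k i ⊢ᵈ of k t - of k i ⊢ᵈ of k j ⊢ᵈ of k t
        + letters b ⁅b i, b j⁆ ⊢ᵈ of k t)
  | c (i₀ t : I) (hi₀ : i₀ ∈ I₀) : GSRelation b I₀ (of k i₀ ⊢ᵈ of k t)
  | d (i j t : I) (hij : i < j) : GSRelation b I₀
      (of k t ⊣ᵈ of k j ⊣ᵈ of k i - of k t ⊣ᵈ of k i ⊣ᵈ of k j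
        + of k t ⊣ᵈ letters b ⁅b i, b j⁆)
  | e (i₀ t : I) (hi₀ : i₀ ∈ I₀) : GSRelation b I₀ (of k t ⊣ᵈ of k i₀)

/-- The index set of the words `x_j ⊣ x_{i_1} ⊣ ⋯ ⊣ x_{i_n}` with `n ≥ 0`, all `i_p ∉ I₀` and
`i_1 ≤ ⋯ ≤ i_n`. -/
abbrev PBWIndex [LinearOrder I] (I₀ : Set I) : Type _ :=
  {p : I × List I // (∀ i ∈ p.2, i ∉ I₀) ∧ p.2.Pairwise (· ≤ ·)}

/-- The element `x_j ⊣ x_{i_1} ⊣ ⋯ ⊣ x_{i_n}` of `U(L)`. -/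
def pbwWord (b : Module.Basis I k L) (j : I) (l : List I) : EnvelopingDialgebra b :=
  l.foldl (fun z i => z ⊣ᵈ envelopingMap b (b i)) (envelopingMap b (b j))

end Enveloping

end

noncomputable section

/-! ### Leibniz algebras -/

section Leibniz

variable (k : Type*) {L : Type*} [Field k] [AddCommGroup L] [Module k L] [Bracket L L]

/-! In a dialgebra the inner position of a center is lost as soon as an element becomes the
non-central factor of a product. The free dialgebra is thus spanned by the `triple b p x q` with
`p`, `q` in the free associative algebra and a center `x` in `L`; `⊣` multiplies `q` on the right by
`forget` of the other factor, and `⊢` multiplies `p` on the left (`triple_dashv`, `vdash_triple`).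
Forgetting the center in (a) leaves `commRel x y`, that is, yx - xy + {x,y}. All of these together
force the letters of L₀ to vanish, so away from the center one computes in the enveloping algebra of
the Lie algebra L/L₀. Its rewriting rules (`AssocRule`) give (b), (c) when placed to the left of a
central letter and (d), (e) when placed to the right, while (a) itself (`envRel`) carries a letter
across the center. The associative rules are confluent: the overlap of two commutation rules
resolves by the Leibniz identity, and those with a killed letter resolve because {L,L₀} = 0 and
{L₀,L} lies in L₀ (`AssocRule.confluent`). For the Gröbner–Shirshov property, every normal s-diword
is a rule on the left, a rule on the right, or a crossing of the center
(`NormalSDiword.of_gsRelation`). Two of them with the same leading diword either lie on one side,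
where associative confluence applies, or do not interact, or are a rule and a crossing that meet
just before the center; the last case is settled by `triple_commRel_sub_envRel`, again the Leibniz
identity. This is collected in `NormalSDiword.resolve`. The basis is obtained without a
composition-diamond lemma for dialgebras. It spans, because letters can be carried to the right of
the center and sorted there. It is independent, because U(L) maps to L ⊗ (k⟨I⟩/J), with J the ideal
of the rules, where L acts on the left by y(x ⊗ u) = x ⊗ yu - {x,y} ⊗ u; a basis word goes to the
tensor of its first letter with a sorted word, and the sorted words are independent modulo J by
confluence (`eq_zero_of_mem_ruleSpan_of_irreducible`). The universal property comes from evaluation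
on the free dialgebra. -/

theorem bracket_self_mem_leibnizKernel (x : L) : ⁅x, x⁆ ∈ leibnizKernel k L :=
  Submodule.subset_span (Or.inl ⟨x, rfl⟩)

theorem bracket_add_bracket_mem_leibnizKernel (x y : L) :
    ⁅x, y⁆ + ⁅y, x⁆ ∈ leibnizKernel k L :=
  Submodule.subset_span (Or.inr ⟨x, y, rfl⟩)

theorem basis_mem_leibnizKernel {k I : Type*} [Field k] [Module k L] {b : Module.Basis I k L}
    {I₀ : Set I} (hI₀ : Submodule.span k (b '' I₀) = leibnizKernel k L) {i : I} (hi : i ∈ I₀) :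
    b i ∈ leibnizKernel k L :=
  hI₀ ▸ Submodule.subset_span ⟨i, hi, rfl⟩

variable [LeibnizAlgebra k L]

/-- The bracket of a Leibniz algebra as a bilinear map. -/
def leibnizBracket : L →ₗ[k] L →ₗ[k] L :=
  LinearMap.mk₂ k (fun x y => ⁅x, y⁆) (LeibnizAlgebra.add_bracket k)
    LeibnizAlgebra.smul_bracket (LeibnizAlgebra.bracket_add k) LeibnizAlgebra.bracket_smul

theorem leibnizBracket_apply (x y : L) : leibnizBracket k x y = ⁅x, y⁆ := rfl

/-- Putting equal second and third arguments in the Leibniz identity makes its first two terms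
coincide. For the mixed generators, the identity is used for `a, c` and for `c, a`, and the two are
combined. -/
theorem bracket_leibnizKernel (x : L) {z : L} (hz : z ∈ leibnizKernel k L) : ⁅x, z⁆ = 0 := by
  have key : leibnizKernel k L ≤ LinearMap.ker (leibnizBracket k x) := by
    refine Submodule.span_le.2 ?_
    rintro _ (⟨a, rfl⟩ | ⟨a, c, rfl⟩)
    · have h := LeibnizAlgebra.leibniz k x a a
      rw [left_eq_add] at h
      exact h
    · have h₁ := LeibnizAlgebra.leibniz k x a c
      have h₂ := LeibnizAlgebra.leibniz k x c a
      simp only [SetLike.mem_coe, LinearMap.mem_ker, map_add, leibnizBracket_apply]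
      rw [h₂, add_assoc, left_eq_add, add_comm] at h₁
      exact h₁
  exact key hz

theorem leibnizKernel_bracket (x : L) {z : L} (hz : z ∈ leibnizKernel k L) :
    ⁅z, x⁆ ∈ leibnizKernel k L := by
  have key : leibnizKernel k L ≤ (leibnizKernel k L).comap ((leibnizBracket k).flip x) := by
    have sq : ∀ a : L, ⁅⁅a, a⁆, x⁆ ∈ leibnizKernel k L := fun a => by
      rw [LeibnizAlgebra.leibniz k a a x]
      exact bracket_add_bracket_mem_leibnizKernel k _ _
    refine Submodule.span_le.2 ?_
    rintro _ (⟨a, rfl⟩ | ⟨a, c, rfl⟩)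
    · exact sq a
    -- Polarization reduces the mixed generators to squares.
    · have e : ⁅a, c⁆ + ⁅c, a⁆ = ⁅a + c, a + c⁆ - ⁅a, a⁆ - ⁅c, c⁆ := by
        rw [LeibnizAlgebra.add_bracket k, LeibnizAlgebra.bracket_add k,
          LeibnizAlgebra.bracket_add k]
        abel
      rw [e]
      exact Submodule.sub_mem _ (Submodule.sub_mem _ (sq _) (sq _)) (sq _)
  exact key hz

end Leibniz

/-! ### The shortlex order of words -/

/-- The shortlex order of words over a linearly ordered alphabet. -/
abbrev ShortlexLT {I : Type*} [LT I] (v w : List I) : Prop := List.Shortlex (· < ·) v w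

section Words

variable {I : Type*}

theorem List.Lex.append_of_length_eq {r : I → I → Prop} {v w : List I} (h : List.Lex r v w)
    (hl : v.length = w.length) (c : List I) : List.Lex r (v ++ c) (w ++ c) := by
  induction h with
  | nil => simp at hl
  | cons _ ih => exact .cons (ih (by simpa using hl))
  | rel h => exact .rel h

variable [LinearOrder I]

/-- The monomial-order property that keeps leading words stable under multiplication. Lexicographic
order alone is not preserved by appending on the right; the equality of lengths in the tie case is
what saves it. -/
theorem ShortlexLT.append_append {v w : List I} (h : ShortlexLT v w) (a c : List I) :
    ShortlexLT (a ++ v ++ c) (a ++ w ++ c) := by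
  rcases List.shortlex_def.1 h with h | ⟨hl, h⟩
  · exact .of_length_lt (by simpa using h)
  · refine .of_lex (by simp [hl]) ?_
    rw [List.append_assoc, List.append_assoc]
    exact List.Lex.append_left _ (h.append_of_length_eq hl c) a

theorem ShortlexLT.swap {i j : I} (h : i < j) : ShortlexLT [i, j] [j, i] :=
  .of_lex rfl (.rel h)

end Words

/-! ### The free associative algebra -/

/-- The free associative algebra, with basis the words in `I`. -/
abbrev WordAlgebra (k I : Type*) [Field k] : Type _ := MonoidAlgebra k (FreeMonoid I)

section WordAlgebra

variable (k : Type*) {L I : Type*} [Field k]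

/-- The basis of words. -/
def wordBasis (I : Type*) : Module.Basis (List I) k (WordAlgebra k I) :=
  (MonoidAlgebra.basis (FreeMonoid I) k).reindex FreeMonoid.toList

/-- A word as an element of the free associative algebra. -/
def word (v : List I) : WordAlgebra k I := wordBasis k I v

theorem word_eq_of (v : List I) : word k v = MonoidAlgebra.of k _ (FreeMonoid.ofList v) := by
  simp [word, wordBasis]

theorem word_append (v w : List I) : word k (v ++ w) = word k v * word k w := by
  simp only [word_eq_of, FreeMonoid.ofList_append, map_mul]

theorem word_nil : word k ([] : List I) = 1 := by
  rw [word_eq_of]; rfl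

theorem word_cons (i : I) (w : List I) : word k (i :: w) = word k [i] * word k w :=
  word_append k [i] w

variable {k}

theorem WordAlgebra.induction {P : WordAlgebra k I → Prop} (word : ∀ v, P (word k v))
    (add : ∀ p q, P p → P q → P (p + q)) (smul : ∀ (r : k) p, P p → P (r • p)) (p) : P p := by
  have hp := (wordBasis k I).mem_span p
  induction hp using Submodule.span_induction with
  | mem x h => obtain ⟨v, rfl⟩ := h; exact word v
  | zero => simpa using smul 0 _ (word [])
  | add x y _ _ hx hy => exact add x y hx hy
  | smul r x _ hx => exact smul r x hx

variable (k) in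
/-- The span of the words with property `P`. -/
def wordSpan (P : List I → Prop) : Submodule k (WordAlgebra k I) :=
  Submodule.span k (word k '' {v | P v})

theorem word_mem_wordSpan {P : List I → Prop} {v : List I} (h : P v) : word k v ∈ wordSpan k P :=
  Submodule.subset_span ⟨v, h, rfl⟩

theorem wordSpan_mono {P Q : List I → Prop} (h : ∀ v, P v → Q v) : wordSpan k P ≤ wordSpan k Q :=
  Submodule.span_mono (Set.image_mono h)

theorem mul_mem_wordSpan {P Q R : List I → Prop} (h : ∀ a c, P a → Q c → R (a ++ c))
    {p q : WordAlgebra k I} (hp : p ∈ wordSpan k P) (hq : q ∈ wordSpan k Q) :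
    p * q ∈ wordSpan k R := by
  induction hp using Submodule.span_induction with
  | mem x hx =>
    obtain ⟨a, ha, rfl⟩ := hx
    induction hq using Submodule.span_induction with
    | mem x hx =>
      obtain ⟨c, hc, rfl⟩ := hx
      rw [← word_append]
      exact word_mem_wordSpan (h a c ha hc)
    | zero => simp
    | add x y _ _ hx hy => rw [mul_add]; exact add_mem hx hy
    | smul r x _ hx => rw [mul_smul_comm]; exact Submodule.smul_mem _ _ hx
  | zero => simp
  | add x y _ _ hx hy => rw [add_mul]; exact add_mem hx hy
  | smul r x _ hx => rw [smul_mul_assoc]; exact Submodule.smul_mem _ _ hx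

theorem wordBasis_repr_eq_zero {P : List I → Prop} {p : WordAlgebra k I} (hp : p ∈ wordSpan k P)
    {w : List I} (hw : ¬ P w) : (wordBasis k I).repr p w = 0 := by
  induction hp using Submodule.span_induction with
  | mem x hx =>
    obtain ⟨v, hv, rfl⟩ := hx
    rw [word, Module.Basis.repr_self, Finsupp.single_eq_of_ne]
    rintro rfl
    exact hw hv
  | zero => simp
  | add x y _ _ hx hy => simp [hx, hy]
  | smul r x _ hx => simp [hx]

theorem wordBasis_repr_word_self (w : List I) : (wordBasis k I).repr (word k w) w = 1 := by
  rw [word, Module.Basis.repr_self, Finsupp.single_eq_same]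

variable [AddCommGroup L] [Module k L] (b : Module.Basis I k L)

/-- An element of `L` as a linear combination of letters. -/
def letter : L →ₗ[k] WordAlgebra k I := b.constr k fun i => word k [i]

@[simp] theorem letter_basis (i : I) : letter b (b i) = word k [i] := by
  simp [letter]

theorem letter_mem_wordSpan (x : L) : letter b x ∈ wordSpan k (fun v => v.length = 1) := by
  have hx := b.mem_span x
  induction hx using Submodule.span_induction with
  | mem x h => obtain ⟨i, rfl⟩ := h; rw [letter_basis]; exact word_mem_wordSpan rfl
  | zero => simp
  | add x y _ _ hx hy => rw [map_add]; exact add_mem hx hy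
  | smul r x _ hx => rw [map_smul]; exact Submodule.smul_mem _ _ hx

variable [Bracket L L]

/-- The relation `y x - x y + {x, y}` of the enveloping algebra of `L`. -/
def commRel (x y : L) : WordAlgebra k I :=
  letter b y * letter b x - letter b x * letter b y + letter b ⁅x, y⁆

/-- The rewriting rules of the enveloping algebra of `L / L₀`, with their leading words. -/
inductive AssocRule [LT I] (b : Module.Basis I k L) (I₀ : Set I) :
    List I → WordAlgebra k I → Prop
  | comm (i j : I) (hij : i < j) : AssocRule b I₀ [j, i] (commRel b (b i) (b j))
  | kill (i : I) (hi : i ∈ I₀) : AssocRule b I₀ [i] (word k [i])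

/-- The span of the multiples of the rules whose leading words have property `P`. -/
def ruleSpan [LT I] (I₀ : Set I) (P : List I → Prop) : Submodule k (WordAlgebra k I) :=
  Submodule.span k {h | ∃ a c u r, AssocRule b I₀ u r ∧ P (a ++ u ++ c) ∧
    h = word k a * r * word k c}

/-! ### Leading words of the rules and their multiples -/

section

variable {b} [LinearOrder I] {I₀ : Set I} {P Q R : List I → Prop}

theorem ruleSpan_mono (h : ∀ v, P v → Q v) : ruleSpan b I₀ P ≤ ruleSpan b I₀ Q :=
  Submodule.span_mono fun _ ⟨a, c, u, r, hr, hP, e⟩ => ⟨a, c, u, r, hr, h _ hP, e⟩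

theorem AssocRule.ne_nil {u : List I} {r : WordAlgebra k I} (h : AssocRule b I₀ u r) : u ≠ [] := by
  cases h <;> simp

/-- A rule is monic with leading word `u`: in a commutation rule the bracket is shorter than `[j,
i]` and the other product is lexicographically smaller, since `i < j`. -/
theorem AssocRule.sub_word_mem {u : List I} {r : WordAlgebra k I} (h : AssocRule b I₀ u r) :
    r - word k u ∈ wordSpan k (ShortlexLT · u) := by
  cases h with
  | comm i j hij =>
    have e : commRel b (b i) (b j) - word k [j, i] = letter b ⁅b i, b j⁆ - word k [i, j] := by
      simp only [commRel, letter_basis, ← word_append, List.singleton_append]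
      abel
    rw [e]
    refine sub_mem (wordSpan_mono (fun v hv => ?_) (letter_mem_wordSpan b _))
      (word_mem_wordSpan (ShortlexLT.swap hij))
    exact .of_length_lt (by simp [hv])
  | kill i hi => simp

theorem mul_mem_ruleSpan (h : ∀ a c, P a → Q c → R (a ++ c)) {p q : WordAlgebra k I}
    (hp : p ∈ wordSpan k P) (hq : q ∈ ruleSpan b I₀ Q) : p * q ∈ ruleSpan b I₀ R := by
  induction hp using Submodule.span_induction with
  | mem x hx =>
    obtain ⟨a, ha, rfl⟩ := hx
    induction hq using Submodule.span_induction with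
    | mem x hx =>
      obtain ⟨a', c, u, r, hr, hQ, rfl⟩ := hx
      refine Submodule.subset_span ⟨a ++ a', c, u, r, hr, ?_, ?_⟩
      · simpa using h _ _ ha hQ
      · simp only [word_append, mul_assoc]
    | zero => simp
    | add x y _ _ hx hy => rw [mul_add]; exact add_mem hx hy
    | smul r x _ hx => rw [mul_smul_comm]; exact Submodule.smul_mem _ _ hx
  | zero => simp
  | add x y _ _ hx hy => rw [add_mul]; exact add_mem hx hy
  | smul r x _ hx => rw [smul_mul_assoc]; exact Submodule.smul_mem _ _ hx

theorem ruleSpan_mul_mem (h : ∀ a c, P a → Q c → R (a ++ c)) {p q : WordAlgebra k I}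
    (hp : p ∈ ruleSpan b I₀ P) (hq : q ∈ wordSpan k Q) : p * q ∈ ruleSpan b I₀ R := by
  induction hq using Submodule.span_induction with
  | mem x hx =>
    obtain ⟨c', hc, rfl⟩ := hx
    induction hp using Submodule.span_induction with
    | mem x hx =>
      obtain ⟨a, c, u, r, hr, hQ, rfl⟩ := hx
      refine Submodule.subset_span ⟨a, c ++ c', u, r, hr, ?_, ?_⟩
      · simpa using h _ _ hQ hc
      · simp only [word_append, mul_assoc]
    | zero => simp
    | add x y _ _ hx hy => rw [add_mul]; exact add_mem hx hy
    | smul r x _ hx => rw [smul_mul_assoc]; exact Submodule.smul_mem _ _ hx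
  | zero => simp
  | add x y _ _ hx hy => rw [mul_add]; exact add_mem hx hy
  | smul r x _ hx => rw [mul_smul_comm]; exact Submodule.smul_mem _ _ hx

theorem AssocRule.mul_sub_word_mem {u : List I} {r : WordAlgebra k I} (h : AssocRule b I₀ u r)
    (a c : List I) :
    word k a * r * word k c - word k (a ++ u ++ c) ∈ wordSpan k (ShortlexLT · (a ++ u ++ c)) := by
  rw [word_append, word_append, ← sub_mul, ← mul_sub]
  refine mul_mem_wordSpan (P := (ShortlexLT · (a ++ u))) (Q := (· = c)) ?_
    (mul_mem_wordSpan (P := (· = a)) ?_ (word_mem_wordSpan rfl) h.sub_word_mem)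
    (word_mem_wordSpan rfl)
  · rintro v c hv rfl; simpa using hv.append_append [] c
  · rintro a v rfl hv; simpa using hv.append_append a []

theorem ruleSpan_le_iff {J : Submodule k (WordAlgebra k I)} :
    ruleSpan b I₀ P ≤ J ↔ ∀ a c u r, AssocRule b I₀ u r → P (a ++ u ++ c) →
      word k a * r * word k c ∈ J := by
  refine ⟨fun h a c u r hr hP => h (Submodule.subset_span ⟨a, c, u, r, hr, hP, rfl⟩), fun h => ?_⟩
  refine Submodule.span_le.2 ?_
  rintro _ ⟨a, c, u, r, hr, hP, rfl⟩
  exact h a c u r hr hP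

theorem AssocRule.mem_ruleSpan {u : List I} {r : WordAlgebra k I} (h : AssocRule b I₀ u r)
    (hP : P u) : r ∈ ruleSpan b I₀ P :=
  Submodule.subset_span ⟨[], [], u, r, h, by simpa using hP, by simp [word_nil]⟩

/-- The form in which rules multiplied by arbitrary polynomials are used: the leading words are
controlled by the words allowed in the two factors. -/
theorem AssocRule.mul_mem {u : List I} {r p q : WordAlgebra k I} (h : AssocRule b I₀ u r)
    (hp : p ∈ wordSpan k P) (hq : q ∈ wordSpan k Q) (hR : ∀ a c, P a → Q c → R (a ++ u ++ c)) :
    p * r * q ∈ ruleSpan b I₀ R :=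
  ruleSpan_mul_mem (P := fun v => ∃ a, P a ∧ v = a ++ u)
    (by rintro _ c ⟨a, ha, rfl⟩ hc; exact hR a c ha hc)
    (mul_mem_ruleSpan (Q := (· = u)) (by rintro a c ha rfl; exact ⟨a, ha, rfl⟩) hp
      (h.mem_ruleSpan rfl)) hq

end

/-! ### Critical pairs of the associative rules -/

section

variable {b} [LinearOrder I] {I₀ : Set I} (hI₀ : Submodule.span k (b '' I₀) = leibnizKernel k L)

include hI₀

theorem letter_mem_ruleSpan {z : L} (hz : z ∈ leibnizKernel k L) :
    letter b z ∈ ruleSpan b I₀ (fun v => v.length ≤ 1) := by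
  rw [← hI₀] at hz
  have key : Submodule.span k (b '' I₀) ≤
      (ruleSpan b I₀ (fun v => v.length ≤ 1)).comap (letter b) := by
    refine Submodule.span_le.2 ?_
    rintro _ ⟨i, hi, rfl⟩
    rw [SetLike.mem_coe, Submodule.mem_comap, letter_basis]
    exact (AssocRule.kill i hi).mem_ruleSpan (by simp)
  exact key hz

variable [LeibnizAlgebra k L]

/-- The commutation rules cover only `i < j`. On the diagonal only {x,x} remains, and reversing the
arguments changes the sign up to {x,y} + {y,x}; both corrections lie in L₀ and are killed.
Bilinearity does the rest. Arbitrary arguments are needed because brackets of basis vectors occur in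
the Jacobi-type overlap. -/
theorem commRel_mem_ruleSpan (x y : L) :
    commRel b x y ∈ ruleSpan b I₀ (fun v => v.length ≤ 2) := by
  have kern : ∀ z ∈ leibnizKernel k L, letter b z ∈ ruleSpan b I₀ (fun v => v.length ≤ 2) :=
    fun z hz => ruleSpan_mono (fun v hv => by omega) (letter_mem_ruleSpan hI₀ hz)
  have hx := b.mem_span x
  induction hx using Submodule.span_induction with
  | mem x h =>
    obtain ⟨i, rfl⟩ := h
    have hy := b.mem_span y
    induction hy using Submodule.span_induction with
    | mem x h =>
      obtain ⟨j, rfl⟩ := h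
      rcases lt_trichotomy i j with h | rfl | h
      · exact (AssocRule.comm i j h).mem_ruleSpan (by simp)
      · rw [commRel, sub_self, zero_add]
        exact kern _ (bracket_self_mem_leibnizKernel k _)
      · have e : commRel b (b i) (b j) =
            letter b (⁅b i, b j⁆ + ⁅b j, b i⁆) - commRel b (b j) (b i) := by
          simp only [commRel, map_add]; abel
        rw [e]
        exact sub_mem (kern _ (bracket_add_bracket_mem_leibnizKernel k _ _))
          ((AssocRule.comm j i h).mem_ruleSpan (by simp))
    | zero =>
      have : commRel b (b i) 0 = 0 := by
        simp [commRel, ← leibnizBracket_apply k]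
      rw [this]; exact zero_mem _
    | add x y _ _ hx hy =>
      have : commRel b (b i) (x + y) = commRel b (b i) x + commRel b (b i) y := by
        simp only [commRel, ← leibnizBracket_apply k, map_add, add_mul, mul_add]; abel
      rw [this]; exact add_mem hx hy
    | smul r x _ hx =>
      have : commRel b (b i) (r • x) = r • commRel b (b i) x := by
        simp only [commRel, ← leibnizBracket_apply k, map_smul, smul_mul_assoc, mul_smul_comm,
          smul_add, smul_sub]
      rw [this]; exact Submodule.smul_mem _ _ hx
  | zero =>
    have : commRel b 0 y = 0 := by
      simp [commRel, ← leibnizBracket_apply k]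
    rw [this]; exact zero_mem _
  | add x x' _ _ hx hy =>
    have : commRel b (x + x') y = commRel b x y + commRel b x' y := by
      simp only [commRel, ← leibnizBracket_apply k, map_add, add_mul, mul_add,
        LinearMap.add_apply]; abel
    rw [this]; exact add_mem hx hy
  | smul r x _ hx =>
    have : commRel b (r • x) y = r • commRel b x y := by
      simp only [commRel, ← leibnizBracket_apply k, map_smul, smul_mul_assoc, mul_smul_comm,
        smul_add, smul_sub, LinearMap.smul_apply]
    rw [this]; exact Submodule.smul_mem _ _ hx

/-- Here L₀ must be stable under bracketing on the right, so that {x_i, x_j} can be killed too. -/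
theorem AssocRule.comm_kill_right {i j : I} (hij : i < j) (hi : i ∈ I₀) :
    commRel b (b i) (b j) - word k [j] * word k [i] ∈ ruleSpan b I₀ (ShortlexLT · [j, i]) := by
  have e : commRel b (b i) (b j) - word k [j] * word k [i] =
      letter b ⁅b i, b j⁆ - 1 * word k [i] * word k [j] := by
    simp only [commRel, letter_basis]; rw [one_mul]; abel
  rw [e]
  refine sub_mem (ruleSpan_mono (fun v hv => .of_length_lt (by simp; omega))
    (letter_mem_ruleSpan hI₀ (leibnizKernel_bracket k _ (basis_mem_leibnizKernel hI₀ hi)))) ?_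
  rw [← word_nil]
  exact Submodule.subset_span ⟨[], [j], [i], _, .kill i hi, .swap hij, rfl⟩

/-- Here the bracket vanishes outright, since {L, L₀} = 0. -/
theorem AssocRule.comm_kill_left {i j : I} (hij : i < j) (hj : j ∈ I₀) :
    commRel b (b i) (b j) - word k [j] * word k [i] ∈ ruleSpan b I₀ (ShortlexLT · [j, i]) := by
  have e : commRel b (b i) (b j) - word k [j] * word k [i] = - (word k [i] * word k [j] * 1) := by
    simp only [commRel, letter_basis, bracket_leibnizKernel k _ (basis_mem_leibnizKernel hI₀ hj),
      map_zero]
    rw [mul_one]; abel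
  rw [e, ← word_nil]
  exact neg_mem (Submodule.subset_span ⟨[i], [], [j], _, .kill j hj, .swap hij, rfl⟩)

/-- The essential overlap x_j x_i x_h: sorting it in two ways differs by brackets of brackets, which
cancel by the Leibniz identity. -/
theorem AssocRule.comm_comm {h i j : I} (hhi : h < i) (hij : i < j) :
    commRel b (b i) (b j) * word k [h] - word k [j] * commRel b (b h) (b i) ∈
      ruleSpan b I₀ (ShortlexLT · [j, i, h]) := by
  -- The first four terms are the remaining sorting steps, at words below `[j, i, h]`. The last
  -- three have a bracket as one argument, so their words have length at most 2.
  have e : commRel b (b i) (b j) * word k [h] - word k [j] * commRel b (b h) (b i) =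
      1 * commRel b (b h) (b j) * word k [i] + word k [h] * commRel b (b i) (b j) * 1
      - word k [i] * commRel b (b h) (b j) * 1 - 1 * commRel b (b h) (b i) * word k [j]
      + commRel b (b h) ⁅b i, b j⁆ + commRel b ⁅b h, b j⁆ (b i) - commRel b ⁅b h, b i⁆ (b j) := by
    have jac := congrArg (letter b) (LeibnizAlgebra.leibniz k (b h) (b i) (b j))
    rw [map_add] at jac
    simp only [commRel, letter_basis, jac]
    noncomm_ring
  have small : ∀ x y : L, commRel b x y ∈ ruleSpan b I₀ (ShortlexLT · [j, i, h]) := fun x y =>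
    ruleSpan_mono (fun v hv => .of_length_lt (by simp; omega)) (commRel_mem_ruleSpan hI₀ x y)
  rw [e, ← word_nil]
  refine sub_mem (add_mem (add_mem (sub_mem (sub_mem (add_mem ?_ ?_) ?_) ?_) (small _ _))
    (small _ _)) (small _ _) <;> refine Submodule.subset_span
      ⟨_, _, _, _, .comm _ _ (by first | assumption | exact hhi.trans hij), .of_lex rfl ?_, rfl⟩
  · exact .cons (.rel hhi)
  · exact .rel (hhi.trans hij)
  · exact .rel hij
  · exact .rel hij

end

/-! ### Confluence of the associative rules -/

section

variable {b} [LinearOrder I] {I₀ : Set I}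

theorem ruleSpan_mul_word_mem {v w : List I} {p : WordAlgebra k I}
    (hp : p ∈ ruleSpan b I₀ (ShortlexLT · v)) :
    p * word k w ∈ ruleSpan b I₀ (ShortlexLT · (v ++ w)) :=
  ruleSpan_mul_mem (Q := (· = w))
    (by rintro a c ha rfl; simpa using ShortlexLT.append_append ha [] c) hp
    (word_mem_wordSpan rfl)

theorem word_mul_ruleSpan_mem {v w : List I} {p : WordAlgebra k I}
    (hp : p ∈ ruleSpan b I₀ (ShortlexLT · v)) :
    word k w * p ∈ ruleSpan b I₀ (ShortlexLT · (w ++ v)) :=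
  mul_mem_ruleSpan (P := (· = w))
    (by rintro a c rfl ha; simpa using ShortlexLT.append_append ha a [])
    (word_mem_wordSpan rfl) hp

/-- Two reductions of non-overlapping subwords commute; replacing each leading word by minus the
tail of its rule leaves multiples of the other rule at smaller words. -/
theorem AssocRule.disjoint {u₁ u₂ : List I} {r₁ r₂ : WordAlgebra k I}
    (h₁ : AssocRule b I₀ u₁ r₁) (h₂ : AssocRule b I₀ u₂ r₂) (d : List I) :
    r₁ * word k (d ++ u₂) - word k (u₁ ++ d) * r₂ ∈
      ruleSpan b I₀ (ShortlexLT · (u₁ ++ (d ++ u₂))) := by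
  have e₁ : r₁ * word k (d ++ u₂) - word k (u₁ ++ d) * r₂ =
      (r₁ - word k u₁) * word k d * r₂ * 1 - 1 * r₁ * (word k d * (r₂ - word k u₂)) := by
    simp only [word_append]; noncomm_ring
  rw [e₁]
  refine sub_mem ?_ ?_
  · rw [← word_nil]
    refine h₂.mul_mem (mul_mem_wordSpan (R := fun v => ∃ a, ShortlexLT a u₁ ∧ v = a ++ d)
      (fun a c ha hc => ⟨a, ha, by rw [hc]⟩) h₁.sub_word_mem
      (word_mem_wordSpan (P := (· = d)) rfl)) (word_mem_wordSpan (P := (· = [])) rfl) ?_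
    rintro _ _ ⟨a, ha, rfl⟩ rfl
    simpa using ha.append_append [] (d ++ u₂)
  · rw [← word_nil]
    refine h₁.mul_mem (word_mem_wordSpan (P := (· = [])) rfl)
      (mul_mem_wordSpan (P := (· = d)) (R := fun v => ∃ a, ShortlexLT a u₂ ∧ v = d ++ a) ?_
        (word_mem_wordSpan rfl) h₂.sub_word_mem) ?_
    · rintro _ a rfl ha; exact ⟨a, ha, rfl⟩
    · rintro _ _ rfl ⟨a, ha, rfl⟩
      simpa using ha.append_append (u₁ ++ d) []

variable [LeibnizAlgebra k L] (hI₀ : Submodule.span k (b '' I₀) = leibnizKernel k L)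

include hI₀

/-- The second leading word starts inside the first. As leading words have one or two letters,
either both rules are the same, or a killed letter meets a commutation rule at one of its ends, or
two commutation rules share one letter. -/
theorem AssocRule.overlap {u₁ u₂ c d c₁ c₂ : List I} {r₁ r₂ : WordAlgebra k I}
    (h₁ : AssocRule b I₀ u₁ r₁) (h₂ : AssocRule b I₀ u₂ r₂) (hd : d ≠ []) (hu : u₁ = c ++ d)
    (e : u₂ ++ c₂ = d ++ c₁) :
    r₁ * word k c₁ - word k c * r₂ * word k c₂ ∈ ruleSpan b I₀ (ShortlexLT · (u₁ ++ c₁)) := by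
  obtain ⟨x, d, rfl⟩ := List.exists_cons_of_ne_nil hd
  cases h₁ with
  | kill i hi =>
    obtain ⟨rfl, rfl, rfl⟩ : c = [] ∧ x = i ∧ d = [] := by
      rcases c with _ | ⟨y, c⟩ <;> simp_all
    cases h₂ with
    | kill i₂ hi₂ =>
      obtain ⟨rfl, rfl⟩ : i₂ = x ∧ c₂ = c₁ := by simpa using e
      simp [word_nil]
    | comm i₂ j₂ hij =>
      obtain ⟨rfl, rfl⟩ : j₂ = x ∧ i₂ :: c₂ = c₁ := by simpa using e
      have h := neg_mem (AssocRule.comm_kill_left hI₀ hij hi)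
      have e₁ : word k [j₂] * word k (i₂ :: c₂) - word k [] * commRel b (b i₂) (b j₂) * word k c₂ =
          -(commRel b (b i₂) (b j₂) - word k [j₂] * word k [i₂]) * word k c₂ := by
        rw [word_cons k i₂ c₂, word_nil]; noncomm_ring
      rw [e₁]
      exact ruleSpan_mul_word_mem (v := [j₂, i₂]) h
  | comm i j hij =>
    rcases c with _ | ⟨y, _ | ⟨z, c⟩⟩
    · obtain ⟨rfl, rfl⟩ : j = x ∧ [i] = d := by simpa using hu
      cases h₂ with
      | kill i₂ hi₂ =>
        obtain ⟨rfl, rfl⟩ : i₂ = j ∧ c₂ = i :: c₁ := by simpa using e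
        have h := AssocRule.comm_kill_left hI₀ hij hi₂
        have e₁ : commRel b (b i) (b i₂) * word k c₁ - word k [] * word k [i₂] * word k (i :: c₁) =
            (commRel b (b i) (b i₂) - word k [i₂] * word k [i]) * word k c₁ := by
          rw [word_cons k i c₁, word_nil]; noncomm_ring
        rw [e₁]
        exact ruleSpan_mul_word_mem (v := [i₂, i]) h
      | comm i₂ j₂ hij₂ =>
        obtain ⟨rfl, rfl, rfl⟩ : j₂ = j ∧ i₂ = i ∧ c₂ = c₁ := by simpa using e
        simp [word_nil]
    · obtain ⟨rfl, rfl, rfl⟩ : j = y ∧ i = x ∧ d = [] := by simpa using hu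
      cases h₂ with
      | kill i₂ hi₂ =>
        obtain ⟨rfl, rfl⟩ : i₂ = i ∧ c₂ = c₁ := by simpa using e
        rw [← sub_mul]
        exact ruleSpan_mul_word_mem (AssocRule.comm_kill_right hI₀ hij hi₂)
      | comm h i₂ hhi =>
        obtain ⟨rfl, rfl⟩ : i₂ = i ∧ h :: c₂ = c₁ := by simpa using e
        rw [word_cons k h c₂, ← mul_assoc, ← sub_mul]
        exact ruleSpan_mul_word_mem (v := [j, i₂, h]) (AssocRule.comm_comm hI₀ hhi hij)
    · simp at hu

/-- It is enough to let the first leading word begin the word; the second one starts either inside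
it or after its end. -/
theorem AssocRule.confluent_aux {u₁ u₂ c c₁ c₂ : List I} {r₁ r₂ : WordAlgebra k I}
    (h₁ : AssocRule b I₀ u₁ r₁) (h₂ : AssocRule b I₀ u₂ r₂) (e : u₁ ++ c₁ = c ++ (u₂ ++ c₂)) :
    r₁ * word k c₁ - word k c * r₂ * word k c₂ ∈ ruleSpan b I₀ (ShortlexLT · (u₁ ++ c₁)) := by
  have disj : ∀ d, c = u₁ ++ d → c₁ = d ++ (u₂ ++ c₂) →
      r₁ * word k c₁ - word k c * r₂ * word k c₂ ∈ ruleSpan b I₀ (ShortlexLT · (u₁ ++ c₁)) := by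
    rintro d rfl rfl
    have h := ruleSpan_mul_word_mem (w := c₂) (h₁.disjoint h₂ d)
    rw [sub_mul, mul_assoc r₁, ← word_append] at h
    simpa using h
  rcases List.append_eq_append_iff.1 e with ⟨d, hc, hc₁⟩ | ⟨d, hu, e'⟩
  · exact disj d hc hc₁
  -- With `d = []` the second leading word starts exactly where the first one ends, which still
  -- counts as disjoint.
  · by_cases hd : d = []
    · subst hd
      exact disj [] (by simpa using hu.symm) (by simpa using e'.symm)
    · exact h₁.overlap hI₀ h₂ hd hu e'

/-- Any two reductions of a word can be joined below this word. -/
theorem AssocRule.confluent {u₁ u₂ a₁ a₂ c₁ c₂ : List I} {r₁ r₂ : WordAlgebra k I}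
    (h₁ : AssocRule b I₀ u₁ r₁) (h₂ : AssocRule b I₀ u₂ r₂)
    (e : a₁ ++ u₁ ++ c₁ = a₂ ++ u₂ ++ c₂) :
    word k a₁ * r₁ * word k c₁ - word k a₂ * r₂ * word k c₂ ∈
      ruleSpan b I₀ (ShortlexLT · (a₁ ++ u₁ ++ c₁)) := by
  rw [List.append_assoc, List.append_assoc] at e
  rcases List.append_eq_append_iff.1 e with ⟨d, rfl, e'⟩ | ⟨d, rfl, e'⟩
  · have h := word_mul_ruleSpan_mem (w := a₁) (h₁.confluent_aux hI₀ h₂ e')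
    rw [← List.append_assoc] at h
    simpa only [mul_sub, word_append, mul_assoc] using h
  · have h := neg_mem (word_mul_ruleSpan_mem (w := a₂) (h₂.confluent_aux hI₀ h₁ e'))
    rw [e', ← List.append_assoc, ← List.append_assoc] at h
    simpa only [mul_sub, word_append, mul_assoc, neg_sub] using h

end

/-! ### Linear independence of the irreducible words -/

section

variable [LinearOrder I]

/-- The words that contain no leading word of a rule. -/
def IrreducibleWord (I₀ : Set I) (w : List I) : Prop :=
  ∀ a c u r, AssocRule b I₀ u r → w ≠ a ++ u ++ c

theorem irreducibleWord_of_pairwise {I₀ : Set I} {w : List I} (h₀ : ∀ i ∈ w, i ∉ I₀)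
    (hs : w.Pairwise (· ≤ ·)) : IrreducibleWord b I₀ w := by
  rintro a c u r hr rfl
  cases hr with
  | comm i j hij => simp [List.pairwise_append, hij.not_ge] at hs
  | kill i hi => exact h₀ i (by simp) hi

theorem exists_eq_of_not_pairwise {I₀ : Set I} {w : List I}
    (h : ¬ ((∀ i ∈ w, i ∉ I₀) ∧ w.Pairwise (· ≤ ·))) :
    ∃ a c u r, AssocRule b I₀ u r ∧ w = a ++ u ++ c := by
  rw [not_and_or] at h
  rcases h with h | h
  · push Not at h
    obtain ⟨i, hi, hi₀⟩ := h
    obtain ⟨a, c, rfl⟩ := List.append_of_mem hi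
    exact ⟨a, c, [i], _, .kill i hi₀, by simp⟩
  · rw [← List.isChain_iff_pairwise, List.isChain_iff_forall_rel_of_append_cons_cons] at h
    push Not at h
    obtain ⟨j, i, a, c, rfl, hij⟩ := h
    exact ⟨a, c, [j, i], _, .comm i j hij, by simp⟩

variable {b} {I₀ : Set I}

/-- A combination uses finitely many multiples of rules, and the largest of their leading words
bounds it. That this word satisfies `P` makes the well-founded descent possible. -/
theorem exists_mem_ruleSpan_of_ne_zero {P : List I → Prop} {p : WordAlgebra k I}
    (hp : p ∈ ruleSpan b I₀ P) (hp0 : p ≠ 0) :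
    ∃ w, P w ∧ p ∈ ruleSpan b I₀ (fun v => v = w ∨ ShortlexLT v w) := by
  suffices p = 0 ∨ ∃ w, P w ∧ p ∈ ruleSpan b I₀ (fun v => v = w ∨ ShortlexLT v w) from
    this.resolve_left hp0
  clear hp0
  have trans : ∀ {u v w : List I}, ShortlexLT u v → ShortlexLT v w → ShortlexLT u w := by
    intro u v w h₁ h₂
    rcases List.shortlex_def.1 h₁ with h₁ | ⟨e₁, h₁⟩ <;>
      rcases List.shortlex_def.1 h₂ with h₂ | ⟨e₂, h₂⟩
    · exact .of_length_lt (h₁.trans h₂)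
    · exact .of_length_lt (by omega)
    · exact .of_length_lt (by omega)
    · exact .of_lex (e₁.trans e₂) (lt_trans (α := List I) h₁ h₂)
  induction hp using Submodule.span_induction with
  | mem x hx =>
    obtain ⟨a, c, u, r, hr, hP, rfl⟩ := hx
    exact Or.inr ⟨_, hP, Submodule.subset_span ⟨a, c, u, r, hr, Or.inl rfl, rfl⟩⟩
  | zero => exact Or.inl rfl
  | add x y _ _ hx hy =>
    rcases hx with rfl | ⟨v, hv, hx⟩
    · simpa using hy
    rcases hy with rfl | ⟨w, hw, hy⟩
    · exact Or.inr ⟨v, hv, by simpa using hx⟩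
    right
    rcases trichotomous_of (ShortlexLT (I := I)) v w with h | rfl | h
    · refine ⟨w, hw, add_mem (ruleSpan_mono ?_ hx) hy⟩
      rintro _ (rfl | h')
      exacts [.inr h, .inr (trans h' h)]
    · exact ⟨v, hv, add_mem hx hy⟩
    · refine ⟨v, hv, add_mem hx (ruleSpan_mono ?_ hy)⟩
      rintro _ (rfl | h')
      exacts [.inr h, .inr (trans h' h)]
  | smul r x _ hx =>
    rcases hx with rfl | ⟨v, hv, hx⟩
    · simp
    · exact Or.inr ⟨v, hv, Submodule.smul_mem _ _ hx⟩

theorem not_shortlexLT_self (w : List I) : ¬ ShortlexLT w w :=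
  fun h => Std.Asymm.asymm w w h h

/-- A multiple of a rule contains no word above its leading word, so the coefficient at `w`
vanishes. -/
theorem ruleSpan_le_wordSpan {w : List I} :
    ruleSpan b I₀ (ShortlexLT · w) ≤ wordSpan k (· ≠ w) := by
  refine ruleSpan_le_iff.2 fun a c u r hr h => ?_
  rw [← sub_add_cancel (word k a * r * word k c) (word k (a ++ u ++ c))]
  refine add_mem (wordSpan_mono ?_ (hr.mul_sub_word_mem a c)) (word_mem_wordSpan ?_)
  · rintro v hv rfl; exact Std.Asymm.asymm _ _ h hv
  · rintro e; rw [e] at h; exact not_shortlexLT_self _ h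

variable [LeibnizAlgebra k L]

/-- An element of the ideal generated by the rules is zero if its words are irreducible. -/
theorem eq_zero_of_mem_ruleSpan_of_irreducible [WellFoundedLT I]
    (hI₀ : Submodule.span k (b '' I₀) = leibnizKernel k L) {p : WordAlgebra k I}
    (hp : p ∈ ruleSpan b I₀ (fun _ => True)) (hirr : p ∈ wordSpan k (IrreducibleWord b I₀)) :
    p = 0 := by
  -- Well-founded induction on the bound `w`: it suffices to make the bound strict, as a smaller
  -- word then bounds `p`.
  have key : ∀ w, p ∈ ruleSpan b I₀ (fun v => v = w ∨ ShortlexLT v w) → p = 0 := by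
    intro w
    induction w using (List.Shortlex.wf (r := (· < ·)) (wellFounded_lt (α := I))).induction with
    | _ w ih =>
    intro hw
    by_contra hp0
    suffices p ∈ ruleSpan b I₀ (ShortlexLT · w) by
      obtain ⟨v, hv, hpv⟩ := exists_mem_ruleSpan_of_ne_zero this hp0
      exact hp0 (ih v hv hpv)
    -- An irreducible `w` is not the leading word of any multiple of a rule, so the bound is already
    -- strict.
    by_cases hred : IrreducibleWord b I₀ w
    · refine ruleSpan_le_iff.2 ?_ hw
      rintro a c u r hr (h | h)
      · exact absurd h.symm (hred a c u r hr)
      · exact Submodule.subset_span ⟨a, c, u, r, hr, h, rfl⟩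
    · unfold IrreducibleWord at hred
      push Not at hred
      obtain ⟨a, c, u, r, hr, rfl⟩ := hred
      -- By confluence all multiples with leading word `w` agree modulo smaller ones, so they
      -- collapse to a scalar times a single one.
      have split : ∃ t : k, p - t • (word k a * r * word k c) ∈
          ruleSpan b I₀ (ShortlexLT · (a ++ u ++ c)) := by
        clear ih hp hirr hp0
        induction hw using Submodule.span_induction with
        | mem x hx =>
          obtain ⟨a', c', u', r', hr', hP, rfl⟩ := hx
          rcases hP with e | h
          · refine ⟨1, ?_⟩
            rw [one_smul, ← e]
            exact hr'.confluent hI₀ hr e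
          · refine ⟨0, ?_⟩
            rw [zero_smul, sub_zero]
            exact Submodule.subset_span ⟨a', c', u', r', hr', h, rfl⟩
        | zero => exact ⟨0, by simp⟩
        | add x y _ _ hx hy =>
          obtain ⟨s, hs⟩ := hx
          obtain ⟨t, ht⟩ := hy
          refine ⟨s + t, ?_⟩
          have := add_mem hs ht
          rwa [sub_add_sub_comm, ← add_smul] at this
        | smul s x _ hx =>
          obtain ⟨t, ht⟩ := hx
          refine ⟨s * t, ?_⟩
          have := Submodule.smul_mem _ s ht
          rwa [smul_sub, smul_smul] at this
      obtain ⟨t, ht⟩ := split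
      -- Compare coefficients at the reducible word `w`: it is 0 in `p`, 1 in the chosen multiple,
      -- and 0 in everything bounded strictly below `w`.
      suffices t = 0 by simpa [this] using ht
      have h₁ := wordBasis_repr_eq_zero (ruleSpan_le_wordSpan ht) (w := a ++ u ++ c) (by simp)
      have h₂ := wordBasis_repr_eq_zero hirr (w := a ++ u ++ c) (fun h => h a c u r hr rfl)
      have h₃ := wordBasis_repr_eq_zero (hr.mul_sub_word_mem a c) (w := a ++ u ++ c)
        (not_shortlexLT_self _)
      rw [map_sub, Finsupp.sub_apply, wordBasis_repr_word_self, sub_eq_zero] at h₃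
      rw [map_sub, map_smul, Finsupp.sub_apply, Finsupp.smul_apply, h₂, h₃, zero_sub,
        smul_eq_mul, mul_one, neg_eq_zero] at h₁
      exact h₁
  by_contra hp0
  obtain ⟨w, -, hw⟩ := exists_mem_ruleSpan_of_ne_zero hp hp0
  exact hp0 (key w hw)

end

end WordAlgebra

end

noncomputable section

/-! ### The order of normal diwords -/

namespace Diword

variable {I : Type*}

theorem length_mk (l : List I) (i : I) (r : List I) :
    (Diword.mk l i r).length = l.length + r.length + 1 := by
  simp [length, word]; omega

variable [LinearOrder I]

theorem lt_iff_wt_lt {u v : Diword I} : u < v ↔ u.wt < v.wt := Iff.rfl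

theorem lt_of_length_lt {u v : Diword I} (h : u.length < v.length) : u < v :=
  lt_iff_wt_lt.2 (Prod.Lex.toLex_lt_toLex.2 (Or.inl h))

theorem length_le_of_le {u v : Diword I} (h : u ≤ v) : u.length ≤ v.length := by
  by_contra h'
  exact h.not_gt (lt_of_length_lt (not_le.1 h'))

theorem lt_of_left_length_lt {u v : Diword I} (h : u.length = v.length)
    (hl : u.left.length < v.left.length) : u < v :=
  lt_iff_wt_lt.2 (Prod.Lex.toLex_lt_toLex.2
    (Or.inr ⟨h, Prod.Lex.toLex_lt_toLex.2 (Or.inl hl)⟩))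

theorem lt_of_shortlexLT_left {l l' : List I} (h : ShortlexLT l l') (i : I) (r : List I) :
    (⟨l, i, r⟩ : Diword I) < ⟨l', i, r⟩ := by
  rcases List.shortlex_def.1 h with h | ⟨hl, h⟩
  · exact lt_of_length_lt (by simpa [length_mk] using h)
  · exact lt_iff_wt_lt.2 (Prod.Lex.toLex_lt_toLex.2 (Or.inr ⟨by simp [length_mk, hl],
      Prod.Lex.toLex_lt_toLex.2 (Or.inr ⟨hl, h.append_of_length_eq hl _⟩)⟩))

theorem lt_of_shortlexLT_right {r r' : List I} (h : ShortlexLT r r') (l : List I) (i : I) :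
    (⟨l, i, r⟩ : Diword I) < ⟨l, i, r'⟩ := by
  rcases List.shortlex_def.1 h with h | ⟨hl, h⟩
  · exact lt_of_length_lt (by simpa [length_mk] using h)
  · exact lt_iff_wt_lt.2 (Prod.Lex.toLex_lt_toLex.2 (Or.inr ⟨by simp [length_mk, hl],
      Prod.Lex.toLex_lt_toLex.2 (Or.inr ⟨rfl, List.Lex.append_left _ (.cons h) _⟩)⟩))

end Diword

/-! ### The free dialgebra as a bimodule over the free associative algebra -/

theorem LinearMap.apply₃_mem {k M₁ M₂ M₃ M : Type*} [CommSemiring k] [AddCommMonoid M₁]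
    [Module k M₁] [AddCommMonoid M₂] [Module k M₂] [AddCommMonoid M₃] [Module k M₃]
    [AddCommMonoid M] [Module k M] (f : M₁ →ₗ[k] M₂ →ₗ[k] M₃ →ₗ[k] M) {N : Submodule k M}
    {S₁ : Set M₁} {S₂ : Set M₂} {S₃ : Set M₃} {x : M₁} {y : M₂} {z : M₃}
    (hx : x ∈ Submodule.span k S₁) (hy : y ∈ Submodule.span k S₂) (hz : z ∈ Submodule.span k S₃)
    (h : ∀ x ∈ S₁, ∀ y ∈ S₂, ∀ z ∈ S₃, f x y z ∈ N) : f x y z ∈ N := by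
  induction hx using Submodule.span_induction with
  | mem x hx =>
    induction hy using Submodule.span_induction with
    | mem y hy =>
      induction hz using Submodule.span_induction with
      | mem z hz => exact h x hx y hy z hz
      | zero => simp
      | add z z' _ _ h h' => rw [map_add]; exact add_mem h h'
      | smul r z _ h => rw [map_smul]; exact N.smul_mem r h
    | zero => simp
    | add z z' _ _ h h' => rw [map_add, LinearMap.add_apply]; exact add_mem h h'
    | smul r z _ h => rw [map_smul, LinearMap.smul_apply]; exact N.smul_mem r h
  | zero => simp
  | add z z' _ _ h h' => simp only [map_add, LinearMap.add_apply]; exact add_mem h h'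
  | smul r z _ h => simp only [map_smul, LinearMap.smul_apply]; exact N.smul_mem r h

namespace FreeDialgebra

variable {k L I : Type*} [Field k] [AddCommGroup L] [Module k L] (b : Module.Basis I k L)

/-- The trilinear map sending words `l`, `r` and a generator `x` to the diword `l ⊢ x ⊣ r`. -/
def triple : WordAlgebra k I →ₗ[k] L →ₗ[k] WordAlgebra k I →ₗ[k] FreeDialgebra k I :=
  (wordBasis k I).constr k fun l => b.constr k fun i => (wordBasis k I).constr k fun r =>
    Finsupp.single ⟨l, i, r⟩ 1

theorem triple_add_left (p p' : WordAlgebra k I) (x : L) (q : WordAlgebra k I) :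
    triple b (p + p') x q = triple b p x q + triple b p' x q := by
  simp only [map_add, LinearMap.add_apply]

theorem triple_add_center (p : WordAlgebra k I) (x x' : L) (q : WordAlgebra k I) :
    triple b p (x + x') q = triple b p x q + triple b p x' q := by
  simp only [map_add, LinearMap.add_apply]

theorem triple_add_right (p : WordAlgebra k I) (x : L) (q q' : WordAlgebra k I) :
    triple b p x (q + q') = triple b p x q + triple b p x q' :=
  map_add _ _ _

theorem triple_sub_left (p p' : WordAlgebra k I) (x : L) (q : WordAlgebra k I) :
    triple b (p - p') x q = triple b p x q - triple b p' x q := by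
  rw [eq_sub_iff_add_eq, ← triple_add_left, sub_add_cancel]

theorem triple_sub_right (p : WordAlgebra k I) (x : L) (q q' : WordAlgebra k I) :
    triple b p x (q - q') = triple b p x q - triple b p x q' :=
  map_sub _ _ _

theorem triple_word (l : List I) (i : I) (r : List I) :
    triple b (word k l) (b i) (word k r) = Finsupp.single ⟨l, i, r⟩ 1 := by
  simp [triple, word]

theorem of_eq_triple (i : I) : of k i = triple b 1 (b i) 1 := by
  rw [← word_nil, triple_word, of]

theorem letters_eq_triple (x : L) : letters b x = triple b 1 x 1 := by
  have : letters b = ((triple b 1).flip 1) :=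
    b.ext fun i => by simp [letters, of_eq_triple b]
  rw [this, LinearMap.flip_apply]

variable {b} in
/-- An identity that is linear in an element of `L` may be checked on the basis. -/
theorem basis_induction {P : L → Prop} (basis : ∀ i, P (b i))
    (add : ∀ x y, P x → P y → P (x + y)) (smul : ∀ (r : k) x, P x → P (r • x)) (zero : P 0)
    (x : L) : P x := by
  have hx := b.mem_span x
  induction hx using Submodule.span_induction with
  | mem x h => obtain ⟨v, rfl⟩ := h; exact basis v
  | zero => exact zero
  | add x y _ _ hx hy => exact add x y hx hy
  | smul r x _ hx => exact smul r x hx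

theorem triple_hom_ext {M : Type*} [AddCommGroup M] [Module k M] {f g : FreeDialgebra k I →ₗ[k] M}
    (h : ∀ p x q, f (triple b p x q) = g (triple b p x q)) : f = g := by
  refine Finsupp.lhom_ext' fun ⟨l, i, r⟩ => LinearMap.ext_ring ?_
  have := h (word k l) (b i) (word k r)
  rwa [triple_word] at this

theorem dashv_triple_word (p q : WordAlgebra k I) (x : L) (l r : List I) (i : I) :
    triple b p x q ⊣ᵈ triple b (word k l) (b i) (word k r) =
      triple b p x (q * word k (l ++ i :: r)) := by
  induction p using WordAlgebra.induction with
  | word l' =>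
    induction x using basis_induction (b := b) with
    | basis j =>
      induction q using WordAlgebra.induction with
      | word r' =>
        rw [triple_word, triple_word, ← word_append, triple_word]
        exact (bilin_single _ _ _ _ _).trans (by rw [mul_one]; rfl)
      | add p q hp hq => rw [map_add, Dialgebra.add_dashv k, hp, hq, ← map_add, ← add_mul]
      | smul s p hp => rw [map_smul, Dialgebra.smul_dashv, hp, ← map_smul, smul_mul_assoc]
    | add p q hp hq => simp only [map_add, LinearMap.add_apply, Dialgebra.add_dashv k, hp, hq]
    | smul s p hp => simp only [map_smul, LinearMap.smul_apply, Dialgebra.smul_dashv, hp]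
    | zero =>
      have h := Dialgebra.smul_dashv (0 : k) (0 : FreeDialgebra k I)
        (triple b (word k l) (b i) (word k r))
      simpa using h
  | add p q hp hq => simp only [map_add, LinearMap.add_apply, Dialgebra.add_dashv k, hp, hq]
  | smul s p hp => simp only [map_smul, LinearMap.smul_apply, Dialgebra.smul_dashv, hp]

theorem vdash_word_triple (p q : WordAlgebra k I) (x : L) (l r : List I) (i : I) :
    triple b (word k l) (b i) (word k r) ⊢ᵈ triple b p x q =
      triple b (word k (l ++ i :: r) * p) x q := by
  induction p using WordAlgebra.induction with
  | word l' =>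
    induction x using basis_induction (b := b) with
    | basis j =>
      induction q using WordAlgebra.induction with
      | word r' =>
        rw [triple_word, triple_word, ← word_append, triple_word]
        exact (bilin_single _ _ _ _ _).trans (by rw [mul_one]; rfl)
      | add p q hp hq => rw [map_add, Dialgebra.vdash_add k, hp, hq, ← map_add]
      | smul s p hp => rw [map_smul, Dialgebra.vdash_smul, hp, ← map_smul]
    | add p q hp hq => simp only [map_add, LinearMap.add_apply, Dialgebra.vdash_add k, hp, hq]
    | smul s p hp => simp only [map_smul, LinearMap.smul_apply, Dialgebra.vdash_smul, hp]
    | zero =>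
      have h := Dialgebra.vdash_smul (0 : k) (triple b (word k l) (b i) (word k r))
        (0 : FreeDialgebra k I)
      simpa using h
  | add p q hp hq =>
    simp only [map_add, LinearMap.add_apply, Dialgebra.vdash_add k, hp, hq, mul_add]
  | smul s p hp =>
    simp only [map_smul, LinearMap.smul_apply, Dialgebra.vdash_smul, hp, mul_smul_comm]

/-- The linear map that forgets the centers of diwords. -/
def forget : FreeDialgebra k I →ₗ[k] WordAlgebra k I :=
  Finsupp.lift _ k _ fun u => word k u.word

@[simp] theorem forget_of (i : I) : forget (of k i) = word k [i] := by
  simp [forget, of, Diword.word]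

theorem forget_triple (p q : WordAlgebra k I) (x : L) :
    forget (triple b p x q) = p * letter b x * q := by
  induction p using WordAlgebra.induction with
  | word l' =>
    induction x using basis_induction (b := b) with
    | basis j =>
      induction q using WordAlgebra.induction with
      | word r' =>
        rw [triple_word, letter_basis, ← word_append, ← word_append]
        simp [forget, Diword.word]
      | add p q hp hq => rw [map_add, map_add, hp, hq, mul_add]
      | smul s p hp => rw [map_smul, map_smul, hp, mul_smul_comm]
    | add p q hp hq => simp only [map_add, LinearMap.add_apply, hp, hq, add_mul, mul_add]
    | smul s p hp =>
      simp only [map_smul, LinearMap.smul_apply, hp, smul_mul_assoc, mul_smul_comm]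
    | zero => simp
  | add p q hp hq => simp only [map_add, LinearMap.add_apply, hp, hq, add_mul]
  | smul s p hp => simp only [map_smul, LinearMap.smul_apply, hp, smul_mul_assoc]

/-- The right factor of `⊣` matters only through its underlying word. This reduces products in the
free dialgebra to products in the free associative algebra. -/
theorem triple_dashv (p q : WordAlgebra k I) (x : L) (f : FreeDialgebra k I) :
    triple b p x q ⊣ᵈ f = triple b p x (q * forget f) := by
  have : bilin Diword.dashv (triple b p x q) =
      (triple b p x) ∘ₗ (LinearMap.mulLeft k q) ∘ₗ forget := by
    refine Finsupp.lhom_ext' fun ⟨l, i, r⟩ => LinearMap.ext_ring ?_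
    have h : bilin Diword.dashv _ _ = _ := dashv_triple_word b p q x l r i
    rw [triple_word] at h
    simpa [forget, Diword.word] using h
  exact LinearMap.congr_fun this f

theorem vdash_triple (p q : WordAlgebra k I) (x : L) (f : FreeDialgebra k I) :
    f ⊢ᵈ triple b p x q = triple b (forget f * p) x q := by
  have : (bilin Diword.vdash).flip (triple b p x q) =
      ((triple b).flip x).flip q ∘ₗ (LinearMap.mulRight k p) ∘ₗ forget := by
    refine Finsupp.lhom_ext' fun ⟨l, i, r⟩ => LinearMap.ext_ring ?_
    have h : bilin Diword.vdash _ _ = _ := vdash_word_triple b p q x l r i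
    rw [triple_word] at h
    simpa [forget, Diword.word] using h
  exact LinearMap.congr_fun this f

theorem of_vdash_triple (j : I) (p q : WordAlgebra k I) (x : L) :
    of k j ⊢ᵈ triple b p x q = triple b (word k [j] * p) x q := by
  rw [vdash_triple, forget_of]

theorem triple_dashv_of (j : I) (p q : WordAlgebra k I) (x : L) :
    triple b p x q ⊣ᵈ of k j = triple b p x (q * word k [j]) := by
  rw [triple_dashv, forget_of]

theorem of_dashv (x : I) (f : FreeDialgebra k I) : of k x ⊣ᵈ f = triple b 1 (b x) (forget f) := by
  rw [of_eq_triple b, triple_dashv, one_mul]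

theorem vdash_of (x : I) (f : FreeDialgebra k I) : f ⊢ᵈ of k x = triple b (forget f) (b x) 1 := by
  rw [of_eq_triple b, vdash_triple, mul_one]

section

variable {b}

theorem triple_mem {P Q : List I → Prop} {Z : Set I} {N : Submodule k (FreeDialgebra k I)}
    {p q : WordAlgebra k I} {x : L} (hp : p ∈ wordSpan k P) (hx : x ∈ Submodule.span k (b '' Z))
    (hq : q ∈ wordSpan k Q)
    (h : ∀ l i r, P l → i ∈ Z → Q r → Finsupp.single ⟨l, i, r⟩ 1 ∈ N) :
    triple b p x q ∈ N := by
  refine LinearMap.apply₃_mem _ hp hx hq ?_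
  rintro _ ⟨l, hl, rfl⟩ _ ⟨i, hi, rfl⟩ _ ⟨r, hr, rfl⟩
  rw [triple_word]
  exact h l i r hl hi hr

theorem mem_span_basis_singleton (i : I) : b i ∈ Submodule.span k (b '' {i}) :=
  Submodule.subset_span ⟨i, rfl, rfl⟩

theorem mem_span_basis_univ (x : L) : x ∈ Submodule.span k (b '' Set.univ) := by
  rw [Set.image_univ, b.span_eq]; trivial

theorem rightNormed_triple_one (x : L) (q : WordAlgebra k I) : RightNormed (triple b 1 x q) := by
  have h : triple b 1 x q ∈ Finsupp.supported k k {u : Diword I | u.left = []} := by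
    rw [← word_nil]
    refine triple_mem (word_mem_wordSpan (P := (· = [])) rfl) (mem_span_basis_univ _)
      (Q := fun _ => True) ?_ ?_
    · have := (wordBasis k I).mem_span q
      rwa [wordSpan, Set.ofPred_true, Set.image_univ]
    · rintro _ i r rfl - -
      exact Finsupp.single_mem_supported k _ rfl
  exact fun u hu => h hu

theorem leftNormed_triple_one (x : L) (p : WordAlgebra k I) : LeftNormed (triple b p x 1) := by
  have h : triple b p x 1 ∈ Finsupp.supported k k {u : Diword I | u.right = []} := by
    rw [← word_nil]
    refine triple_mem (P := fun _ => True) ?_ (mem_span_basis_univ _)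
      (word_mem_wordSpan (P := (· = [])) rfl) ?_
    · have := (wordBasis k I).mem_span p
      rwa [wordSpan, Set.ofPred_true, Set.image_univ]
    · rintro r i _ - - rfl
      exact Finsupp.single_mem_supported k _ rfl
  exact fun u hu => h hu

theorem word_mem_eqSpan (v : List I) : word k v ∈ wordSpan k (· = v) := word_mem_wordSpan rfl

/-- Homogeneity serves to read off degrees in the compositions of multiplication, where a leading
diword is not directly at hand. -/
theorem length_of_mem_support_triple {p q : WordAlgebra k I} {x : L} {m n : ℕ}
    (hp : p ∈ wordSpan k (fun v => v.length = m)) (hq : q ∈ wordSpan k (fun v => v.length = n))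
    {u : Diword I} (hu : u ∈ (triple b p x q).support) : u.length = m + n + 1 := by
  have h : triple b p x q ∈ Finsupp.supported k k {u : Diword I | u.length = m + n + 1} := by
    refine triple_mem hp (mem_span_basis_univ _) hq ?_
    rintro l i r rfl - rfl
    exact Finsupp.single_mem_supported k _ (Diword.length_mk l i r)
  exact h hu

theorem one_mem_wordSpan : (1 : WordAlgebra k I) ∈ wordSpan k (fun v => v.length = 0) := by
  rw [← word_nil]; exact word_mem_wordSpan rfl

end

/-! ### Filling a context -/

theorem plug_add (c : DiContext I) (f g : FreeDialgebra k I) :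
    c.plug (f + g) = c.plug f + c.plug g := Finsupp.mapDomain_add

theorem plug_smul (c : DiContext I) (s : k) (f : FreeDialgebra k I) :
    c.plug (s • f) = s • c.plug f := Finsupp.mapDomain_smul _ _

theorem plug_center (a c : List I) (p : WordAlgebra k I) (x : L) (q : WordAlgebra k I) :
    (DiContext.center a c).plug (triple b p x q) = triple b (word k a * p) x (q * word k c) := by
  induction p using WordAlgebra.induction with
  | word l =>
    induction x using basis_induction (b := b) with
    | basis i =>
      induction q using WordAlgebra.induction with
      | word r =>
        rw [triple_word, DiContext.plug, Finsupp.mapDomain_single, ← word_append, ← word_append,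
          triple_word]; rfl
      | add p q hp hq => simp only [map_add, plug_add, hp, hq, add_mul]
      | smul s p hp => simp only [map_smul, plug_smul, hp, smul_mul_assoc]
    | add p q hp hq => simp only [map_add, LinearMap.add_apply, plug_add, hp, hq]
    | smul s p hp => simp only [map_smul, LinearMap.smul_apply, plug_smul, hp]
    | zero => simp [DiContext.plug]
  | add p q hp hq => simp only [map_add, LinearMap.add_apply, plug_add, hp, hq, mul_add]
  | smul s p hp => simp only [map_smul, LinearMap.smul_apply, plug_smul, hp, mul_smul_comm]

/-- A hole away from the center sees only the underlying associative polynomial. -/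
theorem plug_before (a c : List I) (t : I) (d : List I) (f : FreeDialgebra k I) :
    (DiContext.before a c t d).plug f =
      triple b (word k a * forget f * word k c) (b t) (word k d) := by
  induction f using Finsupp.induction_linear with
  | zero => simp [DiContext.plug]
  | add f g hf hg => rw [plug_add, hf, hg, map_add, mul_add, add_mul, triple_add_left]
  | single u s =>
    have e : (Finsupp.single u s : FreeDialgebra k I) = s • Finsupp.single u 1 := by simp
    have e' : forget (Finsupp.single u 1 : FreeDialgebra k I) = word k u.word := by simp [forget]
    rw [e, plug_smul, map_smul, mul_smul_comm, smul_mul_assoc, map_smul, LinearMap.smul_apply,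
      LinearMap.smul_apply, e', ← word_append, ← word_append, triple_word, DiContext.plug,
      Finsupp.mapDomain_single]
    rfl

theorem plug_after (a : List I) (t : I) (c d : List I) (f : FreeDialgebra k I) :
    (DiContext.after a t c d).plug f =
      triple b (word k a) (b t) (word k c * forget f * word k d) := by
  induction f using Finsupp.induction_linear with
  | zero => simp [DiContext.plug]
  | add f g hf hg => rw [plug_add, hf, hg, map_add, mul_add, add_mul, triple_add_right]
  | single u s =>
    have e : (Finsupp.single u s : FreeDialgebra k I) = s • Finsupp.single u 1 := by simp
    have e' : forget (Finsupp.single u 1 : FreeDialgebra k I) = word k u.word := by simp [forget]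
    rw [e, plug_smul, map_smul, mul_smul_comm, smul_mul_assoc, map_smul,
      e', ← word_append, ← word_append, triple_word, DiContext.plug,
      Finsupp.mapDomain_single]
    rfl

end FreeDialgebra

end

noncomputable section

/-! ### The Gröbner–Shirshov basis -/

namespace FreeDialgebra

variable {k L I : Type*} [Field k] [AddCommGroup L] [Module k L] [Bracket L L]
  (b : Module.Basis I k L)

/-- The relation `y ⊢ x - x ⊣ y + {x, y}`, multiplied by `p` on the left and by `q` on the
right. -/
def envRel (p : WordAlgebra k I) (y x : L) (q : WordAlgebra k I) : FreeDialgebra k I :=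
  triple b (p * letter b y) x q - triple b p x (letter b y * q) + triple b p ⁅x, y⁆ q

theorem envRel_mem [LeibnizAlgebra k L] {P Q : List I → Prop} {Y Z : Set I}
    {N : Submodule k (FreeDialgebra k I)}
    {p q : WordAlgebra k I} {x y : L} (hp : p ∈ wordSpan k P) (hy : y ∈ Submodule.span k (b '' Y))
    (hx : x ∈ Submodule.span k (b '' Z)) (hq : q ∈ wordSpan k Q)
    (h : ∀ l j i r, P l → j ∈ Y → i ∈ Z → Q r → envRel b (word k l) (b j) (b i) (word k r) ∈ N) :
    envRel b p y x q ∈ N := by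
  induction hp using Submodule.span_induction with
  | mem p hp =>
    obtain ⟨l, hl, rfl⟩ := hp
    induction hq using Submodule.span_induction with
    | mem q hq =>
      obtain ⟨r, hr, rfl⟩ := hq
      induction hy using Submodule.span_induction with
      | mem y hy =>
        obtain ⟨j, hj, rfl⟩ := hy
        induction hx using Submodule.span_induction with
        | mem x hx =>
          obtain ⟨i, hi, rfl⟩ := hx
          exact h l j i r hl hj hi hr
        | zero => simp [envRel, ← leibnizBracket_apply k]
        | add x x' _ _ hx hx' =>
          convert add_mem hx hx' using 1
          simp only [envRel, ← leibnizBracket_apply k, map_add, LinearMap.add_apply]; abel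
        | smul s x _ hx =>
          convert N.smul_mem s hx using 1
          simp only [envRel, ← leibnizBracket_apply k, map_smul, LinearMap.smul_apply, smul_add,
            smul_sub]
      | zero => simp [envRel, ← leibnizBracket_apply k]
      | add x x' _ _ hx hx' =>
        convert add_mem hx hx' using 1
        simp only [envRel, ← leibnizBracket_apply k, map_add, LinearMap.add_apply, mul_add,
          add_mul]; abel
      | smul s x _ hx =>
        convert N.smul_mem s hx using 1
        simp only [envRel, ← leibnizBracket_apply k, map_smul, LinearMap.smul_apply, smul_add,
          smul_sub, mul_smul_comm, smul_mul_assoc]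
    | zero => simp [envRel]
    | add x x' _ _ hx hx' =>
      convert add_mem hx hx' using 1
      simp only [envRel, map_add, mul_add]; abel
    | smul s x _ hx =>
      convert N.smul_mem s hx using 1
      simp only [envRel, map_smul, smul_add, smul_sub, mul_smul_comm]
  | zero => simp [envRel]
  | add x x' _ _ hx hx' =>
    convert add_mem hx hx' using 1
    simp only [envRel, map_add, LinearMap.add_apply, add_mul]; abel
  | smul s x _ hx =>
    convert N.smul_mem s hx using 1
    simp only [envRel, map_smul, LinearMap.smul_apply, smul_add, smul_sub, smul_mul_assoc]

/-- The critical pair of (b) and (a) on the word y x t with center t. Carrying both letters across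
the center in either order leaves `commRel` on the right, which is how (d) arises; the terms with a
double bracket at the center cancel by the Leibniz identity. -/
theorem triple_commRel_sub_envRel [LeibnizAlgebra k L] (p q : WordAlgebra k I) (x y t : L) :
    triple b (p * commRel b x y) t q - envRel b (p * letter b y) x t q =
      - envRel b (p * letter b x) y t q + envRel b p ⁅x, y⁆ t q + envRel b p y t (letter b x * q)
      - envRel b p y ⁅t, x⁆ q - envRel b p x t (letter b y * q) + envRel b p x ⁅t, y⁆ q
      + triple b p t (commRel b x y * q) := by
  have jac := LeibnizAlgebra.leibniz k t x y
  simp only [envRel, commRel, mul_add, add_mul, mul_sub, sub_mul, triple_add_left,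
    triple_add_center, triple_add_right, triple_sub_left, triple_sub_right, jac, mul_assoc]
  abel

theorem plug_center_envRel (a d : List I) (p q : WordAlgebra k I) (y x : L) :
    (DiContext.center a d).plug (envRel b p y x q) =
      envRel b (word k a * p) y x (q * word k d) := by
  have hsub : ∀ f g : FreeDialgebra k I, (DiContext.center a d).plug (f - g) =
      (DiContext.center a d).plug f - (DiContext.center a d).plug g := fun f g => by
    rw [eq_sub_iff_add_eq, ← plug_add, sub_add_cancel]
  simp only [envRel, plug_add, hsub, plug_center, mul_assoc]

theorem envRel_one (i j : I) : envRel b 1 (b j) (b i) 1 =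
    Finsupp.single ⟨[j], i, []⟩ 1 - Finsupp.single ⟨[], i, [j]⟩ 1 + triple b 1 ⁅b i, b j⁆ 1 := by
  simp only [← triple_word b, word_nil, envRel, letter_basis, one_mul, mul_one]

/-- The diword with center `i` followed by `j` has coefficient -1: the bracket term is left normed
and cannot cancel it. -/
theorem not_leftNormed_envRel (i j : I) : ¬ LeftNormed (envRel b 1 (b j) (b i) 1) := by
  intro h
  have h₁ : triple b 1 ⁅b i, b j⁆ 1 ⟨[], i, [j]⟩ = 0 := by
    by_contra h'
    simpa using leftNormed_triple_one (b := b) ⁅b i, b j⁆ 1 _ (Finsupp.mem_support_iff.2 h')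
  have h₂ : envRel b 1 (b j) (b i) 1 ⟨[], i, [j]⟩ = -1 := by
    rw [envRel_one, Finsupp.add_apply, h₁, Finsupp.sub_apply, Finsupp.single_eq_same,
      Finsupp.single_eq_of_ne (by simp)]
    simp
  have := h ⟨[], i, [j]⟩ (Finsupp.mem_support_iff.2 (by simp [h₂]))
  simp at this

/-! ### The relations (a)–(e) -/

section Relations

variable {b} [LinearOrder I] {I₀ : Set I}

theorem gsRelation_envRel (i j : I) : GSRelation b I₀ (envRel b 1 (b j) (b i) 1) := by
  convert GSRelation.a (I₀ := I₀) (b := b) i j using 1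
  rw [of_eq_triple b i, of_vdash_triple, triple_dashv_of, letters_eq_triple]
  simp [envRel]

/-- Relations (d) and (e) are exactly the associative rules placed after a central letter, and (b),
(c) are the same rules placed before one. -/
theorem gsRelation_right {u : List I} {r : WordAlgebra k I} (h : AssocRule b I₀ u r) (t : I) :
    GSRelation b I₀ (triple b 1 (b t) r) := by
  cases h with
  | comm i j hij =>
    convert GSRelation.d (I₀ := I₀) (b := b) i j t hij using 1
    simp only [of_dashv b, triple_dashv_of, forget_of, letters_eq_triple, forget_triple, one_mul,
      mul_one, commRel, triple_add_right, triple_sub_right, letter_basis]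
  | kill i hi =>
    convert GSRelation.e (b := b) i t hi using 1
    rw [of_dashv b, forget_of]

theorem gsRelation_left {u : List I} {r : WordAlgebra k I} (h : AssocRule b I₀ u r) (t : I) :
    GSRelation b I₀ (triple b r (b t) 1) := by
  cases h with
  | comm i j hij =>
    convert GSRelation.b (I₀ := I₀) (b := b) i j t hij using 1
    simp only [vdash_of b, forget_of, letters_eq_triple, forget_triple, one_mul, mul_one, commRel,
      triple_add_left, triple_sub_left, letter_basis]
  | kill i hi =>
    convert GSRelation.c (b := b) i t hi using 1
    rw [vdash_of b, forget_of]

theorem gsRelation_cases {f : FreeDialgebra k I} (h : GSRelation b I₀ f) :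
    (∃ i j, f = envRel b 1 (b j) (b i) 1) ∨
    (∃ u r t, AssocRule b I₀ u r ∧ f = triple b r (b t) 1) ∨
    (∃ u r t, AssocRule b I₀ u r ∧ f = triple b 1 (b t) r) := by
  cases h with
  | a i j =>
    refine Or.inl ⟨i, j, ?_⟩
    rw [of_eq_triple b i, of_vdash_triple, triple_dashv_of, letters_eq_triple]
    simp [envRel]
  | b i j t hij =>
    refine Or.inr (Or.inl ⟨_, _, t, .comm i j hij, ?_⟩)
    simp only [vdash_of b, forget_of, letters_eq_triple, forget_triple, one_mul, mul_one, commRel,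
      triple_add_left, triple_sub_left, letter_basis]
  | c i t hi => exact Or.inr (Or.inl ⟨_, _, t, .kill i hi, by rw [vdash_of b, forget_of]⟩)
  | d i j t hij =>
    refine Or.inr (Or.inr ⟨_, _, t, .comm i j hij, ?_⟩)
    simp only [of_dashv b, triple_dashv_of, forget_of, letters_eq_triple, forget_triple, one_mul,
      mul_one, commRel, triple_add_right, triple_sub_right, letter_basis]
  | e i t hi => exact Or.inr (Or.inr ⟨_, _, t, .kill i hi, by rw [of_dashv b, forget_of]⟩)

/-- The span of the diwords below `u`. -/
def belowSpan (k : Type*) [Field k] (u : Diword I) : Submodule k (FreeDialgebra k I) :=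
  Finsupp.supported k k {v | v < u}

theorem single_mem_belowSpan {u v : Diword I} (h : v < u) (s : k) :
    Finsupp.single v s ∈ belowSpan k u :=
  Finsupp.single_mem_supported k s h

theorem isLead_of_sub_mem {f : FreeDialgebra k I} {u : Diword I}
    (h : f - Finsupp.single u 1 ∈ belowSpan k u) : IsLead f u ∧ f u = 1 := by
  have h' : ∀ v, (f - Finsupp.single u 1 : FreeDialgebra k I) v ≠ 0 → v < u := fun v hv =>
    h (Finsupp.mem_support_iff.2 hv)
  have hu : f u = 1 := by
    by_contra hne
    refine lt_irrefl u (h' u ?_)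
    rw [Finsupp.sub_apply, Finsupp.single_eq_same]
    exact sub_ne_zero.2 hne
  refine ⟨⟨by simp [hu], fun v hv => ?_⟩, hu⟩
  by_cases e : v = u
  · exact e.le
  · refine (h' v ?_).le
    rw [Finsupp.sub_apply, Finsupp.single_eq_of_ne e, sub_zero]
    exact Finsupp.mem_support_iff.1 hv

theorem IsLead.unique {f : FreeDialgebra k I} {u v : Diword I} (hu : IsLead f u)
    (hv : IsLead f v) : u = v :=
  le_antisymm (hv.2 _ hu.1) (hu.2 _ hv.1)

theorem IsLead.not_leftNormed {f : FreeDialgebra k I} {u : Diword I} (hu : IsLead f u)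
    (h : u.right ≠ []) : ¬ LeftNormed f := fun h' => h (h' u hu.1)

theorem IsLead.not_rightNormed {f : FreeDialgebra k I} {u : Diword I} (hu : IsLead f u)
    (h : u.left ≠ []) : ¬ RightNormed f := fun h' => h (h' u hu.1)

theorem isLead_triple_right {u : List I} {r : WordAlgebra k I} (hr : AssocRule b I₀ u r)
    (p : List I) (t : I) (a c : List I) :
    IsLead (triple b (word k p) (b t) (word k a * r * word k c)) ⟨p, t, a ++ u ++ c⟩ ∧
      triple b (word k p) (b t) (word k a * r * word k c) ⟨p, t, a ++ u ++ c⟩ = 1 := by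
  refine isLead_of_sub_mem ?_
  rw [← triple_word b, ← triple_sub_right]
  refine triple_mem (word_mem_wordSpan (P := (· = p)) rfl) (mem_span_basis_singleton t)
    (hr.mul_sub_word_mem a c) ?_
  rintro _ _ v rfl rfl hv
  exact single_mem_belowSpan (Diword.lt_of_shortlexLT_right hv _ _) _

theorem isLead_triple_left {u : List I} {r : WordAlgebra k I} (hr : AssocRule b I₀ u r)
    (a c : List I) (t : I) (q : List I) :
    IsLead (triple b (word k a * r * word k c) (b t) (word k q)) ⟨a ++ u ++ c, t, q⟩ ∧
      triple b (word k a * r * word k c) (b t) (word k q) ⟨a ++ u ++ c, t, q⟩ = 1 := by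
  refine isLead_of_sub_mem ?_
  rw [← triple_word b, ← triple_sub_left]
  refine triple_mem (hr.mul_sub_word_mem a c) (mem_span_basis_singleton t)
    (word_mem_wordSpan (P := (· = q)) rfl) ?_
  rintro v _ _ hv rfl rfl
  exact single_mem_belowSpan (Diword.lt_of_shortlexLT_left hv _ _) _

/-- Among the two diwords of length 2, the one with the longer left part is larger, so (a) is
oriented towards carrying letters to the right of the center. -/
theorem isLead_envRel (i j : I) :
    IsLead (envRel b 1 (b j) (b i) 1) ⟨[j], i, []⟩ ∧
      envRel b 1 (b j) (b i) 1 ⟨[j], i, []⟩ = 1 := by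
  refine isLead_of_sub_mem ?_
  have e : envRel b 1 (b j) (b i) 1 - Finsupp.single ⟨[j], i, []⟩ 1 =
      triple b (word k []) ⁅b i, b j⁆ (word k []) - Finsupp.single ⟨[], i, [j]⟩ 1 := by
    rw [envRel_one, word_nil]; abel
  rw [e]
  refine sub_mem (triple_mem (word_mem_wordSpan (P := (· = [])) rfl) (mem_span_basis_univ _)
    (word_mem_wordSpan (P := (· = [])) rfl) ?_) (single_mem_belowSpan
      (Diword.lt_of_left_length_lt (by simp [Diword.length_mk]) (by simp)) _)
  rintro _ i _ rfl - rfl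
  exact single_mem_belowSpan (Diword.lt_of_length_lt (by simp [Diword.length_mk])) _

end Relations

end FreeDialgebra

end

noncomputable section

namespace FreeDialgebra

/-! ### Spans of normal s-diwords and triviality of compositions -/

section Spans

variable {k I : Type*} [Field k] [LinearOrder I]

/-- The span of the normal `s`-diwords, `s ∈ S`, whose leading diword has property `P`. -/
def normalSpan (S : Set (FreeDialgebra k I)) (P : Diword I → Prop) :
    Submodule k (FreeDialgebra k I) :=
  Submodule.span k {p | ∃ s ∈ S, ∃ (c : DiContext I) (u : Diword I),
    c.IsNormal s ∧ IsLead s u ∧ P (c.fill u) ∧ p = c.plug s}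

/-- The span of the right normed `s`-diwords, `s ∈ S`, whose leading diword has property `P`. -/
def rightNormedSpan (S : Set (FreeDialgebra k I)) (P : Diword I → Prop) :
    Submodule k (FreeDialgebra k I) :=
  Submodule.span k {p | ∃ s ∈ S, ∃ (c : DiContext I) (u : Diword I),
    c.IsRightNormed s ∧ IsLead s u ∧ P (c.fill u) ∧ p = c.plug s}

/-- The span of the left normed `s`-diwords, `s ∈ S`, whose leading diword has property `P`. -/
def leftNormedSpan (S : Set (FreeDialgebra k I)) (P : Diword I → Prop) :
    Submodule k (FreeDialgebra k I) :=
  Submodule.span k {p | ∃ s ∈ S, ∃ (c : DiContext I) (u : Diword I),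
    c.IsLeftNormed s ∧ IsLead s u ∧ P (c.fill u) ∧ p = c.plug s}

variable {S : Set (FreeDialgebra k I)} {w : Diword I} {PR PL : Prop} {h : FreeDialgebra k I}

theorem TrivialMod.of_normalSpan (hh : h ∈ normalSpan S (· < w)) (hR : ¬ PR) (hL : ¬ PL) :
    TrivialMod S w PR PL h := by
  refine Submodule.span_mono ?_ hh
  rintro _ ⟨s, hs, c, u, hc, hu, hw, rfl⟩
  exact ⟨s, hs, c, u, hc, hu, hw, fun h => absurd h hR, fun h => absurd h hL, rfl⟩

theorem TrivialMod.of_rightNormedSpan (hh : h ∈ rightNormedSpan S (· < w)) (hL : ¬ PL) :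
    TrivialMod S w PR PL h := by
  refine Submodule.span_mono ?_ hh
  rintro _ ⟨s, hs, c, u, hc, hu, hw, rfl⟩
  exact ⟨s, hs, c, u, hc.1, hu, hw, fun _ => hc, fun h => absurd h hL, rfl⟩

theorem TrivialMod.of_leftNormedSpan (hh : h ∈ leftNormedSpan S (· < w)) (hR : ¬ PR) :
    TrivialMod S w PR PL h := by
  refine Submodule.span_mono ?_ hh
  rintro _ ⟨s, hs, c, u, hc, hu, hw, rfl⟩
  exact ⟨s, hs, c, u, hc.1, hu, hw, fun h => absurd h hR, fun _ => hc, rfl⟩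

theorem TrivialMod.mono {PR' PL' : Prop} (hh : TrivialMod S w PR' PL' h) (hR : PR → PR')
    (hL : PL → PL') : TrivialMod S w PR PL h := by
  refine Submodule.span_mono ?_ hh
  rintro _ ⟨s, hs, c, u, hc, hu, hw, hR', hL', rfl⟩
  exact ⟨s, hs, c, u, hc, hu, hw, hR' ∘ hR, hL' ∘ hL, rfl⟩

theorem TrivialMod.sub_comm {g : FreeDialgebra k I} (hh : TrivialMod S w PR PL (g - h)) :
    TrivialMod S w PR PL (h - g) := by
  rw [← neg_sub]; exact neg_mem (S := Submodule k (FreeDialgebra k I)) hh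

theorem exists_isLead (hh : h ≠ 0) : ∃ v, IsLead h v := by
  obtain ⟨v, hv, hmax⟩ := h.support.exists_max_image id (Finsupp.support_nonempty_iff.2 hh)
  exact ⟨v, hv, hmax⟩

/-- To bound lengths by the degree of `h`, it suffices to show one diword of length at least `n` in
its support; the leading diword is at least as long. -/
theorem LeftMulTrivial.of_rightNormedSpan {n : ℕ}
    (hh : h ∈ rightNormedSpan S (fun u => u.length ≤ n))
    (hn : h ≠ 0 → ∃ v ∈ h.support, n ≤ v.length) : LeftMulTrivial S h := by
  by_cases h0 : h = 0
  · rw [h0]; exact zero_mem (S := Submodule k (FreeDialgebra k I)) _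
  obtain ⟨v, hv⟩ := exists_isLead h0
  obtain ⟨v', hv', hle⟩ := hn h0
  refine Submodule.span_mono ?_ hh
  rintro _ ⟨s, hs, c, u, hc, hu, hw, rfl⟩
  exact ⟨s, hs, c, u, v, hc, hu, hv,
    hw.trans (hle.trans (Diword.length_le_of_le (hv.2 _ hv'))), rfl⟩

theorem RightMulTrivial.of_leftNormedSpan {n : ℕ}
    (hh : h ∈ leftNormedSpan S (fun u => u.length ≤ n))
    (hn : h ≠ 0 → ∃ v ∈ h.support, n ≤ v.length) : RightMulTrivial S h := by
  by_cases h0 : h = 0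
  · rw [h0]; exact zero_mem (S := Submodule k (FreeDialgebra k I)) _
  obtain ⟨v, hv⟩ := exists_isLead h0
  obtain ⟨v', hv', hle⟩ := hn h0
  refine Submodule.span_mono ?_ hh
  rintro _ ⟨s, hs, c, u, hc, hu, hw, rfl⟩
  exact ⟨s, hs, c, u, v, hc, hu, hv,
    hw.trans (hle.trans (Diword.length_le_of_le (hv.2 _ hv'))), rfl⟩

end Spans

/-! ### Multiples of the associative rules as normal s-diwords -/

variable {k L I : Type*} [Field k] [AddCommGroup L] [Module k L] [Bracket L L]
  {b : Module.Basis I k L} [LinearOrder I] {I₀ : Set I}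

/-- A rule needs an adjacent central letter to become one of (d), (e). If `a` is empty, this is the
actual center; otherwise the last letter of `a` serves as center of `s`, and the right normed `s`
stands after the center. -/
theorem exists_plug_right {u : List I} {r : WordAlgebra k I} (hr : AssocRule b I₀ u r)
    (p : List I) (t : I) (a d : List I) :
    ∃ s, GSRelation b I₀ s ∧ ∃ (c : DiContext I) (v : Diword I), c.IsNormal s ∧ IsLead s v ∧
      c.fill v = ⟨p, t, a ++ u ++ d⟩ ∧
      c.plug s = triple b (word k p) (b t) (word k a * r * word k d) ∧
      (p = [] → c.IsRightNormed s) := by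
  rcases List.eq_nil_or_concat a with rfl | ⟨a, x, rfl⟩
  · have e : (DiContext.center p d).plug (triple b 1 (b t) r) =
        triple b (word k p) (b t) (word k [] * r * word k d) := by
      rw [plug_center, mul_one, word_nil, one_mul]
    have hlead := (isLead_triple_right hr [] t [] []).1
    simp only [word_nil, one_mul, mul_one, List.nil_append, List.append_nil] at hlead
    refine ⟨_, gsRelation_right hr t, .center p d, _, trivial, hlead, by simp [DiContext.fill],
      e, ?_⟩
    rintro rfl
    refine ⟨trivial, rightNormed_triple_one _ _, ?_⟩
    rw [e, word_nil]
    exact rightNormed_triple_one _ _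
  · have e : (DiContext.after p t a d).plug (triple b 1 (b x) r) =
        triple b (word k p) (b t) (word k (a.concat x) * r * word k d) := by
      rw [plug_after b, forget_triple, letter_basis, List.concat_eq_append, word_append, one_mul]
      simp only [mul_assoc]
    have hlead := (isLead_triple_right hr [] x [] []).1
    simp only [word_nil, one_mul, mul_one, List.nil_append, List.append_nil] at hlead
    refine ⟨_, gsRelation_right hr x, .after p t a d, _, rightNormed_triple_one _ _, hlead,
      by simp [DiContext.fill, Diword.word], e, ?_⟩
    rintro rfl
    refine ⟨rightNormed_triple_one _ _, rightNormed_triple_one _ _, ?_⟩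
    rw [e, word_nil]
    exact rightNormed_triple_one _ _

/-- The mirror image: the letter following the rule, or else the actual center, becomes the center
of `s`. -/
theorem exists_plug_left {u : List I} {r : WordAlgebra k I} (hr : AssocRule b I₀ u r)
    (a d : List I) (t : I) (q : List I) :
    ∃ s, GSRelation b I₀ s ∧ ∃ (c : DiContext I) (v : Diword I), c.IsNormal s ∧ IsLead s v ∧
      c.fill v = ⟨a ++ u ++ d, t, q⟩ ∧
      c.plug s = triple b (word k a * r * word k d) (b t) (word k q) ∧
      (q = [] → c.IsLeftNormed s) := by
  rcases d with _ | ⟨x, d⟩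
  · have e : (DiContext.center a q).plug (triple b r (b t) 1) =
        triple b (word k a * r * word k []) (b t) (word k q) := by
      rw [plug_center, one_mul, word_nil, mul_one]
    have hlead := (isLead_triple_left hr [] [] t []).1
    simp only [word_nil, one_mul, mul_one, List.nil_append, List.append_nil] at hlead
    refine ⟨_, gsRelation_left hr t, .center a q, _, trivial, hlead, by simp [DiContext.fill],
      e, ?_⟩
    rintro rfl
    refine ⟨trivial, leftNormed_triple_one _ _, ?_⟩
    rw [e, word_nil]
    exact leftNormed_triple_one _ _
  · have e : (DiContext.before a d t q).plug (triple b r (b x) 1) =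
        triple b (word k a * r * word k (x :: d)) (b t) (word k q) := by
      rw [plug_before b, forget_triple, letter_basis, word_cons k x d, mul_one]
      simp only [mul_assoc]
    have hlead := (isLead_triple_left hr [] [] x []).1
    simp only [word_nil, one_mul, mul_one, List.nil_append, List.append_nil] at hlead
    refine ⟨_, gsRelation_left hr x, .before a d t q, _, leftNormed_triple_one _ _, hlead,
      by simp [DiContext.fill, Diword.word], e, ?_⟩
    rintro rfl
    refine ⟨leftNormed_triple_one _ _, leftNormed_triple_one _ _, ?_⟩
    rw [e, word_nil]
    exact leftNormed_triple_one _ _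

theorem triple_right_mem_normalSpan {P Q : List I → Prop} {Z : Set I} {R : Diword I → Prop}
    {p h : WordAlgebra k I} {x : L} (hp : p ∈ wordSpan k P)
    (hx : x ∈ Submodule.span k (b '' Z)) (hh : h ∈ ruleSpan b I₀ Q)
    (hR : ∀ l i v, P l → i ∈ Z → Q v → R ⟨l, i, v⟩) :
    triple b p x h ∈ normalSpan {f | GSRelation b I₀ f} R := by
  refine LinearMap.apply₃_mem _ hp hx hh ?_
  rintro _ ⟨l, hl, rfl⟩ _ ⟨i, hi, rfl⟩ _ ⟨a, d, u, r, hr, hQ, rfl⟩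
  obtain ⟨s, hs, c, v, hc, hv, hfill, hplug, -⟩ := exists_plug_right hr l i a d
  exact Submodule.subset_span ⟨s, hs, c, v, hc, hv, hfill ▸ hR _ _ _ hl hi hQ, hplug.symm⟩

theorem triple_left_mem_normalSpan {P Q : List I → Prop} {Z : Set I} {R : Diword I → Prop}
    {p h : WordAlgebra k I} {x : L} (hh : h ∈ ruleSpan b I₀ Q)
    (hx : x ∈ Submodule.span k (b '' Z)) (hp : p ∈ wordSpan k P)
    (hR : ∀ v i l, Q v → i ∈ Z → P l → R ⟨v, i, l⟩) :
    triple b h x p ∈ normalSpan {f | GSRelation b I₀ f} R := by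
  refine LinearMap.apply₃_mem _ hh hx hp ?_
  rintro _ ⟨a, d, u, r, hr, hQ, rfl⟩ _ ⟨i, hi, rfl⟩ _ ⟨l, hl, rfl⟩
  obtain ⟨s, hs, c, v, hc, hv, hfill, hplug, -⟩ := exists_plug_left hr a d i l
  exact Submodule.subset_span ⟨s, hs, c, v, hc, hv, hfill ▸ hR _ _ _ hQ hi hl, hplug.symm⟩

theorem triple_mem_rightNormedSpan {Q : List I → Prop} {R : Diword I → Prop}
    {h : WordAlgebra k I} (i : I) (hh : h ∈ ruleSpan b I₀ Q)
    (hR : ∀ v, Q v → R ⟨[], i, v⟩) :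
    triple b 1 (b i) h ∈ rightNormedSpan {f | GSRelation b I₀ f} R := by
  rw [← word_nil]
  refine LinearMap.apply₃_mem _ (word_mem_wordSpan (P := (· = [])) rfl)
    (mem_span_basis_singleton i) hh ?_
  rintro _ ⟨_, rfl, rfl⟩ _ ⟨i, rfl, rfl⟩ _ ⟨a, d, u, r, hr, hQ, rfl⟩
  obtain ⟨s, hs, c, v, -, hv, hfill, hplug, hc⟩ := exists_plug_right hr [] i a d
  exact Submodule.subset_span ⟨s, hs, c, v, hc rfl, hv, hfill ▸ hR _ hQ, hplug.symm⟩

theorem triple_mem_leftNormedSpan {Q : List I → Prop} {R : Diword I → Prop}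
    {h : WordAlgebra k I} (i : I) (hh : h ∈ ruleSpan b I₀ Q)
    (hR : ∀ v, Q v → R ⟨v, i, []⟩) :
    triple b h (b i) 1 ∈ leftNormedSpan {f | GSRelation b I₀ f} R := by
  rw [← word_nil]
  refine LinearMap.apply₃_mem _ hh
    (mem_span_basis_singleton i) (word_mem_wordSpan (P := (· = [])) rfl) ?_
  rintro _ ⟨a, d, u, r, hr, hQ, rfl⟩ _ ⟨i, rfl, rfl⟩ _ ⟨_, rfl, rfl⟩
  obtain ⟨s, hs, c, v, -, hv, hfill, hplug, hc⟩ := exists_plug_left hr a d i []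
  exact Submodule.subset_span ⟨s, hs, c, v, hc rfl, hv, hfill ▸ hR _ hQ, hplug.symm⟩

theorem envRel_mem_normalSpan [LeibnizAlgebra k L] {P Q : List I → Prop} {Y Z : Set I}
    {R : Diword I → Prop} {p q : WordAlgebra k I} {y x : L} (hp : p ∈ wordSpan k P)
    (hy : y ∈ Submodule.span k (b '' Y)) (hx : x ∈ Submodule.span k (b '' Z))
    (hq : q ∈ wordSpan k Q)
    (hR : ∀ l j i r, P l → j ∈ Y → i ∈ Z → Q r → R ⟨l ++ [j], i, r⟩) :
    envRel b p y x q ∈ normalSpan {f | GSRelation b I₀ f} R := by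
  refine envRel_mem b hp hy hx hq fun l j i r hl hj hi hr => ?_
  refine Submodule.subset_span ⟨_, gsRelation_envRel i j, .center l r, _, trivial,
    (isLead_envRel i j).1, ?_, ?_⟩
  · simpa [DiContext.fill] using hR l j i r hl hj hi hr
  · rw [plug_center_envRel, mul_one, one_mul]

/-! ### Normal diwords of the relations -/

variable (b I₀) in
/-- The normal `s`-diwords for the relations `s`, with their leading diwords, a condition that is
necessary for being right normed, and one for being left normed. -/
inductive NormalSDiword : Diword I → FreeDialgebra k I → Prop → Prop → Prop
  | center (a : List I) (j i : I) (d : List I) : NormalSDiword ⟨a ++ [j], i, d⟩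
      (envRel b (word k a) (b j) (b i) (word k d)) False False
  | left (a d : List I) (u : List I) (r : WordAlgebra k I) (hr : AssocRule b I₀ u r) (t : I)
      (q : List I) : NormalSDiword ⟨a ++ u ++ d, t, q⟩
        (triple b (word k a * r * word k d) (b t) (word k q)) False (q = [])
  | right (p : List I) (t : I) (a d : List I) (u : List I) (r : WordAlgebra k I)
      (hr : AssocRule b I₀ u r) : NormalSDiword ⟨p, t, a ++ u ++ d⟩
        (triple b (word k p) (b t) (word k a * r * word k d)) (p = []) False

/-- Normality limits the position of the hole: (a) is neither left nor right normed and fits only at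
the center, while (b), (c) cannot stand after it and (d), (e) cannot stand before it. The normedness
conditions are read off the leading diword. -/
theorem NormalSDiword.of_gsRelation {f : FreeDialgebra k I} {v : Diword I} {c : DiContext I}
    (hf : GSRelation b I₀ f) (hv : IsLead f v) (hc : c.IsNormal f) :
    ∃ PR PL, NormalSDiword b I₀ (c.fill v) (c.plug f) PR PL ∧
      (c.IsRightNormed f → PR) ∧ (c.IsLeftNormed f → PL) := by
  rcases gsRelation_cases hf with ⟨i, j, rfl⟩ | ⟨u, r, t, hr, rfl⟩ | ⟨u, r, t, hr, rfl⟩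
  · obtain rfl := hv.unique (isLead_envRel i j).1
    have hL := not_leftNormed_envRel b i j
    have hR := hv.not_rightNormed (by simp)
    cases c with
    | center a d =>
      refine ⟨False, False, ?_, fun h => hR h.2.1, fun h => hL h.2.1⟩
      rw [plug_center_envRel, mul_one, one_mul]
      exact .center a j i d
    | before => exact (hL hc).elim
    | after => exact (hR hc).elim
  · have hlead := (isLead_triple_left hr [] [] t []).1
    simp only [word_nil, one_mul, mul_one, List.nil_append, List.append_nil] at hlead
    obtain rfl := hv.unique hlead
    have hR := hv.not_rightNormed hr.ne_nil
    cases c with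
    | center a d =>
      refine ⟨False, d = [], ?_, fun h => hR h.2.1, fun h => ?_⟩
      · convert NormalSDiword.left a [] u r hr t d using 1
        · simp [DiContext.fill]
        · rw [plug_center, one_mul, word_nil, mul_one]
      · have h' := h.2.2
        rw [plug_center, one_mul] at h'
        have := (isLead_triple_left hr a [] t d).1
        rw [word_nil, mul_one] at this
        by_contra hd
        exact this.not_leftNormed hd h'
    | before a d x q =>
      refine ⟨False, q = [], ?_, fun h => hR h.2.1, fun h => ?_⟩
      · convert NormalSDiword.left a (t :: d) u r hr x q using 1
        · simp [DiContext.fill, Diword.word]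
        · rw [plug_before b, forget_triple, word_cons k t d, letter_basis, mul_one]
          simp only [mul_assoc]
      · have h' := h.2.2
        have := (isLead_triple_left hr a (t :: d) x q).1
        rw [plug_before b, forget_triple, letter_basis, mul_one] at h'
        rw [word_cons k t d, ← mul_assoc, mul_assoc (word k a)] at this
        by_contra hd
        exact this.not_leftNormed hd h'
    | after => exact (hR hc).elim
  · have hlead := (isLead_triple_right hr [] t [] []).1
    simp only [word_nil, one_mul, mul_one, List.nil_append, List.append_nil] at hlead
    obtain rfl := hv.unique hlead
    have hL := hv.not_leftNormed hr.ne_nil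
    cases c with
    | center a d =>
      refine ⟨a = [], False, ?_, fun h => ?_, fun h => hL h.2.1⟩
      · convert NormalSDiword.right a t [] d u r hr using 1
        · simp [DiContext.fill]
        · rw [plug_center, mul_one, word_nil, one_mul]
      · have h' := h.2.2
        rw [plug_center, mul_one] at h'
        have := (isLead_triple_right hr a t [] d).1
        rw [word_nil, one_mul] at this
        by_contra hd
        exact this.not_rightNormed hd h'
    | before => exact (hL hc).elim
    | after p x a d =>
      refine ⟨p = [], False, ?_, fun h => ?_, fun h => hL h.2.1⟩
      · convert NormalSDiword.right p x (a ++ [t]) d u r hr using 1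
        · simp [DiContext.fill, Diword.word]
        · rw [plug_after b, forget_triple, word_append, letter_basis, one_mul]
          simp only [mul_assoc]
      · have h' := h.2.2
        have := (isLead_triple_right hr p x (a ++ [t]) d).1
        rw [plug_after b, forget_triple, letter_basis, one_mul] at h'
        rw [word_append, mul_assoc (word k a)] at this
        by_contra hd
        exact this.not_rightNormed hd h'

end FreeDialgebra

end

noncomputable section

/-! ### Resolution of normal s-diwords with the same leading diword -/

namespace FreeDialgebra

variable {k L I : Type*} [Field k] [AddCommGroup L] [Module k L] [Bracket L L]
  {b : Module.Basis I k L} [LinearOrder I] {I₀ : Set I}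

/-- Rules on opposite sides of the center do not interact; the identity is the one for disjoint
subwords, with the center in between. -/
theorem left_sub_right_mem {a d u a' d' u' : List I} {r r' : WordAlgebra k I}
    (hr : AssocRule b I₀ u r) (hr' : AssocRule b I₀ u' r') (t : I) :
    triple b (word k a * r * word k d) (b t) (word k (a' ++ u' ++ d')) -
      triple b (word k (a ++ u ++ d)) (b t) (word k a' * r' * word k d') ∈
      normalSpan {f | GSRelation b I₀ f} (· < ⟨a ++ u ++ d, t, a' ++ u' ++ d'⟩) := by
  have e : triple b (word k a * r * word k d) (b t) (word k (a' ++ u' ++ d')) -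
      triple b (word k (a ++ u ++ d)) (b t) (word k a' * r' * word k d') =
      triple b (word k a * r * word k d - word k (a ++ u ++ d)) (b t) (word k a' * r' * word k d')
      - triple b (word k a * r * word k d) (b t)
        (word k a' * r' * word k d' - word k (a' ++ u' ++ d')) := by
    rw [triple_sub_left, triple_sub_right]; abel
  rw [e]
  refine sub_mem
    (triple_right_mem_normalSpan (hr.mul_sub_word_mem a d) (mem_span_basis_singleton t)
      (hr'.mul_mem (word_mem_eqSpan a') (word_mem_eqSpan d') (R := (· = a' ++ u' ++ d'))
        (by rintro _ _ rfl rfl; rfl)) ?_)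
    (triple_left_mem_normalSpan (hr.mul_mem (word_mem_eqSpan a) (word_mem_eqSpan d)
      (R := (· = a ++ u ++ d)) (by rintro _ _ rfl rfl; rfl)) (mem_span_basis_singleton t)
      (hr'.mul_sub_word_mem a' d') ?_)
  · rintro v _ _ hv rfl rfl; exact Diword.lt_of_shortlexLT_left hv _ _
  · rintro _ _ v rfl rfl hv; exact Diword.lt_of_shortlexLT_right hv _ _

variable [LeibnizAlgebra k L]

/-- A letter crossing the center only lengthens the word before a rule on the right. What remains is
smaller by the right word, by the length of the left part, or by total length. -/
theorem center_sub_right_mem {a a' d' u' : List I} {r' : WordAlgebra k I}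
    (hr' : AssocRule b I₀ u' r') (j i : I) :
    envRel b (word k a) (b j) (b i) (word k (a' ++ u' ++ d')) -
      triple b (word k (a ++ [j])) (b i) (word k a' * r' * word k d') ∈
      normalSpan {f | GSRelation b I₀ f} (· < ⟨a ++ [j], i, a' ++ u' ++ d'⟩) := by
  have e : envRel b (word k a) (b j) (b i) (word k (a' ++ u' ++ d')) -
      triple b (word k (a ++ [j])) (b i) (word k a' * r' * word k d') =
      - envRel b (word k a) (b j) (b i) (word k a' * r' * word k d' - word k (a' ++ u' ++ d'))
      - triple b (word k a) (b i) (word k [j] * (word k a' * r' * word k d'))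
      + triple b (word k a) ⁅b i, b j⁆ (word k a' * r' * word k d') := by
    simp only [envRel, letter_basis, triple_sub_right, mul_sub, word_append k a [j]]; abel
  have hrule : word k a' * r' * word k d' ∈ ruleSpan b I₀ (· = a' ++ u' ++ d') :=
    hr'.mul_mem (word_mem_eqSpan a') (word_mem_eqSpan d') (by rintro _ _ rfl rfl; rfl)
  rw [e]
  refine add_mem (sub_mem (neg_mem (envRel_mem_normalSpan (word_mem_eqSpan a)
      (mem_span_basis_singleton j) (mem_span_basis_singleton i) (hr'.mul_sub_word_mem a' d') ?_))
    (triple_right_mem_normalSpan (word_mem_eqSpan a) (mem_span_basis_singleton i)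
      (mul_mem_ruleSpan (R := (· = j :: (a' ++ u' ++ d'))) ?_ (word_mem_eqSpan [j]) hrule) ?_))
    (triple_right_mem_normalSpan (word_mem_eqSpan a) (mem_span_basis_univ _) hrule ?_)
  · rintro _ _ _ v rfl rfl rfl hv; exact Diword.lt_of_shortlexLT_right hv _ _
  · rintro _ _ rfl rfl; rfl
  · rintro _ _ _ rfl rfl rfl
    exact Diword.lt_of_left_length_lt (by simp [Diword.length_mk]; omega) (by simp)
  · rintro _ _ _ rfl - rfl
    exact Diword.lt_of_length_lt (by simp [Diword.length_mk])

/-- The crossing letter `j` lies outside the leading word of the rule, so the two reductions are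
independent. -/
theorem left_sub_center_mem_of_cons {a d u : List I} {r : WordAlgebra k I}
    (hr : AssocRule b I₀ u r) (j i : I) (q : List I) :
    triple b (word k a * r * word k (d ++ [j])) (b i) (word k q) -
      envRel b (word k (a ++ u ++ d)) (b j) (b i) (word k q) ∈
      normalSpan {f | GSRelation b I₀ f} (· < ⟨a ++ u ++ d ++ [j], i, q⟩) := by
  have e : triple b (word k a * r * word k (d ++ [j])) (b i) (word k q) -
      envRel b (word k (a ++ u ++ d)) (b j) (b i) (word k q) =
      envRel b (word k a * r * word k d - word k (a ++ u ++ d)) (b j) (b i) (word k q)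
      + triple b (word k a * r * word k d) (b i) (word k (j :: q))
      - triple b (word k a * r * word k d) ⁅b i, b j⁆ (word k q) := by
    simp only [envRel, letter_basis, triple_sub_left, sub_mul, word_append k d [j],
      word_cons k j q, mul_assoc]
    abel
  have hrule : word k a * r * word k d ∈ ruleSpan b I₀ (· = a ++ u ++ d) :=
    hr.mul_mem (word_mem_eqSpan a) (word_mem_eqSpan d) (by rintro _ _ rfl rfl; rfl)
  rw [e]
  refine sub_mem (add_mem (envRel_mem_normalSpan (hr.mul_sub_word_mem a d)
      (mem_span_basis_singleton j) (mem_span_basis_singleton i) (word_mem_eqSpan q) ?_)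
    (triple_left_mem_normalSpan hrule (mem_span_basis_singleton i) (word_mem_eqSpan _) ?_))
    (triple_left_mem_normalSpan hrule (mem_span_basis_univ _) (word_mem_eqSpan q) ?_)
  · rintro v _ _ _ hv rfl rfl rfl
    exact Diword.lt_of_shortlexLT_left (by simpa using hv.append_append [] _) _ _
  · rintro _ _ _ rfl rfl rfl
    exact Diword.lt_of_left_length_lt (by simp [Diword.length_mk]; omega) (by simp)
  · rintro _ _ _ rfl - rfl
    exact Diword.lt_of_length_lt (by simp [Diword.length_mk])

variable (hI₀ : Submodule.span k (b '' I₀) = leibnizKernel k L)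

include hI₀

/-- With `i ∈ I₀` the bracket in (a) is zero, so crossing the center only moves the killed letter to
the right, where (e) applies. -/
theorem left_sub_center_mem_of_kill {i : I} (hi : i ∈ I₀) (a : List I) (t : I) (q : List I) :
    triple b (word k a * word k [i]) (b t) (word k q) -
      envRel b (word k a) (b i) (b t) (word k q) ∈
      normalSpan {f | GSRelation b I₀ f} (· < ⟨a ++ [i], t, q⟩) := by
  have e : triple b (word k a * word k [i]) (b t) (word k q) -
      envRel b (word k a) (b i) (b t) (word k q) =
      triple b (word k a) (b t) (word k [i] * word k q) := by
    simp only [envRel, letter_basis, bracket_leibnizKernel k _ (basis_mem_leibnizKernel hI₀ hi),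
      map_zero, LinearMap.zero_apply]
    abel
  rw [e]
  refine triple_right_mem_normalSpan (word_mem_eqSpan a) (mem_span_basis_singleton t)
    (ruleSpan_mul_mem (R := (· = i :: q)) ?_ ((AssocRule.kill i hi).mem_ruleSpan (P := (· = [i]))
      rfl) (word_mem_eqSpan q)) ?_
  · rintro _ _ rfl rfl; rfl
  · rintro _ _ _ rfl rfl rfl
    exact Diword.lt_of_left_length_lt (by simp [Diword.length_mk]; omega) (by simp)

omit hI₀ in
theorem left_sub_center_mem_of_comm {i j : I} (hij : i < j) (a : List I) (t : I) (q : List I) :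
    triple b (word k a * commRel b (b i) (b j)) (b t) (word k q) -
      envRel b (word k (a ++ [j])) (b i) (b t) (word k q) ∈
      normalSpan {f | GSRelation b I₀ f} (· < ⟨a ++ [j, i], t, q⟩) := by
  -- The leading term has already cancelled. Each remaining term is smaller because its left word is
  -- swapped, a bracket shortens it, or a letter has moved to the right of the center.
  have e := triple_commRel_sub_envRel b (word k a) (word k q) (b i) (b j) (b t)
  simp only [letter_basis, ← word_append] at e
  rw [e]
  have env : ∀ {p q' : List I} {Y Z : Set I} {y x : L}, y ∈ Submodule.span k (b '' Y) →
      x ∈ Submodule.span k (b '' Z) →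
      (∀ j' ∈ Y, ∀ i' ∈ Z, (⟨p ++ [j'], i', q'⟩ : Diword I) < ⟨a ++ [j, i], t, q⟩) →
      envRel b (word k p) y x (word k q') ∈
        normalSpan {f | GSRelation b I₀ f} (· < ⟨a ++ [j, i], t, q⟩) := by
    intro p q' Y Z y x hy hx h
    refine envRel_mem_normalSpan (word_mem_eqSpan p) hy hx (word_mem_eqSpan q') ?_
    rintro _ j' i' _ rfl hj hi rfl
    exact h j' hj i' hi
  have len : ∀ j' i' : I, (⟨a ++ [j'], i', q⟩ : Diword I) < ⟨a ++ [j, i], t, q⟩ := fun j' i' =>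
    Diword.lt_of_length_lt (by simp [Diword.length_mk])
  have left : ∀ j' i' s : I, (⟨a ++ [j'], i', [s] ++ q⟩ : Diword I) < ⟨a ++ [j, i], t, q⟩ :=
    fun j' i' s => Diword.lt_of_left_length_lt (by simp [Diword.length_mk]; omega) (by simp)
  refine add_mem (add_mem (sub_mem (sub_mem (add_mem (add_mem (neg_mem ?_) ?_) ?_) ?_) ?_) ?_) ?_
  · refine env (mem_span_basis_singleton j) (mem_span_basis_singleton t) ?_
    rintro _ rfl _ rfl
    exact Diword.lt_of_shortlexLT_left
      (by simpa using (ShortlexLT.swap hij).append_append a []) _ _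
  · exact env (mem_span_basis_univ _) (mem_span_basis_univ _) fun j' _ i' _ => len j' i'
  · exact env (mem_span_basis_univ _) (mem_span_basis_univ _) fun j' _ i' _ => left j' i' _
  · exact env (mem_span_basis_univ _) (mem_span_basis_univ _) fun j' _ i' _ => len j' i'
  · exact env (mem_span_basis_univ _) (mem_span_basis_univ _) fun j' _ i' _ => left j' i' _
  · exact env (mem_span_basis_univ _) (mem_span_basis_univ _) fun j' _ i' _ => len j' i'
  · refine triple_right_mem_normalSpan (word_mem_eqSpan a) (mem_span_basis_singleton t)
      (ruleSpan_mul_mem (R := (· = [j, i] ++ q)) ?_ ((AssocRule.comm i j hij).mem_ruleSpan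
      (P := (· = [j, i])) rfl) (word_mem_eqSpan q)) ?_
    · rintro _ _ rfl rfl; rfl
    · rintro _ _ _ rfl rfl rfl
      exact Diword.lt_of_left_length_lt (by simp [Diword.length_mk]; omega) (by simp)

/-- There is a true overlap only if the rule ends immediately before the center, that is, if `d` is
empty. -/
theorem left_sub_center_mem {a d u a' : List I} {r : WordAlgebra k I}
    (hr : AssocRule b I₀ u r) {j : I} (i : I) (q : List I) (e : a ++ u ++ d = a' ++ [j]) :
    triple b (word k a * r * word k d) (b i) (word k q) -
      envRel b (word k a') (b j) (b i) (word k q) ∈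
      normalSpan {f | GSRelation b I₀ f} (· < ⟨a' ++ [j], i, q⟩) := by
  rcases List.eq_nil_or_concat d with rfl | ⟨d, x, rfl⟩
  · rw [word_nil, mul_one]
    cases hr with
    | kill i₀ hi =>
      obtain ⟨rfl, rfl⟩ : a = a' ∧ i₀ = j := by simpa using e
      exact left_sub_center_mem_of_kill hI₀ hi a i q
    | comm x y hxy =>
      have e' : (a ++ [y]) ++ [x] = a' ++ [j] := by simpa using e
      obtain ⟨rfl, e''⟩ := List.append_inj' e' rfl
      obtain rfl : x = j := by simpa using e''
      have := left_sub_center_mem_of_comm (b := b) (I₀ := I₀) hxy a i q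
      simpa using this
  · rw [List.concat_eq_append, ← List.append_assoc] at e
    obtain ⟨rfl, e''⟩ := List.append_inj' e rfl
    obtain rfl : x = j := by simpa using e''
    rw [List.concat_eq_append]
    exact left_sub_center_mem_of_cons hr x i q

/-- Two normal diwords of the relations with the same leading diword agree modulo smaller ones. -/
theorem NormalSDiword.resolve {w : Diword I} {f g : FreeDialgebra k I} {PR PL PR' PL' : Prop}
    (hf : NormalSDiword b I₀ w f PR PL) (hg : NormalSDiword b I₀ w g PR' PL') :
    TrivialMod {f | GSRelation b I₀ f} w (PR ∧ PR') (PL ∧ PL') (f - g) := by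
  generalize hw : w = w' at hg
  cases hf with
  | center a j i d =>
    cases hg with
    | center a' j' i' d' =>
      obtain ⟨e, rfl, rfl⟩ := Diword.mk.inj hw
      obtain ⟨rfl, e''⟩ := List.append_inj' e rfl
      obtain rfl : j = j' := by simpa using e''
      rw [sub_self]
      exact zero_mem (S := Submodule k (FreeDialgebra k I)) _
    | left a' d' u r hr t q =>
      obtain ⟨e, rfl, rfl⟩ := Diword.mk.inj hw
      have hm := left_sub_center_mem hI₀ hr i d e.symm
      rw [e] at hm
      exact TrivialMod.sub_comm (TrivialMod.of_normalSpan hm (by simp) (by simp))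
    | right p t a' d' u r hr =>
      obtain ⟨rfl, rfl, rfl⟩ := Diword.mk.inj hw
      have hm := center_sub_right_mem (a := a) (a' := a') (d' := d') hr j i
      exact .of_normalSpan hm (by simp) (by simp)
  | left a d u r hr t q =>
    cases hg with
    | center a' j' i' d' =>
      obtain ⟨e, rfl, rfl⟩ := Diword.mk.inj hw
      have hm := left_sub_center_mem hI₀ hr t q e
      exact .of_normalSpan hm (by simp) (by simp)
    | left a' d' u' r' hr' t' q' =>
      obtain ⟨e, rfl, rfl⟩ := Diword.mk.inj hw
      rw [← triple_sub_left]
      have hm := hr.confluent hI₀ hr' e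
      rw [e] at hm
      -- For empty `q` both diwords may be left normed, and then the difference has to be expressed
      -- by left normed s-diwords.
      by_cases hq : q = []
      · subst hq
        rw [word_nil]
        refine .of_leftNormedSpan (triple_mem_leftNormedSpan t hm fun v hv => ?_) (by simp)
        exact Diword.lt_of_shortlexLT_left hv _ _
      · refine .of_normalSpan (triple_left_mem_normalSpan hm (mem_span_basis_singleton t)
          (word_mem_eqSpan q) ?_) (by simp) (by simp [hq])
        rintro v _ _ hv rfl rfl
        exact Diword.lt_of_shortlexLT_left hv _ _
    | right p t' a' d' u' r' hr' =>
      obtain ⟨rfl, rfl, rfl⟩ := Diword.mk.inj hw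
      have hm := left_sub_right_mem (a := a) (d := d) (a' := a') (d' := d') hr hr' t
      exact .of_normalSpan hm (by simp) (by simp)
  | right p t a d u r hr =>
    cases hg with
    | center a' j i d' =>
      obtain ⟨rfl, rfl, rfl⟩ := Diword.mk.inj hw
      have hm := center_sub_right_mem (a := a') (a' := a) (d' := d) hr j t
      exact TrivialMod.sub_comm (TrivialMod.of_normalSpan hm (by simp) (by simp))
    | left a' d' u' r' hr' t' q =>
      obtain ⟨rfl, rfl, rfl⟩ := Diword.mk.inj hw
      have hm := left_sub_right_mem (a := a') (d := d') (a' := a) (d' := d) hr' hr t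
      exact TrivialMod.sub_comm (TrivialMod.of_normalSpan hm (by simp) (by simp))
    | right p' t' a' d' u' r' hr' =>
      obtain ⟨rfl, rfl, e⟩ := Diword.mk.inj hw
      rw [← triple_sub_right]
      have hm := hr.confluent hI₀ hr' e
      rw [e] at hm
      by_cases hp : p = []
      · subst hp
        rw [word_nil]
        refine .of_rightNormedSpan (triple_mem_rightNormedSpan t hm fun v hv => ?_) (by simp)
        exact Diword.lt_of_shortlexLT_right hv _ _
      · refine .of_normalSpan (triple_right_mem_normalSpan (word_mem_eqSpan p)
          (mem_span_basis_singleton t) hm ?_) (by simp [hp]) (by simp)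
        rintro _ _ v rfl rfl hv
        exact Diword.lt_of_shortlexLT_right hv _ _

/-- This is `x ⊣` applied to (a). The degree bound forces a case split: for `i = j` the quadratic
part cancels and the degree falls to 2, where {x_i, x_i} in L₀ can be killed without longer words.
-/
theorem leftMulTrivial_commRel (i j x : I) :
    LeftMulTrivial {f | GSRelation b I₀ f} (triple b 1 (b x) (commRel b (b i) (b j))) := by
  by_cases hij : i = j
  · subst hij
    rw [commRel, sub_self, zero_add]
    refine .of_rightNormedSpan (n := 2) (triple_mem_rightNormedSpan x (letter_mem_ruleSpan hI₀
      (bracket_self_mem_leibnizKernel k (b i))) ?_) fun h0 => ?_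
    · intro v hv; simp [Diword.length_mk]; omega
    · obtain ⟨v, hv⟩ := Finsupp.support_nonempty_iff.2 h0
      exact ⟨v, hv, (length_of_mem_support_triple one_mem_wordSpan
        (letter_mem_wordSpan b _) hv).ge⟩
  · refine .of_rightNormedSpan (n := 3) (triple_mem_rightNormedSpan x
      (commRel_mem_ruleSpan hI₀ _ _) ?_) fun _ => ?_
    · intro v hv; simp [Diword.length_mk]; omega
    -- For `i ≠ j` this diword has coefficient 1, whichever index is larger, which certifies degree
    -- 3.
    · refine ⟨⟨[], x, [j, i]⟩, Finsupp.mem_support_iff.2 ?_, by simp [Diword.length_mk]⟩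
      have e : triple b 1 (b x) (commRel b (b i) (b j)) = Finsupp.single ⟨[], x, [j, i]⟩ 1 -
          Finsupp.single ⟨[], x, [i, j]⟩ 1 + triple b 1 (b x) (letter b ⁅b i, b j⁆) := by
        simp only [commRel, triple_add_right, triple_sub_right, letter_basis, ← word_append,
          ← word_nil, triple_word, List.singleton_append]
      have h0 : triple b 1 (b x) (letter b ⁅b i, b j⁆) ⟨[], x, [j, i]⟩ = 0 := by
        by_contra h
        have := length_of_mem_support_triple one_mem_wordSpan (letter_mem_wordSpan b _)
          (Finsupp.mem_support_iff.2 h)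
        simp [Diword.length_mk] at this
      rw [e, Finsupp.add_apply, h0, Finsupp.sub_apply, Finsupp.single_eq_same,
        Finsupp.single_eq_of_ne (by simp [Ne.symm hij])]
      simp

theorem rightMulTrivial_commRel (i j x : I) :
    RightMulTrivial {f | GSRelation b I₀ f} (triple b (commRel b (b i) (b j)) (b x) 1) := by
  by_cases hij : i = j
  · subst hij
    rw [commRel, sub_self, zero_add]
    refine .of_leftNormedSpan (n := 2) (triple_mem_leftNormedSpan x (letter_mem_ruleSpan hI₀
      (bracket_self_mem_leibnizKernel k (b i))) ?_) fun h0 => ?_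
    · intro v hv; simp [Diword.length_mk]; omega
    · obtain ⟨v, hv⟩ := Finsupp.support_nonempty_iff.2 h0
      exact ⟨v, hv, (length_of_mem_support_triple (letter_mem_wordSpan b _)
        one_mem_wordSpan hv).ge⟩
  · refine .of_leftNormedSpan (n := 3) (triple_mem_leftNormedSpan x
      (commRel_mem_ruleSpan hI₀ _ _) ?_) fun _ => ?_
    · intro v hv; simp [Diword.length_mk]; omega
    · refine ⟨⟨[j, i], x, []⟩, Finsupp.mem_support_iff.2 ?_, by simp [Diword.length_mk]⟩
      have e : triple b (commRel b (b i) (b j)) (b x) 1 = Finsupp.single ⟨[j, i], x, []⟩ 1 -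
          Finsupp.single ⟨[i, j], x, []⟩ 1 + triple b (letter b ⁅b i, b j⁆) (b x) 1 := by
        simp only [commRel, triple_add_left, triple_sub_left, letter_basis, ← word_append,
          ← word_nil, triple_word, List.singleton_append]
      have h0 : triple b (letter b ⁅b i, b j⁆) (b x) 1 ⟨[j, i], x, []⟩ = 0 := by
        by_contra h
        have := length_of_mem_support_triple (letter_mem_wordSpan b _) one_mem_wordSpan
          (Finsupp.mem_support_iff.2 h)
        simp [Diword.length_mk] at this
      rw [e, Finsupp.add_apply, h0, Finsupp.sub_apply, Finsupp.single_eq_same,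
        Finsupp.single_eq_of_ne (by simp [Ne.symm hij])]
      simp

theorem isGroebnerShirshovBasis_gsRelation :
    IsGroebnerShirshovBasis {f | GSRelation b I₀ f} where
  monic f hf := by
    rcases gsRelation_cases hf with ⟨i, j, rfl⟩ | ⟨u, r, t, hr, rfl⟩ | ⟨u, r, t, hr, rfl⟩
    · exact ⟨_, isLead_envRel i j⟩
    · have := isLead_triple_left hr [] [] t []
      simp only [word_nil, one_mul, mul_one] at this
      exact ⟨_, this⟩
    · have := isLead_triple_right hr [] t [] []
      simp only [word_nil, one_mul, mul_one] at this
      exact ⟨_, this⟩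
  left_mul f hf hR x := by
    rw [of_dashv b]
    rcases gsRelation_cases hf with ⟨i, j, rfl⟩ | ⟨u, r, t, hr, rfl⟩ | ⟨u, r, t, hr, rfl⟩
    · have e : forget (envRel b 1 (b j) (b i) 1) = commRel b (b i) (b j) := by
        simp [envRel, commRel, forget_triple]
      rw [e]
      exact leftMulTrivial_commRel hI₀ i j x
    -- For (b), (c) the center `t` becomes an ordinary letter following the rule, now on the right
    -- of `x`.
    · rw [forget_triple, letter_basis, mul_one]
      have hlead := isLead_triple_right hr [] x [] [t]
      simp only [word_nil, one_mul] at hlead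
      refine .of_rightNormedSpan (n := u.length + 2) (triple_mem_rightNormedSpan x
        (ruleSpan_mul_mem (R := (· = u ++ [t])) ?_ (hr.mem_ruleSpan (P := (· = u)) rfl)
          (word_mem_eqSpan [t])) ?_) fun _ => ⟨_, hlead.1.1, by simp [Diword.length_mk]⟩
      · rintro _ _ rfl rfl; rfl
      · rintro _ rfl; simp [Diword.length_mk]
    · exact (hR (rightNormed_triple_one _ _)).elim
  right_mul f hf hL x := by
    rw [vdash_of b]
    rcases gsRelation_cases hf with ⟨i, j, rfl⟩ | ⟨u, r, t, hr, rfl⟩ | ⟨u, r, t, hr, rfl⟩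
    · have e : forget (envRel b 1 (b j) (b i) 1) = commRel b (b i) (b j) := by
        simp [envRel, commRel, forget_triple]
      rw [e]
      exact rightMulTrivial_commRel hI₀ i j x
    · exact (hL (leftNormed_triple_one _ _)).elim
    · rw [forget_triple, letter_basis, one_mul]
      have hlead := isLead_triple_left hr [t] [] x []
      simp only [word_nil, mul_one] at hlead
      refine .of_leftNormedSpan (n := u.length + 2) (triple_mem_leftNormedSpan x
        (mul_mem_ruleSpan (R := (· = [t] ++ u)) ?_ (word_mem_eqSpan [t])
          (hr.mem_ruleSpan (P := (· = u)) rfl)) ?_) fun _ => ⟨_, hlead.1.1,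
            by simp [Diword.length_mk]⟩
      · rintro _ _ rfl rfl; rfl
      · rintro _ rfl; simp [Diword.length_mk]
  inclusion f hf g hg c u w hw hu hc e := by
    -- An inclusion compares `f` in the empty context with a normal g-diword, so it is settled by
    -- `NormalSDiword.resolve` just as an intersection is.
    obtain ⟨PR, PL, hF, hFR, hFL⟩ := NormalSDiword.of_gsRelation hf (c := .center [] []) hw trivial
    obtain ⟨PR', PL', hG, hGR, hGL⟩ := NormalSDiword.of_gsRelation hg hu hc
    have hfill : (DiContext.center [] []).fill w = w := by simp [DiContext.fill]
    have hplug : (DiContext.center [] []).plug f = f := by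
      have : (DiContext.center [] []).fill = (id : Diword I → Diword I) := by
        funext v; simp [DiContext.fill]
      rw [DiContext.plug, this, Finsupp.mapDomain_id]
    rw [hfill, hplug] at hF
    rw [← e] at hG
    exact (hF.resolve hI₀ hG).mono
      (fun h => ⟨hFR ⟨trivial, h.1, hplug.symm ▸ h.1⟩, hGR h.2⟩)
      (fun h => ⟨hFL ⟨trivial, h.1, hplug.symm ▸ h.1⟩, hGL h.2⟩)
  intersection f hf g hg c d t u w _ _ ht hu hc hd e e' _ := by
    obtain ⟨PR, PL, hF, hFR, hFL⟩ := NormalSDiword.of_gsRelation hf ht hc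
    obtain ⟨PR', PL', hG, hGR, hGL⟩ := NormalSDiword.of_gsRelation hg hu hd
    rw [← e] at hF
    rw [← e'] at hG
    exact (hF.resolve hI₀ hG).mono (fun h => ⟨hFR h.1, hGR h.2⟩) (fun h => ⟨hFL h.1, hGL h.2⟩)

end FreeDialgebra

end

noncomputable section

/-! ### Quotients and homomorphisms of dialgebras -/

section Quotient

variable {k D : Type*} [Field k] [AddCommGroup D] [Module k D] [DialgebraMul D]

theorem subset_dialgebraIdeal (S : Set D) : S ⊆ dialgebraIdeal k S := fun _ hs =>
  Submodule.mem_sInf.2 fun _ hJ => hJ.2 hs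

theorem dialgebraIdeal_le {S : Set D} {J : Submodule k D} (hJ : IsDialgebraIdeal J)
    (hS : S ⊆ J) : dialgebraIdeal k S ≤ J := sInf_le ⟨hJ, hS⟩

variable [Dialgebra k D]

theorem mk_dashv_mk (S : Set D) (x y : D) :
    (dialgebraIdeal k S).mkQ x ⊣ᵈ (dialgebraIdeal k S).mkQ y =
      (dialgebraIdeal k S).mkQ (x ⊣ᵈ y) := rfl

theorem mk_vdash_mk (S : Set D) (x y : D) :
    (dialgebraIdeal k S).mkQ x ⊢ᵈ (dialgebraIdeal k S).mkQ y =
      (dialgebraIdeal k S).mkQ (x ⊢ᵈ y) := rfl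

instance dialgebra_quotient (S : Set D) : Dialgebra k (D ⧸ dialgebraIdeal k S) := by
  have hs : ∀ x : D ⧸ dialgebraIdeal k S, ∃ y, (dialgebraIdeal k S).mkQ y = x :=
    Submodule.mkQ_surjective _
  constructor
  · intro x y z
    obtain ⟨x, rfl⟩ := hs x; obtain ⟨y, rfl⟩ := hs y; obtain ⟨z, rfl⟩ := hs z
    simp only [← map_add, mk_dashv_mk, Dialgebra.add_dashv k]
  · intro x y z
    obtain ⟨x, rfl⟩ := hs x; obtain ⟨y, rfl⟩ := hs y; obtain ⟨z, rfl⟩ := hs z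
    simp only [← map_add, mk_dashv_mk, Dialgebra.dashv_add k]
  · intro r x y
    obtain ⟨x, rfl⟩ := hs x; obtain ⟨y, rfl⟩ := hs y
    simp only [← map_smul, mk_dashv_mk, Dialgebra.smul_dashv]
  · intro r x y
    obtain ⟨x, rfl⟩ := hs x; obtain ⟨y, rfl⟩ := hs y
    simp only [← map_smul, mk_dashv_mk, Dialgebra.dashv_smul]
  · intro x y z
    obtain ⟨x, rfl⟩ := hs x; obtain ⟨y, rfl⟩ := hs y; obtain ⟨z, rfl⟩ := hs z
    simp only [← map_add, mk_vdash_mk, Dialgebra.add_vdash k]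
  · intro x y z
    obtain ⟨x, rfl⟩ := hs x; obtain ⟨y, rfl⟩ := hs y; obtain ⟨z, rfl⟩ := hs z
    simp only [← map_add, mk_vdash_mk, Dialgebra.vdash_add k]
  · intro r x y
    obtain ⟨x, rfl⟩ := hs x; obtain ⟨y, rfl⟩ := hs y
    simp only [← map_smul, mk_vdash_mk, Dialgebra.smul_vdash]
  · intro r x y
    obtain ⟨x, rfl⟩ := hs x; obtain ⟨y, rfl⟩ := hs y
    simp only [← map_smul, mk_vdash_mk, Dialgebra.vdash_smul]
  all_goals
    intro x y z
    obtain ⟨x, rfl⟩ := hs x; obtain ⟨y, rfl⟩ := hs y; obtain ⟨z, rfl⟩ := hs z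
  · simp only [mk_dashv_mk, Dialgebra.dashv_assoc k]
  · simp only [mk_vdash_mk, Dialgebra.vdash_assoc k]
  · simp only [mk_dashv_mk, mk_vdash_mk, Dialgebra.dashv_vdash k]
  · simp only [mk_dashv_mk, mk_vdash_mk, Dialgebra.vdash_of_dashv k]
  · simp only [mk_dashv_mk, mk_vdash_mk, Dialgebra.vdash_dashv k]

end Quotient

theorem IsDialgebraHom.isDialgebraIdeal_ker {k D E : Type*} [Field k] [AddCommGroup D]
    [Module k D] [DialgebraMul D] [AddCommGroup E] [Module k E] [DialgebraMul E] [Dialgebra k E]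
    {F : D →ₗ[k] E} (hF : IsDialgebraHom F) : IsDialgebraIdeal (LinearMap.ker F) := by
  have h₁ : ∀ x : E, (0 : E) ⊣ᵈ x = 0 := fun x => by
    simpa using Dialgebra.smul_dashv (0 : k) 0 x
  have h₂ : ∀ x : E, x ⊣ᵈ (0 : E) = 0 := fun x => by
    simpa using Dialgebra.dashv_smul (0 : k) x 0
  have h₃ : ∀ x : E, (0 : E) ⊢ᵈ x = 0 := fun x => by
    simpa using Dialgebra.smul_vdash (0 : k) 0 x
  have h₄ : ∀ x : E, x ⊢ᵈ (0 : E) = 0 := fun x => by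
    simpa using Dialgebra.vdash_smul (0 : k) x 0
  intro a ha d
  rw [LinearMap.mem_ker] at ha
  simp only [LinearMap.mem_ker, (hF _ _).1, (hF _ _).2, ha, h₁, h₂, h₃, h₄, and_self]

namespace FreeDialgebra

/-! ### Evaluation of the free dialgebra -/

section Eval

variable {k I E : Type*} [Field k] [AddCommGroup E] [Module k E] [DialgebraMul E]

/-- The action of a word on the right. -/
def rightFold (g : I → E) (z : E) (w : List I) : E := w.foldl (fun z x => z ⊣ᵈ g x) z

/-- The action of a word on the left. -/
def leftFold (g : I → E) (w : List I) (z : E) : E := w.foldr (fun x z => g x ⊢ᵈ z) z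

/-- The value of a diword in a dialgebra. -/
def evalDiword (g : I → E) (u : Diword I) : E :=
  leftFold g u.left (rightFold g (g u.center) u.right)

variable (k) in
/-- The homomorphism from the free dialgebra with prescribed values on the generators. -/
def eval (g : I → E) : FreeDialgebra k I →ₗ[k] E := Finsupp.lift _ k _ (evalDiword g)

theorem eval_single (g : I → E) (u : Diword I) (s : k) :
    eval k g (Finsupp.single u s) = s • evalDiword g u := by
  simp [eval]

theorem eval_of (g : I → E) (i : I) : eval k g (of k i) = g i := by
  rw [of, eval_single, one_smul]; rfl

variable (k) [Dialgebra k E]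
include k

theorem dashv_rightFold (g : I → E) (z y : E) (w : List I) :
    z ⊣ᵈ rightFold g y w = rightFold g (z ⊣ᵈ y) w := by
  induction w generalizing y with
  | nil => rfl
  | cons x w ih => exact (ih _).trans (by rw [← Dialgebra.dashv_assoc k]; rfl)

/-- In the right argument of `⊣` the two products are indistinguishable, so a left action turns into
a right action on `z`. -/
theorem dashv_leftFold (g : I → E) (z y : E) (w : List I) :
    z ⊣ᵈ leftFold g w y = rightFold g z w ⊣ᵈ y := by
  induction w generalizing z with
  | nil => rfl
  | cons x w ih =>
    exact (Dialgebra.dashv_vdash k z (g x) (leftFold g w y)).trans (ih _)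

theorem leftFold_dashv (g : I → E) (z y : E) (w : List I) :
    leftFold g w z ⊣ᵈ y = leftFold g w (z ⊣ᵈ y) := by
  induction w with
  | nil => rfl
  | cons x w ih =>
    refine (Dialgebra.vdash_dashv k (g x) (leftFold g w z) y).symm.trans ?_
    rw [ih]; rfl

theorem leftFold_vdash (g : I → E) (z y : E) (w : List I) :
    leftFold g w z ⊢ᵈ y = leftFold g w (z ⊢ᵈ y) := by
  induction w with
  | nil => rfl
  | cons x w ih =>
    refine (Dialgebra.vdash_assoc k (g x) (leftFold g w z) y).trans ?_
    rw [ih]; rfl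

theorem rightFold_vdash (g : I → E) (z y : E) (w : List I) :
    rightFold g z w ⊢ᵈ y = z ⊢ᵈ leftFold g w y := by
  induction w generalizing z with
  | nil => rfl
  | cons x w ih =>
    refine (ih _).trans ?_
    rw [Dialgebra.vdash_of_dashv k, Dialgebra.vdash_assoc k]; rfl

theorem evalDiword_dashv (g : I → E) (u v : Diword I) :
    evalDiword g (u.dashv v) = evalDiword g u ⊣ᵈ evalDiword g v := by
  unfold evalDiword
  rw [leftFold_dashv k, dashv_leftFold k, dashv_rightFold k]
  simp [Diword.dashv, Diword.word, rightFold]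

theorem evalDiword_vdash (g : I → E) (u v : Diword I) :
    evalDiword g (u.vdash v) = evalDiword g u ⊢ᵈ evalDiword g v := by
  unfold evalDiword
  rw [leftFold_vdash k, rightFold_vdash k]
  simp [Diword.vdash, Diword.word, leftFold]

end Eval

theorem isDialgebraHom_eval (k : Type*) {I E : Type*} [Field k] [AddCommGroup E] [Module k E]
    [DialgebraMul E] [Dialgebra k E] (g : I → E) : IsDialgebraHom (eval k g) := by
  have key : ∀ (m : Diword I → Diword I → Diword I) (m' : E →ₗ[k] E →ₗ[k] E),
      (∀ u v, evalDiword g (m u v) = m' (evalDiword g u) (evalDiword g v)) →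
      ∀ f h, eval k g (bilin m f h) = m' (eval k g f) (eval k g h) := by
    intro m m' hm f h
    have e : (bilin m).compr₂ (eval k g) = m'.compl₁₂ (eval k g) (eval k g) := by
      refine Finsupp.lhom_ext' fun u => LinearMap.ext_ring
        (Finsupp.lhom_ext' fun v => LinearMap.ext_ring ?_)
      change eval k g (bilin m (Finsupp.single u 1) (Finsupp.single v 1)) =
        m' (eval k g (Finsupp.single u 1)) (eval k g (Finsupp.single v 1))
      rw [bilin_single, eval_single, eval_single, eval_single, mul_one, one_smul, one_smul,
        one_smul, hm]
    exact LinearMap.congr_fun₂ e f h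
  intro f h
  exact ⟨key Diword.dashv (LinearMap.mk₂ k (fun x y => x ⊣ᵈ y) (Dialgebra.add_dashv k)
      Dialgebra.smul_dashv (Dialgebra.dashv_add k) Dialgebra.dashv_smul)
      (evalDiword_dashv k g) f h,
    key Diword.vdash (LinearMap.mk₂ k (fun x y => x ⊢ᵈ y) (Dialgebra.add_vdash k)
      Dialgebra.smul_vdash (Dialgebra.vdash_add k) Dialgebra.vdash_smul)
      (evalDiword_vdash k g) f h⟩

/-- Homomorphisms from the free dialgebra are determined by their values on the generators. -/
theorem isDialgebraHom_ext {k I E : Type*} [Field k] [AddCommGroup E] [Module k E]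
    [DialgebraMul E] {F G : FreeDialgebra k I →ₗ[k] E} (hF : IsDialgebraHom F)
    (hG : IsDialgebraHom G) (h : ∀ i, F (of k i) = G (of k i)) : F = G := by
  have hr : ∀ (i : I) (r : List I), F (Finsupp.single ⟨[], i, r⟩ 1) =
      G (Finsupp.single ⟨[], i, r⟩ 1) := by
    intro i r
    induction r using List.reverseRecOn with
    | nil => exact h i
    | append_singleton r x ih =>
      have e : (Finsupp.single ⟨[], i, r ++ [x]⟩ 1 : FreeDialgebra k I) =
          Finsupp.single ⟨[], i, r⟩ 1 ⊣ᵈ of k x :=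
        ((bilin_single Diword.dashv ⟨[], i, r⟩ ⟨[], x, []⟩ (1 : k) 1).trans
          (by rw [mul_one]; rfl)).symm
      rw [e, (hF _ _).1, (hG _ _).1, ih, h]
  refine Finsupp.lhom_ext' fun ⟨l, i, r⟩ => LinearMap.ext_ring ?_
  change F (Finsupp.single _ 1) = G (Finsupp.single _ 1)
  induction l with
  | nil => exact hr i r
  | cons x l ih =>
    have e : (Finsupp.single ⟨x :: l, i, r⟩ 1 : FreeDialgebra k I) =
        of k x ⊢ᵈ Finsupp.single ⟨l, i, r⟩ 1 :=
      ((bilin_single Diword.vdash ⟨[], x, []⟩ ⟨l, i, r⟩ (1 : k) 1).trans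
        (by rw [mul_one]; rfl)).symm
    rw [e, (hF _ _).2, (hG _ _).2, ih, h]

end FreeDialgebra

/-! ### The universal property -/

section Universal

open FreeDialgebra

variable {k L I : Type*} [Field k] [AddCommGroup L] [Module k L]
  (b : Module.Basis I k L)

theorem letters_basis (i : I) : letters b (b i) = of k i := by simp [letters]

variable [Bracket L L]

theorem envelopingMap_basis (i : I) :
    envelopingMap b (b i) = (dialgebraIdeal k (envelopingRelations b)).mkQ (of k i) := by
  rw [envelopingMap, LinearMap.comp_apply, letters_basis]

theorem mem_envelopingRelations_iff {f : FreeDialgebra k I} :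
    f ∈ envelopingRelations b ↔ ∃ i j, f = -envRel b 1 (b j) (b i) 1 := by
  constructor
  · rintro ⟨i, j, rfl⟩
    refine ⟨i, j, ?_⟩
    rw [of_eq_triple b i, of_vdash_triple, triple_dashv_of, letters_eq_triple]
    simp only [envRel, letter_basis, one_mul, mul_one]
    abel
  · rintro ⟨i, j, rfl⟩
    refine ⟨i, j, ?_⟩
    rw [of_eq_triple b i, of_vdash_triple, triple_dashv_of, letters_eq_triple]
    simp only [envRel, letter_basis, one_mul, mul_one]
    abel

variable [LeibnizAlgebra k L]

theorem envRel_mem_dialgebraIdeal (y x : L) :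
    envRel b 1 y x 1 ∈ dialgebraIdeal k (envelopingRelations b) := by
  have h1 : (1 : WordAlgebra k I) ∈ wordSpan k (· = []) := by
    rw [← word_nil]; exact word_mem_wordSpan rfl
  refine envRel_mem b h1 (mem_span_basis_univ y) (mem_span_basis_univ x) h1 ?_
  rintro _ j i _ rfl - - rfl
  rw [word_nil]
  exact neg_mem_iff.1 (subset_dialgebraIdeal _ ((mem_envelopingRelations_iff b).2 ⟨i, j, rfl⟩))

theorem isLeibnizHom_envelopingMap : IsLeibnizHom (envelopingMap b) := by
  intro x y
  have h := (Submodule.Quotient.mk_eq_zero _).2 (envRel_mem_dialgebraIdeal b y x)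
  have e : envRel b 1 y x 1 = letters b y ⊢ᵈ letters b x - letters b x ⊣ᵈ letters b y +
      letters b ⁅x, y⁆ := by
    simp only [letters_eq_triple, triple_dashv, vdash_triple, forget_triple, envRel, one_mul,
      mul_one]
  rw [e] at h
  change (dialgebraIdeal k (envelopingRelations b)).mkQ _ = 0 at h
  rw [map_add, map_sub, ← mk_dashv_mk, ← mk_vdash_mk] at h
  rw [← neg_sub, eq_neg_iff_add_eq_zero, add_comm]
  exact h

/-- Evaluation at the `δ (b i)` kills the defining relations precisely because `δ` is a Leibniz
homomorphism; uniqueness holds because the generators determine a homomorphism. -/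
theorem isUniversalEnvelopingDialgebra_envelopingMap :
    IsUniversalEnvelopingDialgebra.{w} (envelopingMap b) := by
  refine ⟨inferInstance, isLeibnizHom_envelopingMap b, fun D _ _ _ _ δ hδ => ?_⟩
  have hle : dialgebraIdeal k (envelopingRelations b) ≤
      LinearMap.ker (eval k fun i => δ (b i)) := by
    refine dialgebraIdeal_le (isDialgebraHom_eval k _).isDialgebraIdeal_ker ?_
    rintro _ ⟨i, j, rfl⟩
    have hl : (eval k fun i => δ (b i)) ∘ₗ letters b = δ :=
      b.ext fun i => by rw [LinearMap.comp_apply, letters_basis, eval_of]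
    have hh := isDialgebraHom_eval k (fun i => δ (b i))
    rw [SetLike.mem_coe, LinearMap.mem_ker, map_sub, map_sub, (hh _ _).1, (hh _ _).2, eval_of,
      eval_of, ← LinearMap.comp_apply, hl, hδ, sub_self]
  refine ⟨Submodule.liftQ _ _ hle, ⟨?_, ?_⟩, ?_⟩
  · intro x y
    obtain ⟨x, rfl⟩ := Submodule.mkQ_surjective _ x
    obtain ⟨y, rfl⟩ := Submodule.mkQ_surjective _ y
    rw [mk_dashv_mk, mk_vdash_mk]
    exact isDialgebraHom_eval k _ x y
  · refine b.ext fun i => ?_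
    rw [LinearMap.comp_apply, envelopingMap_basis]
    exact eval_of _ i
  · rintro F ⟨hF, hFδ⟩
    refine Submodule.linearMap_qext _ (isDialgebraHom_ext ?_ ?_ fun i => ?_)
    · intro x y
      simp only [LinearMap.comp_apply, ← mk_dashv_mk, ← mk_vdash_mk]
      exact hF _ _
    · intro x y
      exact isDialgebraHom_eval k _ x y
    · refine Eq.trans ?_ (eval_of _ i).symm
      rw [LinearMap.comp_apply, ← envelopingMap_basis, ← hFδ, LinearMap.comp_apply]

end Universal

end

noncomputable section

/-! ### The two sets of relations generate the same ideal -/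

section Ideal

open FreeDialgebra

variable {k L I : Type*} [Field k] [AddCommGroup L] [Module k L] {b : Module.Basis I k L}

theorem IsDialgebraIdeal.triple_mul_word_mem {J : Submodule k (FreeDialgebra k I)}
    (hJ : IsDialgebraIdeal J) {p q : WordAlgebra k I} {x : L} (h : triple b p x q ∈ J)
    (v : List I) : triple b p x (q * word k v) ∈ J := by
  induction v generalizing q with
  | nil => rwa [word_nil, mul_one]
  | cons i v ih =>
    rw [word_cons, ← mul_assoc]
    refine ih ?_
    rw [← triple_dashv_of]
    exact (hJ _ h _).1

variable [Bracket L L]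

theorem forget_envRel_one (y x : L) : forget (envRel b 1 y x 1) = commRel b x y := by
  simp [envRel, commRel, forget_triple]

/-- The kill rules are consequences of the commutators: `commRel x x` is {x,x}, and `commRel x y +
commRel y x` is {x,y} + {y,x}. The quantification over a subspace lets this be applied on either
side of a center. -/
theorem AssocRule.map_mem [LinearOrder I] {I₀ : Set I}
    (hI₀ : Submodule.span k (b '' I₀) = leibnizKernel k L) {N : Submodule k (WordAlgebra k I)}
    (hN : ∀ x y, commRel b x y ∈ N) {u : List I} {r : WordAlgebra k I}
    (hr : AssocRule b I₀ u r) : r ∈ N := by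
  cases hr with
  | comm i j hij => exact hN _ _
  | kill i hi =>
    have hle : leibnizKernel k L ≤ N.comap (letter b) := by
      have hs : ∀ x, letter b ⁅x, x⁆ ∈ N := fun x => by simpa [commRel] using hN x x
      refine Submodule.span_le.2 ?_
      rintro _ (⟨x, rfl⟩ | ⟨x, y, rfl⟩)
      · exact hs x
      · have e : letter b (⁅x, y⁆ + ⁅y, x⁆) = commRel b x y + commRel b y x := by
          simp only [commRel, map_add]; abel
        rw [SetLike.mem_coe, Submodule.mem_comap, e]
        exact add_mem (hN _ _) (hN _ _)
    have := hle (basis_mem_leibnizKernel hI₀ hi)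
    rwa [Submodule.mem_comap, letter_basis] at this

theorem pbwWord_eq_mkQ (j : I) (l : List I) : pbwWord b j l =
    (dialgebraIdeal k (envelopingRelations b)).mkQ (triple b 1 (b j) (word k l)) := by
  induction l using List.reverseRecOn with
  | nil => rw [word_nil, ← of_eq_triple, ← envelopingMap_basis]; rfl
  | append_singleton l i ih =>
    rw [pbwWord, List.foldl_append, ← pbwWord, ih, List.foldl_cons, List.foldl_nil,
      envelopingMap_basis, mk_dashv_mk, triple_dashv_of, word_append]

variable [LeibnizAlgebra k L]

theorem envRel_word_mem_dialgebraIdeal (l r : List I) (y x : L) :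
    envRel b (word k l) y x (word k r) ∈ dialgebraIdeal k (envelopingRelations b) := by
  have hJ := isDialgebraIdeal_dialgebraIdeal k (envelopingRelations b)
  have hr : envRel b 1 y x (word k r) ∈ dialgebraIdeal k (envelopingRelations b) := by
    induction r using List.reverseRecOn with
    | nil => rw [word_nil]; exact envRel_mem_dialgebraIdeal b y x
    | append_singleton r i ih =>
      convert (hJ _ ih (of k i)).1 using 1
      simp only [envRel, Dialgebra.add_dashv k, sub_eq_add_neg, ← neg_one_smul k (triple _ _ _ _),
        Dialgebra.smul_dashv, triple_dashv_of, word_append, mul_assoc]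
  induction l with
  | nil => rwa [word_nil]
  | cons i l ih =>
    convert (hJ _ ih (of k i)).2.2.2 using 1
    simp only [envRel, Dialgebra.vdash_add k, sub_eq_add_neg, ← neg_one_smul k (triple _ _ _ _),
      Dialgebra.vdash_smul, of_vdash_triple, word_cons k i l, mul_assoc]

variable [LinearOrder I] {I₀ : Set I} (hI₀ : Submodule.span k (b '' I₀) = leibnizKernel k L)

include hI₀

/-- Multiplying an element of the ideal from the left by `⊣` forgets its center, so (a) produces
every `commRel` to the right of any center. -/
theorem triple_right_mem_dialgebraIdeal {u : List I} {r : WordAlgebra k I}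
    (hr : AssocRule b I₀ u r) (p q : WordAlgebra k I) (x : L) (v : List I) :
    triple b p x (q * r * word k v) ∈ dialgebraIdeal k (envelopingRelations b) := by
  have hJ := isDialgebraIdeal_dialgebraIdeal k (envelopingRelations b)
  refine hJ.triple_mul_word_mem ?_ v
  refine hr.map_mem hI₀ (N := (dialgebraIdeal k (envelopingRelations b)).comap
    (triple b p x ∘ₗ LinearMap.mulLeft k q)) fun y z => ?_
  have := (hJ _ (envRel_mem_dialgebraIdeal b z y) (triple b p x q)).2.1
  rwa [triple_dashv, forget_envRel_one] at this

theorem triple_left_mem_dialgebraIdeal {u : List I} {r : WordAlgebra k I}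
    (hr : AssocRule b I₀ u r) (x : L) :
    triple b r x 1 ∈ dialgebraIdeal k (envelopingRelations b) := by
  have hJ := isDialgebraIdeal_dialgebraIdeal k (envelopingRelations b)
  refine hr.map_mem hI₀ (N := (dialgebraIdeal k (envelopingRelations b)).comap
    (((triple b).flip x).flip 1)) fun y z => ?_
  have := (hJ _ (envRel_mem_dialgebraIdeal b z y) (triple b 1 x 1)).2.2.1
  rwa [vdash_triple, forget_envRel_one, mul_one] at this

theorem dialgebraIdeal_envelopingRelations :
    dialgebraIdeal k (envelopingRelations b) = dialgebraIdeal k {f | GSRelation b I₀ f} := by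
  refine le_antisymm
    (dialgebraIdeal_le (isDialgebraIdeal_dialgebraIdeal k _) ?_)
    (dialgebraIdeal_le (isDialgebraIdeal_dialgebraIdeal k _) ?_)
  · intro f hf
    obtain ⟨i, j, rfl⟩ := (mem_envelopingRelations_iff b).1 hf
    exact neg_mem (subset_dialgebraIdeal (k := k) _ (gsRelation_envRel i j))
  · intro f hf
    rcases gsRelation_cases hf with ⟨i, j, rfl⟩ | ⟨u, r, t, hr, rfl⟩ | ⟨u, r, t, hr, rfl⟩
    · exact envRel_mem_dialgebraIdeal b _ _
    · exact triple_left_mem_dialgebraIdeal hI₀ hr _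
    · have := triple_right_mem_dialgebraIdeal hI₀ hr 1 1 (b t) []
      rwa [word_nil, mul_one, one_mul] at this

/-! ### The basis of the enveloping dialgebra -/

theorem span_pbwWord [WellFoundedLT I] :
    Submodule.span k (Set.range fun p : PBWIndex I₀ => pbwWord b p.1.1 p.1.2) = ⊤ := by
  set P := (Submodule.span k (Set.range fun p : PBWIndex I₀ => pbwWord b p.1.1 p.1.2)).comap
    (dialgebraIdeal k (envelopingRelations b)).mkQ with hP
  have hJ : dialgebraIdeal k (envelopingRelations b) ≤ P := fun f hf => by
    rw [hP, Submodule.mem_comap, Submodule.mkQ_apply, (Submodule.Quotient.mk_eq_zero _).2 hf]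
    exact zero_mem _
  -- Sorting to the right of the center: each rule replaces the word by shortlex-smaller ones.
  have hright : ∀ (t : I) (v : List I), triple b 1 (b t) (word k v) ∈ P := by
    intro t v
    induction v using (List.Shortlex.wf (r := (· < ·)) (wellFounded_lt (α := I))).induction with
    | _ v ih =>
    by_cases hv : (∀ i ∈ v, i ∉ I₀) ∧ v.Pairwise (· ≤ ·)
    · exact Submodule.subset_span ⟨⟨(t, v), hv⟩, pbwWord_eq_mkQ t v⟩
    · obtain ⟨a, c, u, r, hr, rfl⟩ := exists_eq_of_not_pairwise (b := b) hv
      rw [← sub_sub_cancel (word k a * r * word k c) (word k (a ++ u ++ c)), triple_sub_right]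
      refine sub_mem (hJ (triple_right_mem_dialgebraIdeal hI₀ hr _ _ _ _)) ?_
      have hle : wordSpan k (ShortlexLT · (a ++ u ++ c)) ≤ P.comap (triple b 1 (b t)) := by
        refine Submodule.span_le.2 ?_
        rintro _ ⟨w, hw, rfl⟩
        exact ih w hw
      exact hle (hr.mul_sub_word_mem a c)
  -- Relation (a) empties the left word one letter at a time. The center ranges over all of `L`
  -- because a bracket takes its place.
  have hall : ∀ (l : List I) (x : L) (r : List I), triple b (word k l) x (word k r) ∈ P := by
    intro l
    induction l using List.reverseRecOn with
    | nil =>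
      intro x r
      rw [word_nil]
      induction x using basis_induction (b := b) with
      | basis t => exact hright t r
      | add x y hx hy => rw [triple_add_center]; exact add_mem hx hy
      | smul s x hx => rw [map_smul, LinearMap.smul_apply]; exact P.smul_mem s hx
      | zero => simp
    | append_singleton l i ih =>
      intro x r
      have e : triple b (word k (l ++ [i])) x (word k r) =
          envRel b (word k l) (b i) x (word k r) + triple b (word k l) x (word k (i :: r)) -
          triple b (word k l) ⁅x, b i⁆ (word k r) := by
        rw [envRel, letter_basis, word_append, word_cons k i r]; abel
      rw [e]
      exact sub_mem (add_mem (hJ (envRel_word_mem_dialgebraIdeal _ _ _ _)) (ih _ _)) (ih _ _)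
  have htop : ∀ f, f ∈ P := by
    intro f
    induction f using Finsupp.induction_linear with
    | zero => exact zero_mem P
    | add f g hf hg => exact add_mem hf hg
    | single u s =>
      have e : (Finsupp.single u s : FreeDialgebra k I) = s • Finsupp.single u 1 := by simp
      rw [e]
      refine P.smul_mem s ?_
      have := hall u.left (b u.center) u.right
      rwa [triple_word] at this
  refine eq_top_iff.2 fun x _ => ?_
  obtain ⟨f, rfl⟩ := Submodule.mkQ_surjective _ x
  exact htop f

end Ideal

end

noncomputable section

/-! ### A model of the enveloping dialgebra -/

section Model

open FreeDialgebra TensorProduct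

variable {k L I : Type*} [Field k] [AddCommGroup L] [Module k L] {b : Module.Basis I k L}

theorem FreeDialgebra.forget_dashv (b : Module.Basis I k L) (f g : FreeDialgebra k I) :
    forget (f ⊣ᵈ g) = forget f * forget g := by
  have h : forget ∘ₗ (bilin Diword.dashv).flip g =
      LinearMap.mulRight k (forget g) ∘ₗ (forget : FreeDialgebra k I →ₗ[k] _) := by
    refine triple_hom_ext b fun p x q => ?_
    change forget (triple b p x q ⊣ᵈ g) = forget (triple b p x q) * forget g
    rw [triple_dashv, forget_triple, forget_triple, mul_assoc _ q]
  exact LinearMap.congr_fun h f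

theorem FreeDialgebra.forget_vdash (b : Module.Basis I k L) (f g : FreeDialgebra k I) :
    forget (f ⊢ᵈ g) = forget f * forget g := by
  have h : forget ∘ₗ bilin Diword.vdash f =
      LinearMap.mulLeft k (forget f) ∘ₗ (forget : FreeDialgebra k I →ₗ[k] _) := by
    refine triple_hom_ext b fun p x q => ?_
    change forget (f ⊢ᵈ triple b p x q) = forget f * forget (triple b p x q)
    rw [vdash_triple, forget_triple, forget_triple, mul_assoc, mul_assoc, mul_assoc]
  exact LinearMap.congr_fun h g

/-! ### The ideal of the rewriting rules -/

theorem mem_wordSpan_true (p : WordAlgebra k I) : p ∈ wordSpan k fun _ => True := by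
  induction p using WordAlgebra.induction with
  | word v => exact word_mem_wordSpan trivial
  | add p q hp hq => exact add_mem hp hq
  | smul s p hp => exact Submodule.smul_mem _ s hp

section RuleIdeal

variable [Bracket L L] [LinearOrder I] {I₀ : Set I}

variable (b I₀) in
/-- The ideal generated by the rewriting rules. -/
def ruleIdeal : Submodule k (WordAlgebra k I) := ruleSpan b I₀ fun _ => True

theorem mul_mem_ruleIdeal (p : WordAlgebra k I) {q : WordAlgebra k I} (hq : q ∈ ruleIdeal b I₀) :
    p * q ∈ ruleIdeal b I₀ :=
  mul_mem_ruleSpan (fun _ _ _ _ => trivial) (mem_wordSpan_true p) hq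

theorem ruleIdeal_mul_mem {p : WordAlgebra k I} (hp : p ∈ ruleIdeal b I₀) (q : WordAlgebra k I) :
    p * q ∈ ruleIdeal b I₀ :=
  ruleSpan_mul_mem (fun _ _ _ _ => trivial) hp (mem_wordSpan_true q)

variable (b I₀) in
/-- The subspace of `L ⊗ k⟨I⟩` spanned by the `x ⊗ p` with `p` in the ideal of the rules. -/
def modelIdeal : Submodule k (L ⊗[k] WordAlgebra k I) :=
  Submodule.span k {z | ∃ x, ∃ p ∈ ruleIdeal b I₀, z = x ⊗ₜ p}

theorem tmul_mem_modelIdeal (x : L) {p : WordAlgebra k I} (hp : p ∈ ruleIdeal b I₀) :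
    x ⊗ₜ p ∈ modelIdeal b I₀ := Submodule.subset_span ⟨x, p, hp, rfl⟩

end RuleIdeal

/-! ### Left and right actions on the model -/

variable [Bracket L L] [LeibnizAlgebra k L]

variable (b) in
/-- The action `y (x ⊗ u) = x ⊗ y u - {x, y} ⊗ u` of `L` on `L ⊗ k⟨I⟩`. -/
def leibnizAct (y : L) : Module.End k (L ⊗[k] WordAlgebra k I) :=
  LinearMap.lTensor L (LinearMap.mulLeft k (letter b y)) -
    LinearMap.rTensor (WordAlgebra k I) ((leibnizBracket k).flip y)

variable (b) in
/-- The action of the free associative algebra on `L ⊗ k⟨I⟩`. -/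
def wordAct : WordAlgebra k I →ₐ[k] Module.End k (L ⊗[k] WordAlgebra k I) :=
  MonoidAlgebra.lift k _ _ (FreeMonoid.lift fun i => leibnizAct b (b i))

theorem wordAct_letter (y x : L) (u : WordAlgebra k I) :
    wordAct b (letter b y) (x ⊗ₜ u) = x ⊗ₜ (letter b y * u) - ⁅x, y⁆ ⊗ₜ u := by
  induction y using basis_induction (b := b) with
  | basis i =>
    rw [letter_basis, word_eq_of, wordAct, MonoidAlgebra.lift_of, ← word_eq_of, ← letter_basis b]
    rfl
  | add y z hy hz =>
    rw [map_add, map_add, LinearMap.add_apply, hy, hz, add_mul, LeibnizAlgebra.bracket_add k,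
      TensorProduct.tmul_add, TensorProduct.add_tmul]
    abel
  | smul s y hy =>
    rw [map_smul, map_smul, LinearMap.smul_apply, hy, smul_mul_assoc, LeibnizAlgebra.bracket_smul,
      TensorProduct.tmul_smul, ← TensorProduct.smul_tmul', smul_sub]
  | zero => simp [← leibnizBracket_apply k]

/-- The terms with brackets at the first factor cancel by the Leibniz identity, so a commutator
relation acts by plain left multiplication on the second factor. -/
theorem wordAct_commRel (x y t : L) (u : WordAlgebra k I) :
    wordAct b (commRel b x y) (t ⊗ₜ u) = t ⊗ₜ (commRel b x y * u) := by
  have jac := LeibnizAlgebra.leibniz k t x y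
  simp only [commRel, map_add, map_sub, map_mul, LinearMap.add_apply, LinearMap.sub_apply,
    Module.End.mul_apply, wordAct_letter, jac, add_mul, sub_mul,
    TensorProduct.tmul_add, TensorProduct.tmul_sub, TensorProduct.add_tmul, mul_assoc]
  abel

/-- Right multiplication on `L ⊗ k⟨I⟩`. -/
def tensorMulRight (q : WordAlgebra k I) : Module.End k (L ⊗[k] WordAlgebra k I) :=
  LinearMap.lTensor L (LinearMap.mulRight k q)

theorem wordAct_word_cons (i : I) (v : List I) (z : L ⊗[k] WordAlgebra k I) :
    wordAct b (word k (i :: v)) z = wordAct b (letter b (b i)) (wordAct b (word k v) z) := by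
  rw [word_cons, map_mul, letter_basis]; rfl

theorem wordAct_letter_tensorMulRight (y : L) (q : WordAlgebra k I)
    (z : L ⊗[k] WordAlgebra k I) : wordAct b (letter b y) (tensorMulRight q z) =
      tensorMulRight q (wordAct b (letter b y) z) := by
  induction z using TensorProduct.induction_on with
  | zero => simp
  | tmul x u =>
    simp only [tensorMulRight, LinearMap.lTensor_tmul, LinearMap.mulRight_apply, wordAct_letter,
      map_sub, mul_assoc]
  | add z z' h h' => simp only [map_add, h, h']

theorem wordAct_tensorMulRight (p q : WordAlgebra k I) (z : L ⊗[k] WordAlgebra k I) :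
    wordAct b p (tensorMulRight q z) = tensorMulRight q (wordAct b p z) := by
  induction p using WordAlgebra.induction with
  | word v =>
    induction v with
    | nil => simp [word_nil]
    | cons i v ih => rw [wordAct_word_cons, wordAct_word_cons, ih, wordAct_letter_tensorMulRight]
  | add p p' h h' => simp only [map_add, LinearMap.add_apply, h, h']
  | smul s p h => simp only [map_smul, LinearMap.smul_apply, h]

variable (b) in
/-- The map from the free dialgebra to its model, `l ⊢ x ⊣ r ↦ l (x ⊗ r)`. -/
def toModel : FreeDialgebra k I →ₗ[k] L ⊗[k] WordAlgebra k I :=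
  Finsupp.lift _ k _ fun u => wordAct b (word k u.left) (b u.center ⊗ₜ word k u.right)

theorem toModel_triple (p q : WordAlgebra k I) (x : L) :
    toModel b (triple b p x q) = wordAct b p (x ⊗ₜ q) := by
  induction p using WordAlgebra.induction with
  | word l =>
    induction x using basis_induction (b := b) with
    | basis i =>
      induction q using WordAlgebra.induction with
      | word r => rw [triple_word]; simp [toModel]
      | add p q hp hq => rw [map_add, map_add, hp, hq, TensorProduct.tmul_add, map_add]
      | smul s p hp => rw [map_smul, map_smul, hp, TensorProduct.tmul_smul, map_smul]
    | add p q hp hq => rw [triple_add_center, map_add, hp, hq, TensorProduct.add_tmul, map_add]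
    | smul s p hp =>
      rw [map_smul, LinearMap.smul_apply, map_smul, hp, ← TensorProduct.smul_tmul', map_smul]
    | zero => simp
  | add p q hp hq => rw [triple_add_left, map_add, hp, hq, map_add, LinearMap.add_apply]
  | smul s p hp =>
    rw [map_smul, LinearMap.smul_apply, LinearMap.smul_apply, map_smul, hp, map_smul,
      LinearMap.smul_apply]

theorem toModel_dashv (f g : FreeDialgebra k I) :
    toModel b (f ⊣ᵈ g) = tensorMulRight (forget g) (toModel b f) := by
  have h : toModel b ∘ₗ (bilin Diword.dashv).flip g =
      tensorMulRight (forget g) ∘ₗ toModel b := by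
    refine triple_hom_ext b fun p x q => ?_
    change toModel b (triple b p x q ⊣ᵈ g) = tensorMulRight _ (toModel b (triple b p x q))
    rw [triple_dashv, toModel_triple, toModel_triple, ← wordAct_tensorMulRight]
    rfl
  exact LinearMap.congr_fun h f

theorem toModel_vdash (f g : FreeDialgebra k I) :
    toModel b (f ⊢ᵈ g) = wordAct b (forget f) (toModel b g) := by
  have h : toModel b ∘ₗ bilin Diword.vdash f = wordAct b (forget f) ∘ₗ toModel b := by
    refine triple_hom_ext b fun p x q => ?_
    change toModel b (f ⊢ᵈ triple b p x q) = wordAct b _ (toModel b (triple b p x q))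
    rw [vdash_triple, toModel_triple, toModel_triple, map_mul]
    rfl
  exact LinearMap.congr_fun h g

/-- The left action was defined so that (a) holds in the model. -/
theorem toModel_envRel (y x : L) : toModel b (envRel b 1 y x 1) = 0 := by
  simp [envRel, toModel_triple, wordAct_letter]

/-! ### The kernel of the model -/

section ModelIdeal

variable [LinearOrder I] {I₀ : Set I}

omit [LeibnizAlgebra k L] in
theorem tensorMulRight_mem_modelIdeal (q : WordAlgebra k I) {z : L ⊗[k] WordAlgebra k I}
    (hz : z ∈ modelIdeal b I₀) : tensorMulRight q z ∈ modelIdeal b I₀ := by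
  suffices modelIdeal b I₀ ≤ (modelIdeal b I₀).comap (tensorMulRight q) from this hz
  refine Submodule.span_le.2 ?_
  rintro _ ⟨x, p, hp, rfl⟩
  exact tmul_mem_modelIdeal x (ruleIdeal_mul_mem hp q)

omit [LeibnizAlgebra k L] in
theorem tensorMulRight_mem_modelIdeal_of_mem {q : WordAlgebra k I} (hq : q ∈ ruleIdeal b I₀)
    (z : L ⊗[k] WordAlgebra k I) : tensorMulRight q z ∈ modelIdeal b I₀ := by
  induction z using TensorProduct.induction_on with
  | zero => simp
  | tmul x u => exact tmul_mem_modelIdeal x (mul_mem_ruleIdeal u hq)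
  | add z z' h h' => rw [map_add]; exact add_mem h h'

theorem wordAct_mem_modelIdeal (p : WordAlgebra k I) {z : L ⊗[k] WordAlgebra k I}
    (hz : z ∈ modelIdeal b I₀) : wordAct b p z ∈ modelIdeal b I₀ := by
  induction p using WordAlgebra.induction with
  | word v =>
    induction v with
    | nil => simpa [word_nil] using hz
    | cons i v ih =>
      rw [wordAct_word_cons]
      suffices modelIdeal b I₀ ≤ (modelIdeal b I₀).comap (wordAct b (letter b (b i))) from this ih
      refine Submodule.span_le.2 ?_
      rintro _ ⟨x, p, hp, rfl⟩
      rw [SetLike.mem_coe, Submodule.mem_comap, wordAct_letter]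
      exact sub_mem (tmul_mem_modelIdeal x (mul_mem_ruleIdeal _ hp)) (tmul_mem_modelIdeal _ hp)
  | add p p' h h' => rw [map_add]; exact add_mem h h'
  | smul s p h => rw [map_smul]; exact Submodule.smul_mem _ s h

variable (hI₀ : Submodule.span k (b '' I₀) = leibnizKernel k L)

include hI₀

/-- Commutator rules act by multiplication on the second factor, and so do the killed letters, since
{t, x_i} = 0 for `i ∈ I₀`. -/
theorem wordAct_mem_modelIdeal_of_mem {p : WordAlgebra k I} (hp : p ∈ ruleIdeal b I₀)
    (z : L ⊗[k] WordAlgebra k I) : wordAct b p z ∈ modelIdeal b I₀ := by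
  suffices ruleIdeal b I₀ ≤
      (modelIdeal b I₀).comap ((wordAct b).toLinearMap.flip z) from this hp
  refine ruleSpan_le_iff.2 fun a c u r hr _ => ?_
  change wordAct b (word k a * r * word k c) z ∈ modelIdeal b I₀
  rw [map_mul, map_mul]
  refine wordAct_mem_modelIdeal (word k a) ?_
  generalize wordAct b (word k c) z = z
  induction z using TensorProduct.induction_on with
  | zero => simp
  | tmul t v =>
    have hmem := ruleIdeal_mul_mem (hr.mem_ruleSpan (P := fun _ => True) trivial) v
    cases hr with
    | comm i j hij => rw [wordAct_commRel]; exact tmul_mem_modelIdeal t hmem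
    | kill i hi =>
      rw [← letter_basis b, wordAct_letter,
        bracket_leibnizKernel k t (basis_mem_leibnizKernel hI₀ hi), TensorProduct.zero_tmul,
        sub_zero, letter_basis]
      exact tmul_mem_modelIdeal t hmem
  | add z z' h h' => rw [map_add]; exact add_mem h h'

theorem toModel_mem_modelIdeal {f : FreeDialgebra k I}
    (hf : f ∈ dialgebraIdeal k (envelopingRelations b)) : toModel b f ∈ modelIdeal b I₀ := by
  -- The image in the model alone does not define an ideal: a non-central factor acts through
  -- `forget`, so `forget` must be kept in the rule ideal at the same time.
  have hK : IsDialgebraIdeal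
      ((ruleIdeal b I₀).comap forget ⊓ (modelIdeal b I₀).comap (toModel b)) := by
    rintro f ⟨h₁, h₂⟩ g
    simp only [SetLike.mem_coe, Submodule.mem_comap] at h₁ h₂
    simp only [Submodule.mem_inf, Submodule.mem_comap, forget_dashv b, forget_vdash b,
      toModel_dashv, toModel_vdash]
    exact ⟨⟨ruleIdeal_mul_mem h₁ _, tensorMulRight_mem_modelIdeal _ h₂⟩,
      ⟨mul_mem_ruleIdeal _ h₁, tensorMulRight_mem_modelIdeal_of_mem h₁ _⟩,
      ⟨ruleIdeal_mul_mem h₁ _, wordAct_mem_modelIdeal_of_mem hI₀ h₁ _⟩,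
      ⟨mul_mem_ruleIdeal _ h₁, wordAct_mem_modelIdeal _ h₂⟩⟩
  refine (dialgebraIdeal_le hK ?_ hf).2
  intro f hf
  obtain ⟨i, j, rfl⟩ := (mem_envelopingRelations_iff b).1 hf
  refine neg_mem ⟨?_, ?_⟩
  · rw [SetLike.mem_coe, Submodule.mem_comap, forget_envRel_one]
    exact ruleSpan_mono (fun _ _ => trivial) (commRel_mem_ruleSpan hI₀ _ _)
  · rw [SetLike.mem_coe, Submodule.mem_comap, toModel_envRel]
    exact zero_mem _

/-- The Poincaré–Birkhoff–Witt statement for L/L₀: by confluence the rule ideal meets the span of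
irreducible words only in zero. -/
theorem linearIndependent_mkQ_word [WellFoundedLT I] :
    LinearIndependent k fun v : {l : List I // (∀ i ∈ l, i ∉ I₀) ∧ l.Pairwise (· ≤ ·)} =>
      (ruleIdeal b I₀).mkQ (word k v.1) := by
  refine LinearIndependent.map
    (((wordBasis k I).linearIndependent).comp _ Subtype.val_injective) ?_
  rw [Submodule.ker_mkQ, Submodule.disjoint_def]
  intro p hp hJ
  refine eq_zero_of_mem_ruleSpan_of_irreducible hI₀ hJ (Submodule.span_mono ?_ hp)
  rintro _ ⟨v, rfl⟩
  exact ⟨v.1, irreducibleWord_of_pairwise b v.2.1 v.2.2, rfl⟩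

/-- The words go to pure tensors of a basis of `L` with independent classes modulo the rule ideal,
and such tensors are independent over a field. -/
theorem linearIndependent_pbwWord [WellFoundedLT I] :
    LinearIndependent k fun p : PBWIndex I₀ => pbwWord b p.1.1 p.1.2 := by
  have hle : dialgebraIdeal k (envelopingRelations b) ≤
      LinearMap.ker (LinearMap.lTensor L (ruleIdeal b I₀).mkQ ∘ₗ toModel b) := fun f hf => by
    suffices modelIdeal b I₀ ≤ LinearMap.ker (LinearMap.lTensor L (ruleIdeal b I₀).mkQ) from
      this (toModel_mem_modelIdeal hI₀ hf)
    refine Submodule.span_le.2 ?_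
    rintro _ ⟨x, p, hp, rfl⟩
    rw [SetLike.mem_coe, LinearMap.mem_ker, LinearMap.lTensor_tmul, Submodule.mkQ_apply,
      (Submodule.Quotient.mk_eq_zero _).2 hp, TensorProduct.tmul_zero]
  refine LinearIndependent.of_comp (Submodule.liftQ _ _ hle) ?_
  have e : Submodule.liftQ _ _ hle ∘ (fun p : PBWIndex I₀ => pbwWord b p.1.1 p.1.2) =
      (fun p : I × {l : List I // (∀ i ∈ l, i ∉ I₀) ∧ l.Pairwise (· ≤ ·)} =>
        b p.1 ⊗ₜ[k] (ruleIdeal b I₀).mkQ (word k p.2.1)) ∘ fun p => (p.1.1, ⟨p.1.2, p.2⟩) := by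
    funext p
    rw [Function.comp_apply, pbwWord_eq_mkQ, Submodule.mkQ_apply, Submodule.liftQ_apply,
      LinearMap.comp_apply, toModel_triple, map_one]
    rfl
  rw [e]
  refine (b.linearIndependent.tmul_of_flat_left (linearIndependent_mkQ_word hI₀)).comp _ ?_
  rintro ⟨⟨i, l⟩, h⟩ ⟨⟨j, l'⟩, h'⟩ e
  simpa using e

theorem injective_envelopingMap [WellFoundedLT I] : Function.Injective (envelopingMap b) := by
  -- The words with `n = 0` are the images of the basis vectors, so a basis of `L` goes to an
  -- independent family.
  have h := (linearIndependent_pbwWord hI₀).comp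
    (fun i : I => (⟨(i, []), by simp⟩ : PBWIndex I₀)) fun i j e => by simpa using e
  have e : envelopingMap b =
      Finsupp.linearCombination k (fun i => envelopingMap b (b i)) ∘ₗ b.repr.toLinearMap :=
    b.ext fun i => by simp
  rw [e, LinearMap.coe_comp]
  exact Function.Injective.comp h b.repr.injective

end ModelIdeal

end Model

end

theorem mainTheorem2 {k L I : Type*} [Field k] [AddCommGroup L] [Module k L] [Bracket L L]
    [LeibnizAlgebra k L] [LinearOrder I] [WellFoundedLT I] (b : Module.Basis I k L) (I₀ : Set I)
    (hI₀ : Submodule.span k (b '' I₀) = leibnizKernel k L) :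
    IsUniversalEnvelopingDialgebra.{w} (envelopingMap b) ∧
    dialgebraIdeal k (envelopingRelations b) = dialgebraIdeal k {f | GSRelation b I₀ f} ∧
    FreeDialgebra.IsGroebnerShirshovBasis {f | GSRelation b I₀ f} ∧
    (LinearIndependent k (fun p : PBWIndex I₀ => pbwWord b p.1.1 p.1.2) ∧
      Submodule.span k (Set.range fun p : PBWIndex I₀ => pbwWord b p.1.1 p.1.2) = ⊤) ∧
    (IsLeibnizHom (envelopingMap b) ∧ Function.Injective (envelopingMap b)) :=
  ⟨isUniversalEnvelopingDialgebra_envelopingMap b, dialgebraIdeal_envelopingRelations hI₀,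
    FreeDialgebra.isGroebnerShirshovBasis_gsRelation hI₀,
    ⟨linearIndependent_pbwWord hI₀, span_pbwWord hI₀⟩,
    isLeibnizHom_envelopingMap b, injective_envelopingMap hI₀⟩
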